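/- Let $n\ge 1$, $1<q<\infty$ and $1/p+1/q=1$. Let $k(t,x;y)\in\mathbf R$ be a kernel, $t>0$, $x,y\in\mathbf R^n$, such that, for some $\delta>0$ and $C_0<\infty$, $$|k(t+s,x+z;y)-k(t,x;y)|\le C_0\frac{|(s,z)|^\delta}{|(t,x)-(0,y)|^{n+\delta}}\quad\text{for } |(s,z)|\le |(t,x)-(0,y)|/2,$$ $$|k(t,x;y+z)-k(t,x;y)|\le C_0\frac{|z|^\delta}{|(t,x)-(0,y)|^{n+\delta}}\quad\text{for } |z|\le |(t,x)-(0,y)|/2,$$ for all $s,t>0$ and $x,y,z\in\mathbf R^n$. Write $S^*f(t,x)=\int_{\mathbf R^n}k(t,x;y)f(y)\,dy$ and, for an aperture $\alpha>0$, $NF(z)=\operatorname{ess\,sup}_{(t,x):|x-z|<\alpha t}|F(t,x)|$. Assume that, for some aperture, $\|N(S^*f)\|_{L_2(\mathbf R^n)}\le C_1\|f\|_{L_2(\mathbf R^n)}$ for all $f\in L_2(\mathbf R^n)$. For a weight $\nu>0$ on $\mathbf R^n$, let $$[\nu]_{A_q}=\sup_Q\Big(\frac1{|Q|}\int_Q\nu\,dx\Big)\Big(\frac1{|Q|}\int_Q\nu^{-1/(q-1)}dx\Big)^{q-1},$$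 the supremum being over all axis-parallel cubes $Q$, write $\nu\in A_q$ if $[\nu]_{A_q}<\infty$, and let $L_q(\nu)=L_q(\mathbf R^n,\nu\,dx)$. Then, for every $\nu\in A_q$ and $f\in L_q(\nu)$, the integral defining $S^*f(t,x)$ converges absolutely for all $t>0$ and $x\in\mathbf R^n$; and for every aperture $\alpha>0$ used in the definition of $N$ there is a constant $C<\infty$, independent of $\nu$ and $f$, such that $$\|N(S^*f)\|_{L_q(\nu)}\le C\,[\nu]_{A_q}^{\max(1,p/q)}\,\|f\|_{L_q(\nu)}\qquad\text{for all }\nu\in A_q,\ f\in L_q(\nu).$$ Moreover, the power $\max(1,p/q)$ is sharp: for all $n\ge1$ and $1<q<\infty$ there is a kernel $k$ satisfying the assumptions above such that, for every aperture $\alpha>0$ and every $\beta<\max(1,p/q)$, there is no constant $C<\infty$ with $\|N(S^*f)\|_{L_q(\nu)}\le C[\nu]_{A_q}^{\beta}\|f\|_{L_q(\nu)}$ for all $\nu\in A_q$ and $f\in L_q(\nu)$. -/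

import Mathlib

open MeasureTheory
open scoped ENNReal NNReal

noncomputable section

namespace NTMax

/-- `ℝⁿ` with the Euclidean norm. -/
abbrev Rn (n : ℕ) : Type := EuclideanSpace ℝ (Fin n)

/-- The Euclidean norm `|(s, z)|` of a vector of `ℝ^{1+n} = ℝ × ℝⁿ`. -/
def enorm2 {n : ℕ} (s : ℝ) (z : Rn n) : ℝ := Real.sqrt (s ^ 2 + ‖z‖ ^ 2)

/-- Off-diagonal Hölder regularity, of order `δ`, of the kernel in the half-space variable
`(t, x)`. -/
def XRegular {n : ℕ} (k : ℝ → Rn n → Rn n → ℝ) (δ : ℝ) : Prop :=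
  ∃ C : ℝ, ∀ (s t : ℝ) (x y z : Rn n), 0 < s → 0 < t →
    enorm2 s z ≤ enorm2 t (x - y) / 2 →
      |k (t + s) (x + z) y - k t x y| ≤ C * (enorm2 s z ^ δ / enorm2 t (x - y) ^ ((n : ℝ) + δ))

/-- Off-diagonal Hölder regularity, of order `δ`, of the kernel in the boundary variable `y`. -/
def YRegular {n : ℕ} (k : ℝ → Rn n → Rn n → ℝ) (δ : ℝ) : Prop :=
  ∃ C : ℝ, ∀ (t : ℝ) (x y z : Rn n), 0 < t →
    ‖z‖ ≤ enorm2 t (x - y) / 2 →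
      |k t x (y + z) - k t x y| ≤ C * (‖z‖ ^ δ / enorm2 t (x - y) ^ ((n : ℝ) + δ))

/-- The operator `S^* f (t, x) = ∫ k(t, x; y) f(y) dy`. -/
def Sstar {n : ℕ} (k : ℝ → Rn n → Rn n → ℝ) (f : Rn n → ℝ) (t : ℝ) (x : Rn n) : ℝ :=
  ∫ y, k t x y * f y

/-- The cone of aperture `α` in the upper half-space, with vertex at the boundary point `z`. -/
def cone {n : ℕ} (α : ℝ) (z : Rn n) : Set (ℝ × Rn n) :=
  {P | 0 < P.1 ∧ ‖P.2 - z‖ < α * P.1}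

/-- The non-tangential maximal function
`N F (z) = ess sup_{(t, x) : |x - z| < α t} |F (t, x)|`, with values in `[0, ∞]`. -/
def ntMax {n : ℕ} (α : ℝ) (F : ℝ → Rn n → ℝ) (z : Rn n) : ℝ≥0∞ :=
  essSup (fun P : ℝ × Rn n => ‖F P.1 P.2‖ₑ) (volume.restrict (cone α z))

/-- The estimate `‖N (S^* f)‖_{L_2} ≤ C ‖f‖_{L_2}` for all `f ∈ L_2(ℝⁿ)`, where `N` has aperture
`α`. -/
def L2NontangentialEstimate {n : ℕ} (k : ℝ → Rn n → Rn n → ℝ) (α : ℝ) : Prop :=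
  ∃ C : ℝ≥0, ∀ f : Rn n → ℝ, MemLp f 2 volume →
    eLpNorm (ntMax α (Sstar k f)) 2 volume ≤ C * eLpNorm f 2 volume

/-- The axis-parallel cube with lower corner `a` and side length `l`. -/
def cube {n : ℕ} (a : Rn n) (l : ℝ) : Set (Rn n) :=
  {x | ∀ i, x i ∈ Set.Ico (a i) (a i + l)}

/-- The Muckenhoupt characteristic
`[ν]_{A_q} = sup_Q (⨍_Q ν) (⨍_Q ν^{-1/(q-1)})^{q-1}`, the supremum over all cubes. -/
def aqChar {n : ℕ} (q : ℝ) (ν : Rn n → ℝ) : ℝ≥0∞ :=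
  ⨆ (a : Rn n) (l : ℝ) (_ : 0 < l),
    (⨍⁻ x in cube a l, ENNReal.ofReal (ν x) ∂volume) *
      (⨍⁻ x in cube a l, ENNReal.ofReal (ν x ^ (-1 / (q - 1))) ∂volume) ^ (q - 1)

/-- `ν` is an `A_q` weight. -/
structure IsAqWeight {n : ℕ} (q : ℝ) (ν : Rn n → ℝ) : Prop where
  aemeasurable : AEMeasurable ν volume
  pos : ∀ᵐ x, 0 < ν x
  char_lt_top : aqChar q ν < ∞

/-- The measure `dν = ν dx`. -/
def weightMeasure {n : ℕ} (ν : Rn n → ℝ) : Measure (Rn n) :=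
  volume.withDensity fun x => ENNReal.ofReal (ν x)

/-- The estimate `‖N (S^* f)‖_{L_q(ν)} ≤ C [ν]_{A_q}^β ‖f‖_{L_q(ν)}` for all `ν ∈ A_q` and all
`f ∈ L_q(ν)`, with one constant `C`, where `N` has aperture `α`. -/
def WeightedEstimate {n : ℕ} (k : ℝ → Rn n → Rn n → ℝ) (q α β : ℝ) : Prop :=
  ∃ C : ℝ≥0, ∀ ν : Rn n → ℝ, IsAqWeight q ν →
    ∀ f : Rn n → ℝ, MemLp f (ENNReal.ofReal q) (weightMeasure ν) →
      eLpNorm (ntMax α (Sstar k f)) (ENNReal.ofReal q) (weightMeasure ν) ≤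
        C * aqChar q ν ^ β * eLpNorm f (ENNReal.ofReal q) (weightMeasure ν)

/-- The standing assumptions on the kernel: regularity in both variables, of some order `δ > 0`,
and the `L_2` non-tangential estimate for some aperture. -/
def Admissible {n : ℕ} (k : ℝ → Rn n → Rn n → ℝ) : Prop :=
  (∃ δ : ℝ, 0 < δ ∧ XRegular k δ ∧ YRegular k δ) ∧
    ∃ α : ℝ, 0 < α ∧ L2NontangentialEstimate k α

end NTMax

end

/-! Upper bound. The regularity hypotheses only compare values of `k`; the `L_2` estimate supplies
its size. If `|k t x y|` were much larger than `ρ^{-n}`, where `ρ` is the distance from `(t, x)` to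
`(0, y)`, then `k` would be nearly constant in a neighbourhood of size proportional to `ρ`, and
`S^*` of the indicator of a ball around `y` would be too large on a piece of many cones
(`exists_size_le`). With size and regularity, values of `S^* f` at neighbouring points differ by at
most a multiple of the maximal function `maxFn` of `f` (`RegKernel.exists_enorm_Sstar_le_add`).
Hence essential suprema over cones, true suprema over cones of any aperture and suprema over
vertical lines agree up to `maxFn`, and the aperture plays no role.

A Calderón–Zygmund decomposition gives the weak type (1,1) bound for the vertical supremum
(`RegKernel.exists_vertSup_weak_type`): the good part uses `L_2`, and the bad part uses cancellation
and regularity in `y`. Weak type then drives a stopping-time argument. On a cube `Q`, outside an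
exceptional set of at most half its measure, the cone supremum is at most a constant times an
average of `|f|` over the tripled cube; inside a maximal dyadic cube `P` of the exceptional set, `f`
is replaced by its restriction to the tripled `P`, again at the cost of that average. Iteration
gives pointwise domination by a sparse operator (`RegKernel.exists_sparse`).

The sparse operator is bounded by duality. The tripled cubes split into `3^n` nested families. In
each, the `A_q` condition is moved from the cubes to the disjoint sets of the sparse family. For `q
≥ 2` this costs one factor `[ν]_{A_q}` (`sparse_term_le_real`), and what remains is Hölder's
inequality and Carleson embedding for the two measures `ν dx` and `ν^{-1/(q-1)} dx`. For `q < 2` the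
two measures exchange roles and the factor becomes `[ν]_{A_q}^{1/(q-1)}`; since `p/q = 1/(q-1)`,
this is the stated power. Truncation and Fatou's lemma extend the bound from bounded, compactly
supported `f` to `L_q(ν)`. Absolute convergence follows from the kernel size and geometric growth of
the `ν`-measure of expanding cubes.

Sharpness. For `k = (t + |x| + |y|)^{-n}` the function `N(S^* f)` is comparable, for `f ≥ 0`, to the
Hardy-type integral of `f(y) (|z| + |y|)^{-n}`, which is bounded on `L_2` by Schur's test. The
weights `|x|^{nε-n}` have characteristic at most a multiple of `1/ε`, and their powers with exponent
`-(q-1)` at most a multiple of `ε^{-(q-1)}`. In both cases a test function makes the operator norm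
at least a multiple of `1/ε`, so letting `ε → 0` excludes every smaller power. -/

noncomputable section
namespace NTMax

variable {n : ℕ}

/-! ### Dyadic cubes -/

/-- The side length `2^{-k}` of the dyadic cubes of generation `k`. -/
def len (k : ℤ) : ℝ := (2 : ℝ) ^ (-k)

/-- The lower corner, in units of the side length, of the dyadic cube of generation `k` that
contains `x`. -/
def idx (k : ℤ) (x : Rn n) : Fin n → ℤ := fun i => ⌊(2 : ℝ) ^ k * x i⌋

/-- The dyadic cube of generation `k` and position `m`. -/
def dy (k : ℤ) (m : Fin n → ℤ) : Set (Rn n) := {x | idx k x = m}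

/-- The dyadic cube `dy k m`, dilated by the factor three about its centre. -/
def tri (k : ℤ) (m : Fin n → ℤ) : Set (Rn n) :=
  {x | ∀ i, m i - 1 ≤ idx k x i ∧ idx k x i ≤ m i + 1}

/-- The volume of the dyadic cubes of generation `k`. -/
def dvol (n : ℕ) (k : ℤ) : ℝ≥0∞ := ENNReal.ofReal (len k) ^ n

lemma len_pos (k : ℤ) : 0 < len k := by unfold len; positivity

lemma two_zpow_eq (k : ℤ) : (2 : ℝ) ^ k = (len k)⁻¹ := by
  unfold len; simp

lemma len_sub_one (k : ℤ) : len (k - 1) = 2 * len k := by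
  unfold len; rw [show -(k - 1) = 1 + -k by ring, zpow_add₀ (by norm_num)]; simp

lemma dvol_ne_zero (k : ℤ) : dvol n k ≠ 0 := by
  unfold dvol; simp [len_pos]

lemma dvol_ne_top (k : ℤ) : dvol n k ≠ ∞ := by
  unfold dvol; simp

lemma dvol_sub_one (k : ℤ) : dvol n (k - 1) = 2 ^ n * dvol n k := by
  unfold dvol
  rw [len_sub_one, ENNReal.ofReal_mul (by norm_num), mul_pow]; simp

lemma measurable_idx (k : ℤ) : Measurable (idx k : Rn n → Fin n → ℤ) := by
  unfold idx
  refine measurable_pi_lambda _ fun i => ?_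
  exact Int.measurable_floor.comp (by fun_prop)

lemma measurableSet_dy (k : ℤ) (m : Fin n → ℤ) : MeasurableSet (dy k m : Set (Rn n)) :=
  measurable_idx k (measurableSet_singleton m)

lemma tri_eq_preimage (k : ℤ) (m : Fin n → ℤ) :
    (tri k m : Set (Rn n)) = idx k ⁻¹' Set.Icc (fun i => m i - 1) (fun i => m i + 1) := by
  ext x
  simp [tri, Pi.le_def, forall_and]

lemma measurableSet_tri (k : ℤ) (m : Fin n → ℤ) : MeasurableSet (tri k m : Set (Rn n)) := by
  rw [tri_eq_preimage]
  exact measurable_idx k (Set.to_countable _).measurableSet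

lemma mem_dy_idx (k : ℤ) (x : Rn n) : x ∈ dy k (idx k x) := rfl

lemma dy_subset_tri (k : ℤ) (m : Fin n → ℤ) : (dy k m : Set (Rn n)) ⊆ tri k m := by
  rintro x rfl i
  constructor <;> omega

lemma volume_cube (a : Rn n) {l : ℝ} (_hl : 0 ≤ l) :
    volume (cube a l) = ENNReal.ofReal l ^ n := by
  have : cube a l = (@WithLp.ofLp 2 (Fin n → ℝ)) ⁻¹'
      (Set.univ.pi fun i => Set.Ico (a i) (a i + l)) := by
    ext x; simp [cube]
  rw [this, (PiLp.volume_preserving_ofLp (Fin n)).measure_preimage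
    (MeasurableSet.univ_pi fun i => measurableSet_Ico).nullMeasurableSet]
  rw [Real.volume_pi_Ico]
  simp

lemma measurableSet_cube (a : Rn n) (l : ℝ) : MeasurableSet (cube a l) := by
  have : cube a l = ⋂ i, {x | x i ∈ Set.Ico (a i) (a i + l)} := by
    ext x; simp [cube]
  rw [this]
  refine MeasurableSet.iInter fun i => ?_
  exact measurableSet_Ico.preimage (by fun_prop)

lemma tri_eq_cube (k : ℤ) (m : Fin n → ℤ) :
    tri k m = cube (WithLp.toLp 2 fun i => ((m i : ℝ) - 1) * len k) (3 * len k) := by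
  ext x
  simp only [tri, cube, idx, Set.mem_ofPred_eq, Set.mem_Ico]
  refine forall_congr' fun i => ?_
  rw [Int.le_floor, Int.floor_le_iff, two_zpow_eq, inv_mul_eq_div, le_div_iff₀ (len_pos k),
    div_lt_iff₀ (len_pos k)]
  push_cast
  constructor <;> rintro ⟨h1, h2⟩ <;> constructor <;> linarith

lemma dy_eq_cube (k : ℤ) (m : Fin n → ℤ) :
    dy k m = cube (WithLp.toLp 2 fun i => (m i : ℝ) * len k) (len k) := by
  ext x
  simp only [dy, cube, idx, Set.mem_ofPred_eq, Set.mem_Ico, funext_iff]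
  refine forall_congr' fun i => ?_
  rw [Int.floor_eq_iff, two_zpow_eq, inv_mul_eq_div, le_div_iff₀ (len_pos k),
    div_lt_iff₀ (len_pos k)]
  constructor <;> rintro ⟨h1, h2⟩ <;> constructor <;> linarith

lemma volume_dy (k : ℤ) (m : Fin n → ℤ) : volume (dy k m : Set (Rn n)) = dvol n k := by
  rw [dy_eq_cube, volume_cube _ (len_pos k).le, dvol]

lemma volume_tri (k : ℤ) (m : Fin n → ℤ) :
    volume (tri k m : Set (Rn n)) = 3 ^ n * dvol n k := by
  rw [tri_eq_cube, volume_cube _ (by have := len_pos k; positivity), dvol,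
    ENNReal.ofReal_mul (by norm_num), mul_pow]
  simp

/-- The index at a coarse scale is an integer quotient of the index at a finer one, so nesting of
`dy` and `tri` becomes integer arithmetic. -/
lemma idx_div (k : ℤ) (j : ℕ) (x : Rn n) (i : Fin n) :
    idx k x i = idx (k + j) x i / 2 ^ j := by
  unfold idx
  have h := Int.floor_div_natCast ((2 : ℝ) ^ (k + j) * x i) (2 ^ j)
  rw [show (2 : ℝ) ^ (k + (j : ℤ)) * x i / ((2 ^ j : ℕ) : ℝ) = (2 : ℝ) ^ k * x i by
    rw [zpow_add₀ (by norm_num)]; push_cast; simp; field_simp] at h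
  rw [h]; push_cast; rfl

lemma dy_subset_of_le {k k' : ℤ} (h : k ≤ k') {m m' : Fin n → ℤ} {x : Rn n}
    (hx : x ∈ dy k m) (hx' : x ∈ dy k' m') : (dy k' m' : Set (Rn n)) ⊆ dy k m := by
  obtain ⟨j, rfl⟩ := Int.le.dest h
  rintro y hy
  rw [dy, Set.mem_ofPred_eq] at *
  subst hx
  funext i
  rw [idx_div k j x, idx_div k j y, hy, hx']

/-- The residue class that determines which of the `3^n` nested families contains `tri k m`. -/
def triClass (k : ℤ) (m : Fin n → ℤ) : Fin n → ZMod 3 :=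
  fun i => ((m i - 1 : ℤ) : ZMod 3) * (2 : ZMod 3) ^ (-k)

/-- In each coordinate, measured in units of the finer cubes, the coarse tripled interval has length
`3 * 2 ^ j` and the fine one length `3`. Equality of the residue classes says that their left
endpoints differ by a multiple of `3`, so the coarse interval is a union of translates of the fine
one by multiples of `3`. -/
lemma tri_subset_of_le {k k' : ℤ} (h : k ≤ k') {m m' : Fin n → ℤ}
    (hc : triClass k m = triClass k' m') {x : Rn n}
    (hx : x ∈ tri k m) (hx' : x ∈ tri k' m') : (tri k' m' : Set (Rn n)) ⊆ tri k m := by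
  obtain ⟨j, rfl⟩ := Int.le.dest h
  intro y hy i
  have hx := hx i
  have hx' := hx' i
  have hy := hy i
  have hc := congrFun hc i
  simp only [triClass] at hc
  -- Cancelling the power of `2` in `ZMod 3`, where `2` is invertible, turns equality of classes
  -- into a congruence of left endpoints.
  have hd : ∃ u : ℤ, m' i - 1 = 2 ^ j * (m i - 1) + 3 * u := by
    have h1 : (((m' i - 1 : ℤ)) : ZMod 3) = ((2 ^ j * (m i - 1) : ℤ) : ZMod 3) := by
      have h2 : (2 : ZMod 3) ≠ 0 := by decide
      rw [neg_add, zpow_add₀ h2, ← mul_assoc, mul_right_comm] at hc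
      have h3 := mul_right_cancel₀ (zpow_ne_zero _ h2) hc
      rw [Int.cast_mul, h3, zpow_neg, zpow_natCast]
      push_cast
      field_simp
    rw [ZMod.intCast_eq_intCast_iff_dvd_sub] at h1
    obtain ⟨u, hu⟩ := h1
    exact ⟨-u, by push_cast at hu; linarith⟩
  obtain ⟨u, hu⟩ := hd
  rw [idx_div k j x] at hx
  rw [idx_div k j y]
  have hJ : (0 : ℤ) < 2 ^ j := by positivity
  generalize (2 : ℤ) ^ j = J at *
  generalize idx (k + j) x i = X at *
  generalize idx (k + j) y i = Y at *
  have key : ∀ Z : ℤ, (m i - 1 ≤ Z / J ∧ Z / J ≤ m i + 1) ↔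
      (J * (m i - 1) ≤ Z ∧ Z < J * (m i - 1) + 3 * J) := by
    intro Z
    rw [Int.le_ediv_iff_mul_le hJ, ← Int.lt_add_one_iff (a := Z / J), Int.ediv_lt_iff_lt_mul hJ]
    rw [show (m i - 1) * J = J * (m i - 1) by ring,
      show (m i + 1 + 1) * J = J * (m i - 1) + 3 * J by ring]
  rw [key] at hx ⊢
  generalize J * (m i - 1) = A at *
  constructor <;> omega

lemma abs_coord_le (x : Rn n) (i : Fin n) : |x i| ≤ ‖x‖ := by
  simpa using PiLp.norm_apply_le x i

lemma norm_le_sqrt_mul {x : Rn n} {r : ℝ} (h : ∀ i, |x i| ≤ r) (hr : 0 ≤ r) :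
    ‖x‖ ≤ Real.sqrt n * r := by
  rw [EuclideanSpace.norm_eq]
  calc Real.sqrt (∑ i, ‖x i‖ ^ 2) ≤ Real.sqrt (∑ _i : Fin n, r ^ 2) := by
        refine Real.sqrt_le_sqrt (Finset.sum_le_sum fun i _ => ?_)
        rw [Real.norm_eq_abs]
        exact pow_le_pow_left₀ (abs_nonneg _) (h i) 2
    _ = Real.sqrt n * r := by
        simp [Real.sqrt_mul, Real.sqrt_sq hr]

lemma norm_sub_le_of_mem_dy {k : ℤ} {m : Fin n → ℤ} {x y : Rn n} (hx : x ∈ dy k m)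
    (hy : y ∈ dy k m) : ‖x - y‖ ≤ Real.sqrt n * len k := by
  refine norm_le_sqrt_mul (fun i => ?_) (len_pos k).le
  have h : ⌊(2 : ℝ) ^ k * x i⌋ = ⌊(2 : ℝ) ^ k * y i⌋ := congrFun (hx.trans hy.symm) i
  have h1 := Int.abs_sub_lt_one_of_floor_eq_floor h
  rw [← mul_sub, abs_mul, two_zpow_eq, abs_of_pos (inv_pos.2 (len_pos k)), inv_mul_eq_div,
    div_lt_one (len_pos k)] at h1
  simpa using h1.le

lemma mem_tri_of_norm_sub_le {k : ℤ} {m : Fin n → ℤ} {x y : Rn n} (hx : x ∈ dy k m)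
    (h : ‖y - x‖ ≤ len k) : y ∈ tri k m := by
  intro i
  have hx : ⌊(2 : ℝ) ^ k * x i⌋ = m i := congrFun hx i
  have h1 := (abs_coord_le (y - x) i).trans h
  have h2 : |(2 : ℝ) ^ k * y i - (2 : ℝ) ^ k * x i| ≤ 1 := by
    rw [← mul_sub, abs_mul, two_zpow_eq, abs_of_pos (inv_pos.2 (len_pos k)), inv_mul_eq_div,
      div_le_one (len_pos k)]
    simpa using h1
  rw [abs_le] at h2
  unfold idx
  rw [← hx]
  have f1 := Int.floor_le ((2 : ℝ) ^ k * x i)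
  have f2 := Int.lt_floor_add_one ((2 : ℝ) ^ k * x i)
  constructor
  · rw [Int.le_floor]; push_cast; linarith
  · rw [Int.floor_le_iff]; push_cast; linarith

lemma len_le_norm_sub_of_notMem_tri {k : ℤ} {m : Fin n → ℤ} {x y : Rn n} (hx : x ∈ dy k m)
    (hy : y ∉ tri k m) : len k ≤ ‖y - x‖ := by
  by_contra h
  exact hy (mem_tri_of_norm_sub_le hx (not_le.1 h).le)

lemma exists_len_between {r : ℝ} (hr : 0 < r) : ∃ k : ℤ, r ≤ len k ∧ len k ≤ 2 * r := by
  obtain ⟨k, hk1, hk2⟩ := exists_mem_Ioc_zpow hr (by norm_num : (1 : ℝ) < 2)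
  refine ⟨-(k + 1), by simpa [len] using hk2, ?_⟩
  have : len (-(k + 1)) = 2 * 2 ^ k := by
    unfold len; rw [neg_neg, zpow_add₀ (by norm_num)]; simp [mul_comm]
  rw [this]; linarith

end NTMax
end

noncomputable section
namespace NTMax

variable {n : ℕ}

/-! ### Nested families and the maximal function -/

/-- A member contained in another one can be dropped. A member `Q i` contained in no other one
contains every member that it meets, so the union is `Q i` together with the members disjoint from
it, and both measures are additive there. Nestedness thus replaces a covering lemma. -/
lemma measure_biUnion_finset_le_of_nested {X ι : Type*} [MeasurableSpace X] (μ₁ μ₂ : Measure X)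
    (Q : ι → Set X) (hQ : ∀ i, MeasurableSet (Q i))
    (hn : ∀ i j, (Q i ∩ Q j).Nonempty → Q i ⊆ Q j ∨ Q j ⊆ Q i)
    (h : ∀ i, μ₁ (Q i) ≤ μ₂ (Q i)) (s : Finset ι) :
    μ₁ (⋃ i ∈ s, Q i) ≤ μ₂ (⋃ i ∈ s, Q i) := by
  classical
  induction s using Finset.strongInduction with
  | H s ih =>
    rcases s.eq_empty_or_nonempty with rfl | ⟨i, hi⟩
    · simp
    by_cases hc : ∃ j ∈ s.erase i, Q i ⊆ Q j
    · obtain ⟨j, hj, hij⟩ := hc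
      have e : (⋃ i ∈ s, Q i) = ⋃ l ∈ s.erase i, Q l := by
        apply Set.Subset.antisymm
        · refine Set.iUnion₂_subset fun l hl => ?_
          by_cases hli : l = i
          · subst hli
            exact hij.trans (Set.subset_biUnion_of_mem (u := Q) (Finset.mem_coe.2 hj))
          · exact Set.subset_biUnion_of_mem (u := Q)
              (Finset.mem_coe.2 (Finset.mem_erase.2 ⟨hli, hl⟩))
        · exact Set.biUnion_subset_biUnion_left (fun l hl => Finset.mem_of_mem_erase hl)
      rw [e]
      exact ih _ (Finset.erase_ssubset hi)
    · push Not at hc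
      set t := (s.erase i).filter fun j => Disjoint (Q i) (Q j) with ht
      have hts : t ⊂ s := (Finset.filter_subset _ _).trans_ssubset (Finset.erase_ssubset hi)
      have e : (⋃ i ∈ s, Q i) = Q i ∪ ⋃ l ∈ t, Q l := by
        apply Set.Subset.antisymm
        · refine Set.iUnion₂_subset fun l hl => ?_
          by_cases hli : l = i
          · subst hli; exact Set.subset_union_left
          by_cases hd : Disjoint (Q i) (Q l)
          · refine Set.subset_union_of_subset_right (Set.subset_biUnion_of_mem (u := Q) ?_) _
            exact Finset.mem_coe.2 (Finset.mem_filter.2 ⟨Finset.mem_erase.2 ⟨hli, hl⟩, hd⟩)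
          · refine Set.subset_union_of_subset_left ?_ _
            rcases hn i l (Set.not_disjoint_iff_nonempty_inter.1 hd) with h1 | h1
            · exact absurd h1 (hc l (Finset.mem_erase.2 ⟨hli, hl⟩))
            · exact h1
        · refine Set.union_subset (Set.subset_biUnion_of_mem (u := Q) (Finset.mem_coe.2 hi)) ?_
          exact Set.biUnion_subset_biUnion_left (fun l hl => hts.1 hl)
      have hd : Disjoint (Q i) (⋃ l ∈ t, Q l) := by
        simp only [Set.disjoint_iUnion_right]
        intro l hl
        exact (Finset.mem_filter.1 hl).2
      have hm : MeasurableSet (⋃ l ∈ t, Q l) := t.measurableSet_biUnion fun l _ => hQ l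
      rw [e, measure_union hd hm, measure_union hd hm]
      exact add_le_add (h i) (ih t hts)

lemma measure_iUnion_le_of_nested {X ι : Type*} [Countable ι] [MeasurableSpace X]
    (μ₁ μ₂ : Measure X) (Q : ι → Set X) (hQ : ∀ i, MeasurableSet (Q i))
    (hn : ∀ i j, (Q i ∩ Q j).Nonempty → Q i ⊆ Q j ∨ Q j ⊆ Q i)
    (h : ∀ i, μ₁ (Q i) ≤ μ₂ (Q i)) :
    μ₁ (⋃ i, Q i) ≤ μ₂ (⋃ i, Q i) := by
  classical
  have hd : Directed (· ⊆ ·) fun s : Finset ι => ⋃ i ∈ s, Q i := by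
    refine Monotone.directed_le (f := fun s : Finset ι => ⋃ i ∈ s, Q i) fun s t hst => ?_
    exact Set.biUnion_subset_biUnion_left hst
  rw [Set.iUnion_eq_iUnion_finset, hd.measure_iUnion, hd.measure_iUnion]
  exact iSup_mono fun s => measure_biUnion_finset_le_of_nested μ₁ μ₂ Q hQ hn h s

lemma tri_nested {k k' : ℤ} {m m' : Fin n → ℤ} (hc : triClass k m = triClass k' m')
    (h : ((tri k m : Set (Rn n)) ∩ tri k' m').Nonempty) :
    (tri k m : Set (Rn n)) ⊆ tri k' m' ∨ (tri k' m' : Set (Rn n)) ⊆ tri k m := by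
  obtain ⟨x, hx, hx'⟩ := h
  rcases le_total k k' with h | h
  · exact Or.inr (tri_subset_of_le h hc hx hx')
  · exact Or.inl (tri_subset_of_le h hc.symm hx' hx)

/-- The maximal function over tripled dyadic cubes. -/
def maxFn (f : Rn n → ℝ≥0∞) (z : Rn n) : ℝ≥0∞ :=
  ⨆ k : ℤ, (dvol n k)⁻¹ * ∫⁻ y in tri k (idx k z), f y

lemma lintegral_tri_le (f : Rn n → ℝ≥0∞) {k : ℤ} {m : Fin n → ℤ} {z : Rn n}
    (hz : z ∈ dy k m) : ∫⁻ y in tri k m, f y ≤ dvol n k * maxFn f z := by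
  subst hz
  have := le_iSup (fun k : ℤ => (dvol n k)⁻¹ * ∫⁻ y in tri k (idx k z), f y) k
  calc ∫⁻ y in tri k (idx k z), f y
      = dvol n k * ((dvol n k)⁻¹ * ∫⁻ y in tri k (idx k z), f y) := by
        rw [← mul_assoc, ENNReal.mul_inv_cancel (dvol_ne_zero k) (dvol_ne_top k), one_mul]
    _ ≤ _ := by gcongr; exact this

lemma maxFn_mono {f g : Rn n → ℝ≥0∞} (h : ∀ x, f x ≤ g x) (z : Rn n) :
    maxFn f z ≤ maxFn g z := by
  unfold maxFn
  exact iSup_mono fun k => mul_le_mul' le_rfl (lintegral_mono h)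

/-- The factor `3 ^ n` appears because integrals over tripled cubes are normalised by the volume of
the original cube. -/
lemma maxFn_le_of_ae_le {f : Rn n → ℝ≥0∞} {c : ℝ≥0∞} (h : ∀ᵐ x, f x ≤ c) (z : Rn n) :
    maxFn f z ≤ 3 ^ n * c := by
  unfold maxFn
  refine iSup_le fun k => ?_
  calc (dvol n k)⁻¹ * ∫⁻ y in tri k (idx k z), f y
      ≤ (dvol n k)⁻¹ * ∫⁻ y in tri k (idx k z), c := by
        exact mul_le_mul' le_rfl (lintegral_mono_ae (ae_restrict_of_ae h))
    _ = (dvol n k)⁻¹ * (c * (3 ^ n * dvol n k)) := by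
        rw [setLIntegral_const, volume_tri]
    _ = 3 ^ n * c * ((dvol n k)⁻¹ * dvol n k) := by ring
    _ = _ := by rw [ENNReal.inv_mul_cancel (dvol_ne_zero k) (dvol_ne_top k), mul_one]

/-- Superlevel sets of the maximal function are unions of dyadic cubes. -/
lemma exists_dy_subset_lt_maxFn {f : Rn n → ℝ≥0∞} {c : ℝ≥0∞} {z : Rn n} (h : c < maxFn f z) :
    ∃ k, ∀ z' ∈ dy k (idx k z), c < maxFn f z' := by
  obtain ⟨k, hk⟩ := lt_iSup_iff.1 h
  refine ⟨k, fun z' hz' => ?_⟩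
  refine hk.trans_le ?_
  have e : idx k z' = idx k z := hz'
  rw [← e]
  exact le_iSup (fun k : ℤ => (dvol n k)⁻¹ * ∫⁻ y in tri k (idx k z'), f y) k

/-- Within one residue class the selected tripled cubes are nested, and
`measure_iUnion_le_of_nested` sums the defining inequality over them. One factor `3 ^ n` is the
volume ratio of tripled and original cubes; the other counts the classes. -/
lemma volume_lt_maxFn_le (f : Rn n → ℝ≥0∞) (c : ℝ≥0∞) :
    c * volume {z | c < maxFn f z} ≤ 9 ^ n * ∫⁻ y, f y := by
  let ι (γ : Fin n → ZMod 3) : Type :=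
    {Q : ℤ × (Fin n → ℤ) // triClass Q.1 Q.2 = γ ∧ c * dvol n Q.1 ≤ ∫⁻ y in tri Q.1 Q.2, f y}
  have hsub : {z | c < maxFn f z} ⊆ ⋃ γ, ⋃ i : ι γ, (tri i.1.1 i.1.2 : Set (Rn n)) := by
    intro z hz
    obtain ⟨k, hk⟩ := lt_iSup_iff.1 (show c < maxFn f z from hz)
    have h1 : c * dvol n k ≤ ∫⁻ y in tri k (idx k z), f y := by
      have := mul_le_mul_left hk.le (dvol n k)
      rwa [mul_right_comm, ENNReal.inv_mul_cancel (dvol_ne_zero k) (dvol_ne_top k),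
        one_mul] at this
    exact Set.mem_iUnion.2 ⟨_, Set.mem_iUnion.2 ⟨⟨(k, idx k z), rfl, h1⟩,
      dy_subset_tri _ _ (mem_dy_idx k z)⟩⟩
  have hγ : ∀ γ : Fin n → ZMod 3, c * volume (⋃ i : ι γ, (tri i.1.1 i.1.2 : Set (Rn n))) ≤
      3 ^ n * ∫⁻ y, f y := by
    intro γ
    have h2 := measure_iUnion_le_of_nested (c • (volume : Measure (Rn n)))
      ((3 ^ n : ℝ≥0∞) • volume.withDensity f)
      (fun i : ι γ => (tri i.1.1 i.1.2 : Set (Rn n))) (fun i => measurableSet_tri _ _)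
      (fun i j h => tri_nested (i.2.1.trans j.2.1.symm) h) (fun i => ?_)
    · rw [Measure.smul_apply, Measure.smul_apply, smul_eq_mul, smul_eq_mul] at h2
      refine h2.trans ?_
      gcongr
      exact (measure_mono (Set.subset_univ _)).trans (by simp)
    · rw [Measure.smul_apply, Measure.smul_apply, smul_eq_mul, smul_eq_mul, volume_tri,
        withDensity_apply _ (measurableSet_tri _ _), mul_left_comm]
      gcongr
      exact i.2.2
  calc c * volume {z | c < maxFn f z}
      ≤ c * ∑ γ : Fin n → ZMod 3, volume (⋃ i : ι γ, (tri i.1.1 i.1.2 : Set (Rn n))) := by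
        gcongr
        refine (measure_mono hsub).trans ?_
        exact measure_iUnion_fintype_le _ _
    _ ≤ ∑ γ : Fin n → ZMod 3, 3 ^ n * ∫⁻ y, f y := by
        rw [Finset.mul_sum]
        exact Finset.sum_le_sum fun γ _ => hγ γ
    _ = _ := by
        rw [Finset.sum_const, Finset.card_univ, Fintype.card_pi, nsmul_eq_mul, ← mul_assoc]
        congr 1
        simp [ZMod.card, ← mul_pow]
        norm_num

lemma lintegral_closedBall_le (f : Rn n → ℝ≥0∞) (z : Rn n) {r : ℝ} (hr : 0 < r) :
    ∫⁻ y in Metric.closedBall z r, f y ≤ ENNReal.ofReal (2 * r) ^ n * maxFn f z := by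
  obtain ⟨k, hk1, hk2⟩ := exists_len_between hr
  calc ∫⁻ y in Metric.closedBall z r, f y ≤ ∫⁻ y in tri k (idx k z), f y := by
        refine lintegral_mono_set fun y hy => ?_
        refine mem_tri_of_norm_sub_le (mem_dy_idx k z) ?_
        rw [Metric.mem_closedBall, dist_eq_norm] at hy
        exact hy.trans hk1
    _ ≤ dvol n k * maxFn f z := lintegral_tri_le f (mem_dy_idx k z)
    _ ≤ _ := by
        unfold dvol
        gcongr

/-- The radial kernel `h^δ / (h + r)^{n + δ}`. -/
def pk (n : ℕ) (δ h r : ℝ) : ℝ := h ^ δ / (h + r) ^ ((n : ℝ) + δ)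

/-- Decomposition into dyadic annuli of scale `h`: the kernel is at most a normalised indicator of a
ball of radius `2 ^ i * h` times the summable factor `2 ^ (-δ i)`. -/
lemma pk_le {δ h r : ℝ} (hδ : 0 < δ) (hh : 0 < h) (hr : 0 ≤ r) :
    ∃ i : ℕ, r ≤ 2 ^ i * h ∧
      pk n δ h r ≤ 2 ^ ((n : ℝ) + δ) * ((2 ^ (-δ)) ^ i * (2 ^ i * h)⁻¹ ^ n) := by
  obtain ⟨i, hi1, hi2⟩ := exists_nat_pow_near (x := (h + r) / h) (y := (2 : ℝ))
    (by rw [le_div_iff₀ hh]; linarith) (by norm_num)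
  rw [div_lt_iff₀ hh] at hi2
  rw [le_div_iff₀ hh] at hi1
  -- With `i + 1` the ball of radius `2 ^ (i + 1) * h` contains the point, while `h + r` is still at
  -- least half that radius.
  refine ⟨i + 1, by linarith, ?_⟩
  have hp : (0 : ℝ) < 2 ^ (i + 1) * h := by positivity
  have h1 : 2 ^ (i + 1) * h / 2 ≤ h + r := by rw [pow_succ]; linarith
  calc pk n δ h r ≤ h ^ δ / (2 ^ (i + 1) * h / 2) ^ ((n : ℝ) + δ) := by
        unfold pk; gcongr
    _ = _ := by
        rw [inv_pow, Real.div_rpow hp.le (by norm_num), Real.rpow_add hp,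
          Real.mul_rpow (by positivity) hh.le
          (z := δ), Real.rpow_natCast, ← Real.rpow_natCast 2 (i + 1),
          ← Real.rpow_natCast (2 ^ (-δ)) (i + 1), ← Real.rpow_mul (by norm_num) (-δ),
          ← Real.rpow_mul (by norm_num) _ δ, neg_mul, Real.rpow_neg (by norm_num) (δ * _),
          mul_comm δ]
        have : h ^ δ ≠ 0 := (Real.rpow_pos_of_pos hh δ).ne'
        field_simp

/-- Each ball of the annular decomposition contributes at most a multiple of `maxFn`, and the
factors `2 ^ (-δ i)` form a geometric series. The bound does not depend on `h`. -/
lemma exists_lintegral_pk_le (n : ℕ) {δ : ℝ} (hδ : 0 < δ) :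
    ∃ C : ℝ≥0, ∀ (f : Rn n → ℝ≥0∞) (h : ℝ) (z : Rn n), AEMeasurable f volume → 0 < h →
      ∫⁻ y, ENNReal.ofReal (pk n δ h ‖z - y‖) * f y ≤ C * maxFn f z := by
  set ρ : ℝ := 2 ^ (-δ) with hρ
  have hρ0 : 0 < ρ := by positivity
  have hρ1 : ρ < 1 := Real.rpow_lt_one_of_one_lt_of_neg (by norm_num) (by linarith)
  set A : ℝ≥0∞ := ENNReal.ofReal (2 ^ ((n : ℝ) + δ)) * 2 ^ n * (1 - ENNReal.ofReal ρ)⁻¹ with hA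
  have hAt : A ≠ ∞ := by
    refine ENNReal.mul_ne_top (by finiteness) (ENNReal.inv_ne_top.2 ?_)
    rw [← ENNReal.ofReal_one, ← ENNReal.ofReal_sub _ hρ0.le]
    simpa using hρ1
  refine ⟨A.toNNReal, fun f h z hf hh => ?_⟩
  rw [ENNReal.coe_toNNReal hAt]
  let a : ℕ → ℝ := fun i => 2 ^ ((n : ℝ) + δ) * (ρ ^ i * (2 ^ i * h)⁻¹ ^ n)
  have hpt : ∀ y, ENNReal.ofReal (pk n δ h ‖z - y‖) * f y ≤
      ∑' i : ℕ, (Metric.closedBall z (2 ^ i * h)).indicator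
        (fun y => ENNReal.ofReal (a i) * f y) y := by
    intro y
    obtain ⟨i, hi1, hi2⟩ := pk_le (n := n) hδ hh (norm_nonneg (z - y))
    refine le_trans ?_ (ENNReal.le_tsum i)
    rw [Set.indicator_of_mem (by rwa [Metric.mem_closedBall, dist_comm, dist_eq_norm])]
    gcongr
  calc ∫⁻ y, ENNReal.ofReal (pk n δ h ‖z - y‖) * f y
      ≤ ∫⁻ y, ∑' i : ℕ, (Metric.closedBall z (2 ^ i * h)).indicator
        (fun y => ENNReal.ofReal (a i) * f y) y := lintegral_mono hpt
    _ = ∑' i : ℕ, ENNReal.ofReal (a i) * ∫⁻ y in Metric.closedBall z (2 ^ i * h), f y := by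
        rw [lintegral_tsum fun i =>
          (hf.const_mul _).indicator Metric.isClosed_closedBall.measurableSet]
        congr with i
        rw [lintegral_indicator Metric.isClosed_closedBall.measurableSet,
          lintegral_const_mul'' _ hf.restrict]
    _ ≤ ∑' i : ℕ, (ENNReal.ofReal (2 ^ ((n : ℝ) + δ)) * 2 ^ n * maxFn f z) *
          ENNReal.ofReal ρ ^ i := by
        refine ENNReal.tsum_le_tsum fun i => ?_
        have hih : (0 : ℝ) < 2 ^ i * h := by positivity
        calc _ ≤ ENNReal.ofReal (a i) * (ENNReal.ofReal (2 * (2 ^ i * h)) ^ n * maxFn f z) := by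
              gcongr; exact lintegral_closedBall_le f z hih
          _ = ENNReal.ofReal (a i * (2 * (2 ^ i * h)) ^ n) * maxFn f z := by
              rw [← mul_assoc, ENNReal.ofReal_mul (p := a i) (by positivity),
                ENNReal.ofReal_pow (by positivity)]
          _ = ENNReal.ofReal (2 ^ ((n : ℝ) + δ) * 2 ^ n * ρ ^ i) * maxFn f z := by
              congr 2
              simp only [a]
              rw [inv_pow, mul_pow 2 (2 ^ i * h)]
              field_simp
          _ = _ := by
              rw [ENNReal.ofReal_mul (by positivity), ENNReal.ofReal_mul (by positivity),
                ENNReal.ofReal_pow hρ0.le, ENNReal.ofReal_pow (by norm_num)]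
              simp only [ENNReal.ofReal_ofNat]
              ring
    _ = A * maxFn f z := by
        rw [ENNReal.tsum_mul_left, ENNReal.tsum_geometric, hA]
        ring

end NTMax
end

noncomputable section
namespace NTMax

variable {n : ℕ}

/-! ### The norm of the half-space -/

lemma enorm2_nonneg (s : ℝ) (z : Rn n) : 0 ≤ enorm2 s z := Real.sqrt_nonneg _

lemma abs_le_enorm2 (s : ℝ) (z : Rn n) : |s| ≤ enorm2 s z := by
  unfold enorm2
  rw [← Real.sqrt_sq_eq_abs]
  exact Real.sqrt_le_sqrt (by nlinarith [sq_nonneg ‖z‖])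

lemma norm_le_enorm2 (s : ℝ) (z : Rn n) : ‖z‖ ≤ enorm2 s z := by
  unfold enorm2
  exact Real.le_sqrt_of_sq_le (by nlinarith [sq_nonneg s])

lemma enorm2_le (s : ℝ) (z : Rn n) : enorm2 s z ≤ |s| + ‖z‖ := by
  unfold enorm2
  rw [Real.sqrt_le_left (by positivity)]
  nlinarith [sq_abs s, abs_nonneg s, norm_nonneg z, mul_nonneg (abs_nonneg s) (norm_nonneg z)]

lemma enorm2_pos {s : ℝ} (hs : 0 < s) (z : Rn n) : 0 < enorm2 s z :=
  (abs_pos.2 hs.ne').trans_le (abs_le_enorm2 s z)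

lemma enorm2_le_add_norm_sub (s : ℝ) (u v : Rn n) : enorm2 s u ≤ enorm2 s v + ‖u - v‖ := by
  have h0 := enorm2_nonneg s v
  have h1 := norm_le_enorm2 s v
  have h2 : enorm2 s v ^ 2 = s ^ 2 + ‖v‖ ^ 2 := Real.sq_sqrt (by positivity)
  have h3 : ‖u‖ ≤ ‖v‖ + ‖u - v‖ := norm_le_norm_add_norm_sub' u v
  have h4 := norm_nonneg (u - v)
  have h5 := norm_nonneg u
  have h6 := norm_nonneg v
  conv_lhs => unfold enorm2
  rw [Real.sqrt_le_left (by positivity)]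
  have h7 : ‖u‖ ^ 2 ≤ (‖v‖ + ‖u - v‖) ^ 2 := pow_le_pow_left₀ h5 h3 2
  nlinarith [mul_le_mul_of_nonneg_right h1 h4]

/-! ### Cones and the non-tangential maximal function -/

lemma isOpen_cone (α : ℝ) (z : Rn n) : IsOpen (cone α z) := by
  have h1 : IsOpen {P : ℝ × Rn n | 0 < P.1} := isOpen_lt continuous_const continuous_fst
  have h2 : IsOpen {P : ℝ × Rn n | ‖P.2 - z‖ < α * P.1} :=
    isOpen_lt (by fun_prop) (by fun_prop)
  exact h1.inter h2

/-- A nonempty open set has positive measure, so the essential bound holds at some point of it. This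
turns the essential supremum into a value at an actual point. -/
lemma exists_mem_enorm_le_ntMax {α : ℝ} (F : ℝ → Rn n → ℝ) (z : Rn n) {U : Set (ℝ × Rn n)}
    (hU : IsOpen U) (hne : U.Nonempty) (hUc : U ⊆ cone α z) :
    ∃ P ∈ U, ‖F P.1 P.2‖ₑ ≤ ntMax α F z := by
  have h := ENNReal.ae_le_essSup (μ := volume.restrict (cone α z))
    (fun P : ℝ × Rn n => ‖F P.1 P.2‖ₑ)
  rw [ae_restrict_iff' (isOpen_cone α z).measurableSet] at h
  by_contra hcon
  push Not at hcon
  have h0 : volume U = 0 := by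
    refine measure_mono_null (fun P hP => ?_) h
    intro h1
    exact absurd (h1 (hUc hP)) (not_le.2 (hcon P hP))
  exact (hU.measure_pos volume hne).ne' h0

/-- The supremum of `|F|` over the cone of aperture `β` with vertex `z`. -/
def coneSup (β : ℝ) (F : ℝ → Rn n → ℝ) (z : Rn n) : ℝ≥0∞ :=
  ⨆ (P : ℝ × Rn n) (_ : P ∈ cone β z), ‖F P.1 P.2‖ₑ

lemma le_coneSup {β : ℝ} (F : ℝ → Rn n → ℝ) {z : Rn n} {t : ℝ} {x : Rn n} (ht : 0 < t)
    (hx : ‖x - z‖ < β * t) : ‖F t x‖ₑ ≤ coneSup β F z :=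
  le_iSup₂ (f := fun (P : ℝ × Rn n) (_ : P ∈ cone β z) => ‖F P.1 P.2‖ₑ) (t, x) ⟨ht, hx⟩

lemma ntMax_le_coneSup (β : ℝ) (F : ℝ → Rn n → ℝ) (z : Rn n) :
    ntMax β F z ≤ coneSup β F z := by
  refine essSup_le_of_ae_le _ ?_
  rw [Filter.EventuallyLE, ae_restrict_iff' (isOpen_cone β z).measurableSet]
  exact Filter.Eventually.of_forall fun P hP => le_coneSup F hP.1 hP.2

lemma isOpen_lt_coneSup (β : ℝ) (F : ℝ → Rn n → ℝ) (c : ℝ≥0∞) :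
    IsOpen {z | c < coneSup β F z} := by
  have : {z | c < coneSup β F z} =
      ⋃ (P : ℝ × Rn n) (_ : 0 < P.1 ∧ c < ‖F P.1 P.2‖ₑ), {z | ‖P.2 - z‖ < β * P.1} := by
    ext z
    simp only [coneSup, lt_iSup_iff, cone, Set.mem_ofPred_eq, Set.mem_iUnion]
    constructor
    · rintro ⟨P, h, hc⟩; exact ⟨P, ⟨h.1, hc⟩, h.2⟩
    · rintro ⟨P, h, hc⟩; exact ⟨P, ⟨h.1, hc⟩, h.2⟩
  rw [this]
  exact isOpen_iUnion fun P => isOpen_iUnion fun _ => isOpen_lt (by fun_prop) (by fun_prop)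

lemma measurable_coneSup (β : ℝ) (F : ℝ → Rn n → ℝ) : Measurable (coneSup β F) :=
  (lowerSemicontinuous_iff_isOpen_preimage.2 fun c => isOpen_lt_coneSup β F c).measurable

/-- Part of positive measure of the superlevel set of `|F|` in the cone keeps a margin `1 / (j + 1)`
from the lateral boundary; it stays in the cone when the vertex moves by less than that margin. -/
lemma isOpen_lt_ntMax (α : ℝ) (F : ℝ → Rn n → ℝ) (c : ℝ≥0∞) :
    IsOpen {z | c < ntMax α F z} := by
  rw [Metric.isOpen_iff]
  intro z hz
  let A : Set (ℝ × Rn n) := {P | c < ‖F P.1 P.2‖ₑ}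
  let U : ℕ → Set (ℝ × Rn n) := fun j =>
    {P | 0 < P.1 ∧ ‖P.2 - z‖ + 1 / ((j : ℝ) + 1) ≤ α * P.1}
  have key : ∃ j, volume (A ∩ U j) ≠ 0 := by
    by_contra hcon
    push Not at hcon
    have h0 : volume (A ∩ ⋃ j, U j) = 0 := by
      rw [Set.inter_iUnion]; exact measure_iUnion_null hcon
    refine absurd (essSup_le_of_ae_le (μ := volume.restrict (cone α z))
      (f := fun P : ℝ × Rn n => ‖F P.1 P.2‖ₑ) c ?_) (not_le.2 hz)
    rw [Filter.EventuallyLE, ae_restrict_iff' (isOpen_cone α z).measurableSet]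
    refine measure_mono_null (fun P hP => ?_) h0
    rw [Set.mem_compl_iff, Set.mem_ofPred_eq, Classical.not_imp, not_le] at hP
    refine ⟨hP.2, ?_⟩
    obtain ⟨j, hj⟩ := exists_nat_one_div_lt (sub_pos.2 hP.1.2)
    exact Set.mem_iUnion.2 ⟨j, hP.1.1, by linarith⟩
  obtain ⟨j, hj⟩ := key
  refine ⟨1 / ((j : ℝ) + 1), by positivity, fun z' hz' => ?_⟩
  by_contra hcon
  rw [Set.mem_ofPred_eq, not_lt] at hcon
  have h := ENNReal.ae_le_essSup (μ := volume.restrict (cone α z'))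
    (fun P : ℝ × Rn n => ‖F P.1 P.2‖ₑ)
  rw [ae_restrict_iff' (isOpen_cone α z').measurableSet] at h
  refine hj (measure_mono_null (fun P hP => ?_) h)
  intro h1
  have hPc : P ∈ cone α z' := by
    refine ⟨hP.2.1, ?_⟩
    have h2 : ‖P.2 - z'‖ ≤ ‖P.2 - z‖ + ‖z - z'‖ := norm_sub_le_norm_sub_add_norm_sub _ _ _
    rw [Metric.mem_ball, dist_comm, dist_eq_norm] at hz'
    have := hP.2.2
    linarith
  exact absurd ((h1 hPc).trans hcon) (not_le.2 hP.1)

lemma measurable_ntMax (α : ℝ) (F : ℝ → Rn n → ℝ) : Measurable (ntMax α F) :=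
  (lowerSemicontinuous_iff_isOpen_preimage.2 fun c => isOpen_lt_ntMax α F c).measurable

/-! ### Size and regularity of the kernel -/

/-- A kernel with size and regularity bounds, with one constant. -/
structure RegKernel (k : ℝ → Rn n → Rn n → ℝ) (δ C : ℝ) : Prop where
  pos : 0 < δ
  nonneg : 0 ≤ C
  x_reg : ∀ (s t : ℝ) (x y z : Rn n), 0 < s → 0 < t →
    enorm2 s z ≤ enorm2 t (x - y) / 2 →
      |k (t + s) (x + z) y - k t x y| ≤ C * (enorm2 s z ^ δ / enorm2 t (x - y) ^ ((n : ℝ) + δ))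
  y_reg : ∀ (t : ℝ) (x y z : Rn n), 0 < t →
    ‖z‖ ≤ enorm2 t (x - y) / 2 →
      |k t x (y + z) - k t x y| ≤ C * (‖z‖ ^ δ / enorm2 t (x - y) ^ ((n : ℝ) + δ))
  size : ∀ (t : ℝ) (x y : Rn n), 0 < t → |k t x y| ≤ C * (enorm2 t (x - y) ^ n)⁻¹

/-- Measurability of the kernel is not assumed; it comes from this Hölder continuity in `y`. -/
lemma YRegular.continuous {k : ℝ → Rn n → Rn n → ℝ} {δ : ℝ} (hδ : 0 < δ) (hY : YRegular k δ)
    {t : ℝ} (ht : 0 < t) (x : Rn n) : Continuous (k t x) := by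
  obtain ⟨C, hC⟩ := hY
  rw [continuous_iff_continuousAt]
  intro y
  have hρ := enorm2_pos ht (x - y)
  rw [ContinuousAt, tendsto_iff_norm_sub_tendsto_zero]
  have hlim : Filter.Tendsto (fun y' : Rn n =>
      C * (‖y' - y‖ ^ δ / enorm2 t (x - y) ^ ((n : ℝ) + δ))) (nhds y) (nhds 0) := by
    have hc : Continuous fun y' : Rn n =>
        C * (‖y' - y‖ ^ δ / enorm2 t (x - y) ^ ((n : ℝ) + δ)) := by
      refine continuous_const.mul (Continuous.div_const ?_ _)
      exact (by fun_prop : Continuous fun y' : Rn n => ‖y' - y‖).rpow_const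
        fun _ => Or.inr hδ.le
    have := hc.tendsto y
    simpa [Real.zero_rpow hδ.ne'] using this
  refine squeeze_zero' (Filter.Eventually.of_forall fun _ => norm_nonneg _) ?_ hlim
  filter_upwards [Metric.closedBall_mem_nhds y (half_pos hρ)] with y' hy'
  rw [Metric.mem_closedBall, dist_eq_norm] at hy'
  have := hC t x y (y' - y) ht hy'
  simpa using this

lemma RegKernel.continuous {k : ℝ → Rn n → Rn n → ℝ} {δ C : ℝ} (hk : RegKernel k δ C)
    {t : ℝ} (ht : 0 < t) (x : Rn n) : Continuous (k t x) :=
  YRegular.continuous hk.pos ⟨C, hk.y_reg⟩ ht x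

lemma rpow_div_rpow_le {δ a b ρ : ℝ} (hδ : 0 < δ) (hρ : 0 < ρ) (ha0 : 0 ≤ a) (ha : a ≤ ρ)
    (hb : ρ / 2 ≤ b) :
    a ^ δ / b ^ ((n : ℝ) + δ) ≤ 2 ^ ((n : ℝ) + δ) * (ρ ^ n)⁻¹ := by
  calc a ^ δ / b ^ ((n : ℝ) + δ) ≤ ρ ^ δ / (ρ / 2) ^ ((n : ℝ) + δ) := by gcongr
    _ = _ := by
      rw [Real.div_rpow hρ.le (by norm_num), Real.rpow_add hρ, Real.rpow_natCast]
      have : ρ ^ δ ≠ 0 := (Real.rpow_pos_of_pos hρ δ).ne'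
      field_simp

/-- The point `y` moves first, then `(t, x)`. Displacements are limited to a quarter of the distance
so that, after `y` has moved, the second one is still below half of the new distance. -/
lemma exists_local_oscillation_le {k : ℝ → Rn n → Rn n → ℝ} {δ : ℝ} (hδ : 0 < δ)
    (hX : XRegular k δ) (hY : YRegular k δ) :
    ∃ A : ℝ, 0 ≤ A ∧ ∀ (s t : ℝ) (x z y y' : Rn n), 0 < s → 0 < t →
      enorm2 s z ≤ enorm2 t (x - y) / 4 → ‖y' - y‖ ≤ enorm2 t (x - y) / 4 →
      |k (t + s) (x + z) y' - k t x y| ≤ A * (enorm2 t (x - y) ^ n)⁻¹ := by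
  obtain ⟨Cx, hX⟩ := hX
  obtain ⟨Cy, hY⟩ := hY
  refine ⟨|Cx| * 2 ^ ((n : ℝ) + δ) + |Cy| * 2 ^ ((n : ℝ) + δ), by positivity, ?_⟩
  intro s t x z y y' hs ht hsz hy
  have hρ := enorm2_pos ht (x - y)
  have hρ' := enorm2_le_add_norm_sub t (x - y) (x - y')
  rw [sub_sub_sub_cancel_left] at hρ'
  have h1 := hX s t x y' z hs ht (by linarith)
  have h2 := hY t x y (y' - y) ht (by linarith)
  rw [add_sub_cancel] at h2
  have h3 := rpow_div_rpow_le (n := n) hδ hρ (enorm2_nonneg s z) (by linarith)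
    (b := enorm2 t (x - y')) (by linarith)
  have h4 := rpow_div_rpow_le (n := n) hδ hρ (norm_nonneg (y' - y)) (by linarith)
    (b := enorm2 t (x - y)) (by linarith)
  have h5 : 0 ≤ enorm2 s z ^ δ / enorm2 t (x - y') ^ ((n : ℝ) + δ) := by
    have := enorm2_nonneg s z
    have := enorm2_nonneg t (x - y')
    positivity
  have h6 : 0 ≤ ‖y' - y‖ ^ δ / enorm2 t (x - y) ^ ((n : ℝ) + δ) := by positivity
  calc |k (t + s) (x + z) y' - k t x y|
      ≤ |k (t + s) (x + z) y' - k t x y'| + |k t x y' - k t x y| := abs_sub_le _ _ _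
    _ ≤ |Cx| * (2 ^ ((n : ℝ) + δ) * (enorm2 t (x - y) ^ n)⁻¹) +
        |Cy| * (2 ^ ((n : ℝ) + δ) * (enorm2 t (x - y) ^ n)⁻¹) := by
        refine add_le_add (h1.trans ?_) (h2.trans ?_)
        · exact mul_le_mul (le_abs_self _) h3 h5 (abs_nonneg _)
        · exact mul_le_mul (le_abs_self _) h4 h6 (abs_nonneg _)
    _ = _ := by ring

lemma volume_closedBall (x : Rn n) {r : ℝ} (hr : 0 ≤ r) :
    volume (Metric.closedBall x r) =
      ENNReal.ofReal (r ^ n) * volume (Metric.ball (0 : Rn n) 1) := by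
  rw [Measure.addHaar_closedBall _ _ hr, finrank_euclideanSpace, Fintype.card_fin]

lemma volume_ball_ne_zero : volume (Metric.ball (0 : Rn n) 1) ≠ 0 :=
  (Metric.measure_ball_pos _ _ one_pos).ne'

lemma volume_ball_ne_top : volume (Metric.ball (0 : Rn n) 1) ≠ ∞ :=
  measure_ball_lt_top.ne

/-- Test the `L_2` estimate on the indicator of the ball `B` of radius `ρ / 4` about `y`. If `|k t x
y|` exceeds the local oscillation by `D`, then `|S^* f| ≥ D |B|` just above `(t, x)`, hence `N(S^*
f) ≥ D |B|` on a ball `E` about `x` of radius comparable to `ρ`. Comparing norms bounds `D` by a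
multiple of `ρ ^ (-n)`. -/
lemma exists_size_le {k : ℝ → Rn n → Rn n → ℝ} {δ α : ℝ} (hδ : 0 < δ)
    (hX : XRegular k δ) (hY : YRegular k δ) (hα : 0 < α) (hL : L2NontangentialEstimate k α) :
    ∃ C : ℝ, 0 ≤ C ∧ ∀ (t : ℝ) (x y : Rn n), 0 < t →
      |k t x y| ≤ C * (enorm2 t (x - y) ^ n)⁻¹ := by
  obtain ⟨A, hA0, hA⟩ := exists_local_oscillation_le hδ hX hY
  obtain ⟨L, hL⟩ := hL
  set V : ℝ := (volume (Metric.ball (0 : Rn n) 1)).toReal with hV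
  have hVpos : 0 < V := ENNReal.toReal_pos volume_ball_ne_zero volume_ball_ne_top
  -- The bound `1 / 8` keeps the displacement from `(t, x)` within `ρ / 4`. The bound `α / 32` makes
  -- two displacements of size `η ρ` fit in the cone at heights above `ρ / 16`.
  set η : ℝ := min (1 / 8) (α / 32) with hη
  have hη0 : 0 < η := by positivity
  refine ⟨A + L / (Real.sqrt ((η / 4) ^ n) * V), by positivity, ?_⟩
  intro t x y ht
  set ρ := enorm2 t (x - y) with hρdef
  have hρ : 0 < ρ := enorm2_pos ht _
  by_cases hD : |k t x y| ≤ A * (ρ ^ n)⁻¹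
  · refine hD.trans ?_
    gcongr
    have : 0 ≤ (L : ℝ) / (Real.sqrt ((η / 4) ^ n) * V) := by positivity
    linarith
  set D := |k t x y| - A * (ρ ^ n)⁻¹ with hDdef
  have hD0 : 0 < D := by linarith [not_le.1 hD]
  set B := Metric.closedBall y (ρ / 4) with hB
  set f : Rn n → ℝ := B.indicator fun _ => (1 : ℝ) with hf
  have hBm : MeasurableSet B := Metric.isClosed_closedBall.measurableSet
  have hBt : volume B ≠ ∞ := measure_closedBall_lt_top.ne
  have hBr : (volume B).toReal = (ρ / 4) ^ n * V := by
    rw [hB, volume_closedBall _ (by positivity), ENNReal.toReal_mul,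
      ENNReal.toReal_ofReal (by positivity)]
  have hBpos : 0 < (volume B).toReal := by rw [hBr]; positivity
  have hmem : MemLp f 2 volume := memLp_indicator_const 2 hBm 1 (Or.inr hBt)
  set E := Metric.closedBall x (η * ρ) with hE
  have hEm : MeasurableSet E := Metric.isClosed_closedBall.measurableSet
  have hEr : (volume E).toReal = (η * ρ) ^ n * V := by
    rw [hE, volume_closedBall _ (by positivity), ENNReal.toReal_mul,
      ENNReal.toReal_ofReal (by positivity)]
  -- lower bound for the operator near `(t, x)`
  have hS : ∀ (s : ℝ) (z : Rn n), 0 < s → enorm2 s z ≤ ρ / 4 →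
      D * (volume B).toReal ≤ |Sstar k f (t + s) (x + z)| := by
    intro s z hs hsz
    have hts : 0 < t + s := by linarith
    have e1 : Sstar k f (t + s) (x + z) = ∫ y' in B, k (t + s) (x + z) y' := by
      unfold Sstar
      rw [← integral_indicator hBm]
      congr 1
      ext y'
      by_cases h : y' ∈ B <;> simp [hf, h]
    have hInt : IntegrableOn (fun y' => k (t + s) (x + z) y') B :=
      (YRegular.continuous hδ hY hts _).continuousOn.integrableOn_compact
        (isCompact_closedBall _ _)
    have e2 : (∫ y' in B, k (t + s) (x + z) y') - k t x y * (volume B).toReal =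
        ∫ y' in B, (k (t + s) (x + z) y' - k t x y) := by
      rw [integral_sub hInt (integrableOn_const hBt), setIntegral_const, smul_eq_mul, mul_comm]
      rfl
    have e3 : |∫ y' in B, (k (t + s) (x + z) y' - k t x y)| ≤
        A * (ρ ^ n)⁻¹ * (volume B).toReal := by
      rw [← Real.norm_eq_abs]
      refine norm_setIntegral_le_of_norm_le_const hBt.lt_top fun y' hy' => ?_
      rw [hB, Metric.mem_closedBall, dist_eq_norm] at hy'
      exact hA s t x z y y' hs ht hsz hy'
    rw [← e2, ← e1] at e3
    have e4 : |k t x y * (volume B).toReal| = |k t x y| * (volume B).toReal := by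
      rw [abs_mul, abs_of_pos hBpos]
    have e5 := abs_sub_abs_le_abs_sub (k t x y * (volume B).toReal) (Sstar k f (t + s) (x + z))
    rw [abs_sub_comm] at e5
    rw [hDdef, sub_mul]
    linarith
  have hN : ∀ z₀ ∈ E, ENNReal.ofReal (D * (volume B).toReal) ≤ ntMax α (Sstar k f) z₀ := by
    intro z₀ hz₀
    rw [hE, Metric.mem_closedBall, dist_comm, dist_eq_norm] at hz₀
    -- The box lies strictly above height `t`, because regularity in `(t, x)` is only assumed for
    -- upward moves, and high enough for every cone with vertex in `E` to contain it.
    set U : Set (ℝ × Rn n) := Set.Ioo (t + ρ / 16) (t + ρ / 8) ×ˢ Metric.ball x (η * ρ) with hU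
    have hη1 : η * ρ ≤ 1 / 8 * ρ := by gcongr; exact min_le_left _ _
    have hη2 : η * ρ ≤ α / 32 * ρ := by gcongr; exact min_le_right _ _
    have hUc : U ⊆ cone α z₀ := by
      rintro P ⟨⟨h1, h2⟩, h3⟩
      rw [Metric.mem_ball, dist_eq_norm] at h3
      refine ⟨by linarith, ?_⟩
      have h4 : ‖P.2 - z₀‖ ≤ ‖P.2 - x‖ + ‖x - z₀‖ := norm_sub_le_norm_sub_add_norm_sub _ _ _
      have h5 : α * (ρ / 16) ≤ α * P.1 := by gcongr; linarith
      linarith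
    obtain ⟨P, hP, hPle⟩ := exists_mem_enorm_le_ntMax (α := α) (Sstar k f) z₀ (U := U)
      (isOpen_Ioo.prod Metric.isOpen_ball)
      ⟨(t + (ρ / 16 + ρ / 8) / 2, x), ⟨by constructor <;> dsimp only <;> linarith,
        Metric.mem_ball_self (by positivity)⟩⟩ hUc
    · refine le_trans ?_ hPle
      obtain ⟨⟨h1, h2⟩, h3⟩ := hP
      rw [Metric.mem_ball, dist_eq_norm] at h3
      have h4 := hS (P.1 - t) (P.2 - x) (by linarith) (by
        refine (enorm2_le _ _).trans ?_
        rw [abs_of_pos (by linarith)]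
        linarith [norm_nonneg (P.2 - x)])
      rw [add_sub_cancel, add_sub_cancel] at h4
      rw [← ofReal_norm, Real.norm_eq_abs]
      exact ENNReal.ofReal_le_ofReal h4
  have hkey : ENNReal.ofReal (D * (volume B).toReal) * volume E ^ (1 / (2 : ℝ)) ≤
      L * volume B ^ (1 / (2 : ℝ)) := by
    have h1 := eLpNorm_indicator_const (μ := (volume : Measure (Rn n)))
      (c := ENNReal.ofReal (D * (volume B).toReal)) (p := 2) hEm (by simp) (by simp)
    have h2 := eLpNorm_indicator_const (μ := (volume : Measure (Rn n)))
      (c := (1 : ℝ)) (p := 2) hBm (by simp) (by simp)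
    have h3 : eLpNorm (E.indicator fun _ => ENNReal.ofReal (D * (volume B).toReal)) 2 volume ≤
        eLpNorm (ntMax α (Sstar k f)) 2 volume := by
      refine eLpNorm_mono_enorm fun z₀ => ?_
      by_cases hz : z₀ ∈ E
      · simpa [hz] using hN z₀ hz
      · simp [hz]
    have h4 := h3.trans (hL f hmem)
    rw [h1, hf, h2] at h4
    simpa using h4
  have hkey' : D * (volume B).toReal * Real.sqrt (volume E).toReal ≤
      L * Real.sqrt (volume B).toReal := by
    have h1 := ENNReal.toReal_mono (by
      exact ENNReal.mul_ne_top (by simp) (ENNReal.rpow_ne_top_of_nonneg (by norm_num) hBt)) hkey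
    rw [ENNReal.toReal_mul, ENNReal.toReal_mul, ENNReal.toReal_ofReal (by positivity),
      ← ENNReal.toReal_rpow, ← ENNReal.toReal_rpow, ENNReal.coe_toReal] at h1
    rwa [Real.sqrt_eq_rpow, Real.sqrt_eq_rpow]
  have hfin : D ≤ L / (Real.sqrt ((η / 4) ^ n) * V) * (ρ ^ n)⁻¹ := by
    have e1 : Real.sqrt (volume B).toReal * Real.sqrt (volume E).toReal =
        Real.sqrt ((η / 4) ^ n) * V * ρ ^ n := by
      rw [← Real.sqrt_mul hBpos.le, hBr, hEr,
        show (ρ / 4) ^ n * V * ((η * ρ) ^ n * V) = (η / 4) ^ n * (V * ρ ^ n) ^ 2 by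
          rw [div_pow, mul_pow, div_pow]; ring,
        Real.sqrt_mul (by positivity), Real.sqrt_sq (by positivity)]
      ring
    have hsq : 0 < Real.sqrt (volume B).toReal := Real.sqrt_pos.2 hBpos
    have h2 : D * (Real.sqrt ((η / 4) ^ n) * V * ρ ^ n) ≤ L := by
      rw [← e1]
      have h3 : D * (Real.sqrt (volume B).toReal * Real.sqrt (volume E).toReal) *
          Real.sqrt (volume B).toReal ≤ L * Real.sqrt (volume B).toReal := by
        refine le_trans (le_of_eq ?_) hkey'
        have := Real.mul_self_sqrt hBpos.le
        linear_combination (D * Real.sqrt (volume E).toReal) * this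
      exact le_of_mul_le_mul_right h3 hsq
    have hsη : 0 < Real.sqrt ((η / 4) ^ n) := Real.sqrt_pos.2 (by positivity)
    rw [← div_eq_mul_inv, div_div, le_div_iff₀ (by positivity)]
    exact h2
  have : |k t x y| = D + A * (ρ ^ n)⁻¹ := by rw [hDdef]; ring
  rw [this, add_mul]
  linarith

lemma Admissible.exists_regKernel {k : ℝ → Rn n → Rn n → ℝ} (hk : Admissible k) :
    ∃ δ C, RegKernel k δ C := by
  obtain ⟨⟨δ, hδ, hX, hY⟩, α, hα, hL⟩ := hk
  obtain ⟨Cs, hCs, hsize⟩ := exists_size_le hδ hX hY hα hL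
  obtain ⟨Cx, hX⟩ := hX
  obtain ⟨Cy, hY⟩ := hY
  have hn2 : ∀ (s : ℝ) (z : Rn n), 0 ≤ enorm2 s z := enorm2_nonneg
  refine ⟨δ, |Cx| + |Cy| + Cs, hδ, by positivity, ?_, ?_, ?_⟩
  · intro s t x y z hs ht h
    refine (hX s t x y z hs ht h).trans ?_
    have := hn2 s z
    have := hn2 t (x - y)
    gcongr
    linarith [le_abs_self Cx, abs_nonneg Cy]
  · intro t x y z ht h
    refine (hY t x y z ht h).trans ?_
    have := hn2 t (x - y)
    gcongr
    linarith [le_abs_self Cy, abs_nonneg Cx]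
  · intro t x y ht
    refine (hsize t x y ht).trans ?_
    have := hn2 t (x - y)
    gcongr
    linarith [abs_nonneg Cy, abs_nonneg Cx]

end NTMax
end

noncomputable section
namespace NTMax

variable {n : ℕ} {k : ℝ → Rn n → Rn n → ℝ} {δ C : ℝ}

/-! ### Comparison of values of `S^* f` at nearby points -/

lemma pk_nonneg {h r : ℝ} (hh : 0 < h) (hr : 0 ≤ r) : 0 ≤ pk n δ h r := by
  unfold pk; positivity

/-- If the displacement bound `A h` is at most half the distance `ρ`, regularity applies. Otherwise
`ρ < 2 A h`, so `h + |w - y|` is at most a multiple of `h`, `pk` is at least a multiple of `(h + |w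
- y|) ^ (-n)`, and the size bound for each of the two kernels suffices; `h ≤ t'` controls the
second. -/
lemma RegKernel.exists_diff_le (hk : RegKernel k δ C) {A c : ℝ} (hA : 0 ≤ A) (hc : 0 < c) :
    ∃ K : ℝ, 0 ≤ K ∧ ∀ (t t' h : ℝ) (x x' y w : Rn n), 0 < t → 0 < h → t < t' → h ≤ t' →
      enorm2 (t' - t) (x' - x) ≤ A * h → c * (h + ‖w - y‖) ≤ enorm2 t (x - y) →
      |k t x y - k t' x' y| ≤ K * pk n δ h ‖w - y‖ := by
  have hC := hk.nonneg
  have hδ := hk.pos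
  refine ⟨C * (A ^ δ / c ^ ((n : ℝ) + δ)) +
    (C * (c ^ n)⁻¹ + C * (2 * A / c) ^ n) * (2 * A / c) ^ δ, by positivity, ?_⟩
  intro t t' h x x' y w ht hh htt hht hAh hcR
  set R := h + ‖w - y‖ with hR
  have hR0 : 0 < R := by positivity
  set ρ := enorm2 t (x - y) with hρ
  have hρ0 : 0 < ρ := enorm2_pos ht _
  have hpk : pk n δ h ‖w - y‖ = h ^ δ / R ^ ((n : ℝ) + δ) := rfl
  have hpk0 : 0 ≤ pk n δ h ‖w - y‖ := pk_nonneg hh (norm_nonneg _)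
  have ht' : 0 < t' := by linarith
  rcases le_or_gt (A * h) (ρ / 2) with hcase | hcase
  · have h1 := hk.x_reg (t' - t) t x y (x' - x) (by linarith) ht (hAh.trans hcase)
    rw [add_sub_cancel, add_sub_cancel, abs_sub_comm] at h1
    have h2 : enorm2 (t' - t) (x' - x) ^ δ / ρ ^ ((n : ℝ) + δ) ≤
        (A * h) ^ δ / (c * R) ^ ((n : ℝ) + δ) := by
      have := enorm2_nonneg (t' - t) (x' - x)
      gcongr
    have h3 : (A * h) ^ δ / (c * R) ^ ((n : ℝ) + δ) =
        A ^ δ / c ^ ((n : ℝ) + δ) * pk n δ h ‖w - y‖ := by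
      rw [hpk, Real.mul_rpow hA hh.le, Real.mul_rpow hc.le hR0.le]
      field_simp
    calc |k t x y - k t' x' y| ≤ C * (A ^ δ / c ^ ((n : ℝ) + δ) * pk n δ h ‖w - y‖) := by
          rw [← h3]; exact h1.trans (mul_le_mul_of_nonneg_left h2 hC)
      _ ≤ _ := by
          rw [add_mul, mul_assoc C]
          exact le_add_of_nonneg_right (by positivity)
  · have hRA : R ≤ 2 * A / c * h := by
      rw [div_mul_eq_mul_div, le_div_iff₀ hc]; linarith
    have hRn : (R ^ n)⁻¹ ≤ (2 * A / c) ^ δ * pk n δ h ‖w - y‖ := by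
      have h1 : R ^ δ ≤ (2 * A / c) ^ δ * h ^ δ := by
        rw [← Real.mul_rpow (by positivity) hh.le]
        exact Real.rpow_le_rpow hR0.le hRA hδ.le
      calc (R ^ n)⁻¹ = R ^ δ / R ^ ((n : ℝ) + δ) := by
            rw [Real.rpow_add hR0, Real.rpow_natCast]
            have := Real.rpow_pos_of_pos hR0 δ
            field_simp
        _ ≤ ((2 * A / c) ^ δ * h ^ δ) / R ^ ((n : ℝ) + δ) := by gcongr
        _ = _ := by rw [hpk, mul_div_assoc]
    have h1 : |k t x y| ≤ C * (c ^ n)⁻¹ * (R ^ n)⁻¹ := by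
      refine (hk.size t x y ht).trans ?_
      rw [mul_assoc, ← mul_inv, ← mul_pow]
      gcongr
    have h2 : |k t' x' y| ≤ C * (2 * A / c) ^ n * (R ^ n)⁻¹ := by
      refine (hk.size t' x' y ht').trans ?_
      rw [mul_assoc]
      gcongr
      have h3 : h ≤ enorm2 t' (x' - y) :=
        hht.trans ((le_abs_self _).trans (abs_le_enorm2 t' (x' - y)))
      have h4 : R ≤ 2 * A / c * enorm2 t' (x' - y) :=
        hRA.trans (mul_le_mul_of_nonneg_left h3 (by positivity))
      rw [← div_eq_mul_inv, inv_le_comm₀ (pow_pos (hh.trans_le h3) n), inv_div,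
        div_le_iff₀]
      · rw [mul_comm, ← mul_pow]; gcongr
      · have : 0 < 2 * A / c := by
          by_contra hcon
          have : 2 * A / c * enorm2 t' (x' - y) ≤ 0 :=
            mul_nonpos_of_nonpos_of_nonneg (not_lt.1 hcon) (hh.le.trans h3)
          linarith
        positivity
      · have : 0 < 2 * A / c := by
          by_contra hcon
          have : 2 * A / c * enorm2 t' (x' - y) ≤ 0 :=
            mul_nonpos_of_nonpos_of_nonneg (not_lt.1 hcon) (hh.le.trans h3)
          linarith
        positivity
    calc |k t x y - k t' x' y| ≤ |k t x y| + |k t' x' y| := abs_sub _ _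
      _ ≤ (C * (c ^ n)⁻¹ + C * (2 * A / c) ^ n) * (R ^ n)⁻¹ := by rw [add_mul]; linarith
      _ ≤ (C * (c ^ n)⁻¹ + C * (2 * A / c) ^ n) * ((2 * A / c) ^ δ * pk n δ h ‖w - y‖) := by
          gcongr
      _ ≤ _ := by
          rw [add_mul (C * (A ^ δ / _)), mul_assoc (C * (c ^ n)⁻¹ + _)]
          exact le_add_of_nonneg_left (by positivity)

lemma RegKernel.abs_le (hk : RegKernel k δ C) {t : ℝ} (ht : 0 < t) (x y : Rn n) :
    |k t x y| ≤ C * (t ^ n)⁻¹ := by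
  refine (hk.size t x y ht).trans ?_
  have := hk.nonneg
  have h2 : t ≤ enorm2 t (x - y) := (le_abs_self t).trans (abs_le_enorm2 _ _)
  gcongr

lemma RegKernel.integrable_mul (hk : RegKernel k δ C) {f : Rn n → ℝ} (hf : Integrable f)
    {t : ℝ} (ht : 0 < t) (x : Rn n) : Integrable fun y => k t x y * f y :=
  hf.bdd_mul (hk.continuous ht x).aestronglyMeasurable
    (Filter.Eventually.of_forall fun y => hk.abs_le ht x y)

lemma RegKernel.enorm_Sstar_le (hk : RegKernel k δ C) {f : Rn n → ℝ} {t : ℝ} (ht : 0 < t)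
    (x : Rn n) : ‖Sstar k f t x‖ₑ ≤ ENNReal.ofReal (C * (t ^ n)⁻¹) * ∫⁻ y, ‖f y‖ₑ := by
  refine (enorm_integral_le_lintegral_enorm _).trans ?_
  rw [← lintegral_const_mul' _ _ (by simp)]
  refine lintegral_mono fun y => ?_
  rw [enorm_mul]
  gcongr
  rw [← ofReal_norm]
  exact ENNReal.ofReal_le_ofReal (hk.abs_le ht x y)

/-- The main comparison tool. The separation condition is only required where `f y ≠ 0`, so `t` may
be far smaller than `h` when `f` vanishes near `x`. -/
lemma RegKernel.exists_enorm_Sstar_le_add (hk : RegKernel k δ C) {A c : ℝ} (hA : 0 ≤ A)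
    (hc : 0 < c) :
    ∃ K : ℝ≥0, ∀ (f : Rn n → ℝ) (t t' h : ℝ) (x x' w : Rn n), Integrable f → 0 < t → 0 < h →
      t < t' → h ≤ t' → enorm2 (t' - t) (x' - x) ≤ A * h →
      (∀ y, f y ≠ 0 → c * (h + ‖w - y‖) ≤ enorm2 t (x - y)) →
      ‖Sstar k f t x‖ₑ ≤ ‖Sstar k f t' x'‖ₑ + K * maxFn (fun y => ‖f y‖ₑ) w := by
  obtain ⟨K, hK0, hK⟩ := hk.exists_diff_le hA hc
  obtain ⟨K', hK'⟩ := exists_lintegral_pk_le n hk.pos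
  refine ⟨K.toNNReal * K', fun f t t' h x x' w hf ht hh htt hht hAh hy => ?_⟩
  have ht' : 0 < t' := by linarith
  have e : Sstar k f t x = Sstar k f t' x' + ∫ y, (k t x y - k t' x' y) * f y := by
    unfold Sstar
    rw [← integral_add (hk.integrable_mul hf ht' x')]
    · congr 1; ext y; ring
    · simp_rw [sub_mul]
      exact (hk.integrable_mul hf ht x).sub (hk.integrable_mul hf ht' x')
  rw [e]
  refine (enorm_add_le _ _).trans (add_le_add le_rfl ?_)
  calc ‖∫ y, (k t x y - k t' x' y) * f y‖ₑ ≤ ∫⁻ y, ‖(k t x y - k t' x' y) * f y‖ₑ :=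
        enorm_integral_le_lintegral_enorm _
    _ ≤ ∫⁻ y, K.toNNReal * (ENNReal.ofReal (pk n δ h ‖w - y‖) * ‖f y‖ₑ) := by
        refine lintegral_mono fun y => ?_
        rw [enorm_mul, ← mul_assoc]
        by_cases hfy : f y = 0
        · simp [hfy]
        gcongr
        rw [← ofReal_norm, Real.norm_eq_abs]
        change _ ≤ ENNReal.ofReal K * _
        rw [← ENNReal.ofReal_mul hK0]
        exact ENNReal.ofReal_le_ofReal
          (hK t t' h x x' y w ht hh htt hht hAh (hy y hfy))
    _ = K.toNNReal * ∫⁻ y, ENNReal.ofReal (pk n δ h ‖w - y‖) * ‖f y‖ₑ := by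
        rw [lintegral_const_mul' _ _ (by simp)]
    _ ≤ K.toNNReal * (K' * maxFn (fun y => ‖f y‖ₑ) w) := by
        gcongr
        exact hK' _ h w hf.aestronglyMeasurable.enorm hh
    _ = _ := by push_cast; ring

/-- The supremum of `|F|` over the vertical line above `z`. -/
def vertSup (F : ℝ → Rn n → ℝ) (z : Rn n) : ℝ≥0∞ := ⨆ (t : ℝ) (_ : 0 < t), ‖F t z‖ₑ

lemma le_vertSup (F : ℝ → Rn n → ℝ) (z : Rn n) {t : ℝ} (ht : 0 < t) :
    ‖F t z‖ₑ ≤ vertSup F z :=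
  le_iSup₂ (f := fun (t : ℝ) (_ : 0 < t) => ‖F t z‖ₑ) t ht

/-- The point `(t, x)` of the cone is compared with `(2 t, z)` on the axis, at scale `h = t`. -/
lemma RegKernel.exists_coneSup_le (hk : RegKernel k δ C) {β : ℝ} (hβ : 0 < β) :
    ∃ K : ℝ≥0, ∀ (f : Rn n → ℝ) (z : Rn n), Integrable f →
      coneSup β (Sstar k f) z ≤ vertSup (Sstar k f) z + K * maxFn (fun y => ‖f y‖ₑ) z := by
  obtain ⟨K, hK⟩ := hk.exists_enorm_Sstar_le_add (A := 1 + β) (c := (2 + β)⁻¹) (by positivity)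
    (by positivity)
  refine ⟨K, fun f z hf => iSup₂_le fun P hP => ?_⟩
  obtain ⟨ht, hx⟩ := hP
  set t := P.1
  set x := P.2
  refine (hK f t (2 * t) t x z z hf ht ht (by linarith) (by linarith) ?_ ?_).trans
    (add_le_add (le_vertSup (Sstar k f) z (by positivity)) le_rfl)
  · refine (enorm2_le _ _).trans ?_
    rw [norm_sub_rev, abs_of_pos (by linarith)]
    linarith
  · intro y _
    rw [inv_mul_le_iff₀ (by positivity)]
    have h1 := norm_le_enorm2 t (x - y)
    have h2 := (le_abs_self t).trans (abs_le_enorm2 t (x - y))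
    have h3 : ‖z - y‖ ≤ ‖z - x‖ + ‖x - y‖ := norm_sub_le_norm_sub_add_norm_sub _ _ _
    rw [norm_sub_rev z x] at h3
    have h4 : β * t ≤ β * enorm2 t (x - y) := by gcongr
    linarith

/-- The value at `(t, z)` is compared with one at a point of a box above it where the essential
bound holds. Together with `RegKernel.exists_coneSup_le` this changes the aperture at the cost of a
maximal function. -/
lemma RegKernel.exists_vertSup_le (hk : RegKernel k δ C) {α : ℝ} (hα : 0 < α) :
    ∃ K : ℝ≥0, ∀ (f : Rn n → ℝ) (z : Rn n), Integrable f →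
      vertSup (Sstar k f) z ≤ ntMax α (Sstar k f) z + K * maxFn (fun y => ‖f y‖ₑ) z := by
  obtain ⟨K, hK⟩ := hk.exists_enorm_Sstar_le_add (A := 2 + α) (c := 2⁻¹) (by positivity)
    (by positivity)
  refine ⟨K, fun f z hf => iSup₂_le fun t ht => ?_⟩
  obtain ⟨P, ⟨⟨h1, h2⟩, h3⟩, hP⟩ := exists_mem_enorm_le_ntMax (α := α) (Sstar k f) z
    (U := Set.Ioo (2 * t) (3 * t) ×ˢ Metric.ball z (α * t)) (isOpen_Ioo.prod Metric.isOpen_ball)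
    ⟨(2.5 * t, z), ⟨by constructor <;> dsimp only <;> linarith,
      Metric.mem_ball_self (by positivity)⟩⟩ (by
      rintro P ⟨⟨h1, h2⟩, h3⟩
      rw [Metric.mem_ball, dist_eq_norm] at h3
      refine ⟨by linarith, h3.trans ?_⟩
      gcongr
      linarith)
  rw [Metric.mem_ball, dist_eq_norm] at h3
  refine (hK f t P.1 t z P.2 z hf ht ht (by linarith) (by linarith) ?_ ?_).trans
    (add_le_add hP le_rfl)
  · refine (enorm2_le _ _).trans ?_
    rw [abs_of_pos (by linarith)]
    linarith
  · intro y _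
    have h1 := norm_le_enorm2 t (z - y)
    have h2 := (le_abs_self t).trans (abs_le_enorm2 t (z - y))
    linarith

end NTMax
end

noncomputable section
namespace NTMax

variable {n : ℕ} {k : ℝ → Rn n → Rn n → ℝ} {δ C : ℝ}

/-! ### Maximal dyadic cubes in a set -/

lemma dy_subset_parent (k : ℤ) (m : Fin n → ℤ) :
    (dy k m : Set (Rn n)) ⊆ dy (k - 1) fun i => m i / 2 := by
  rintro x rfl
  funext i
  have := idx_div (k - 1) 1 x i
  simpa using this

/-- The maximal dyadic cubes contained in a set. -/
def whit (E : Set (Rn n)) : Set (ℤ × (Fin n → ℤ)) :=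
  {Q | dy Q.1 Q.2 ⊆ E ∧ ¬ dy (Q.1 - 1) (fun i => Q.2 i / 2) ⊆ E}

lemma whit_eq_of_mem {E : Set (Rn n)} {Q Q' : ℤ × (Fin n → ℤ)} (hQ : Q ∈ whit E)
    (hQ' : Q' ∈ whit E) {x : Rn n} (hx : x ∈ dy Q.1 Q.2) (hx' : x ∈ dy Q'.1 Q'.2) : Q = Q' := by
  have key : ∀ {Q Q' : ℤ × (Fin n → ℤ)}, Q ∈ whit E → Q' ∈ whit E → x ∈ dy Q.1 Q.2 →
      x ∈ dy Q'.1 Q'.2 → Q'.1 ≤ Q.1 := by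
    intro Q Q' hQ hQ' hx hx'
    by_contra hlt
    exact hQ'.2 ((dy_subset_of_le (by omega) hx (dy_subset_parent _ _ hx')).trans hQ.1)
  have h1 : Q.1 = Q'.1 := le_antisymm (key hQ' hQ hx' hx) (key hQ hQ' hx hx')
  refine Prod.ext h1 ?_
  rw [dy, Set.mem_ofPred_eq] at hx hx'
  rw [← hx, ← hx', h1]

lemma pairwiseDisjoint_whit (E : Set (Rn n)) :
    (whit E).PairwiseDisjoint fun Q => (dy Q.1 Q.2 : Set (Rn n)) := by
  intro Q hQ Q' hQ' hne
  rw [Function.onFun, Set.disjoint_left]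
  intro x hx hx'
  exact hne (whit_eq_of_mem hQ hQ' hx hx')

/-- For `n ≥ 1` volumes of dyadic cubes are unbounded, so a set of finite volume contains no
arbitrarily large ones. This is what makes maximal cubes exist. -/
lemma exists_le_of_dvol_le (hn : 1 ≤ n) {v : ℝ≥0∞} (hv : v ≠ ∞) :
    ∃ b : ℤ, ∀ k, dvol n k ≤ v → b ≤ k := by
  refine ⟨-⌈v.toReal + 1⌉₊, fun k hk => ?_⟩
  by_contra hcon
  push Not at hcon
  obtain ⟨j, rfl⟩ : ∃ j : ℕ, k = -j := ⟨k.natAbs, by omega⟩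
  have hj : v.toReal + 1 ≤ j := by
    refine (Nat.le_ceil _).trans ?_
    exact_mod_cast (by omega : ⌈v.toReal + 1⌉₊ ≤ j)
  have h2 : (j : ℝ) < 2 ^ j := by exact_mod_cast Nat.lt_two_pow_self
  have h3 : len (-(j : ℤ)) = 2 ^ j := by simp [len]
  have h4 : ENNReal.ofReal (2 ^ j) ≤ dvol n (-(j : ℤ)) := by
    rw [dvol, h3]
    refine le_self_pow₀ ?_ (by omega)
    rw [ENNReal.one_le_ofReal]
    exact one_le_pow₀ (by norm_num)
  have h5 := (ENNReal.ofReal_le_iff_le_toReal hv).1 (h4.trans hk)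
  linarith

lemma exists_mem_whit (hn : 1 ≤ n) {E : Set (Rn n)} (hE : volume E ≠ ∞)
    {x : Rn n} (hx : ∃ k, dy k (idx k x) ⊆ E) : ∃ Q ∈ whit E, x ∈ dy Q.1 Q.2 := by
  obtain ⟨b, hb⟩ := exists_le_of_dvol_le hn hE
  obtain ⟨k, hk, hmin⟩ := Int.exists_least_of_bdd (P := fun k => dy k (idx k x) ⊆ E)
    ⟨b, fun k hk => hb k (by rw [← volume_dy k (idx k x)]; exact measure_mono hk)⟩ hx
  refine ⟨(k, idx k x), ⟨hk, fun hcon => ?_⟩, mem_dy_idx k x⟩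
  have h1 : idx (k - 1) x = fun i => idx k x i / 2 := dy_subset_parent k _ (mem_dy_idx k x)
  dsimp only at hcon
  rw [← h1] at hcon
  have := hmin _ hcon
  omega

lemma biUnion_whit (hn : 1 ≤ n) {E : Set (Rn n)} (hE : volume E ≠ ∞)
    (ho : ∀ x ∈ E, ∃ k, dy k (idx k x) ⊆ E) : ⋃ Q ∈ whit E, dy Q.1 Q.2 = E := by
  apply Set.Subset.antisymm
  · exact Set.iUnion₂_subset fun Q hQ => hQ.1
  · intro x hx
    obtain ⟨Q, hQ, hxQ⟩ := exists_mem_whit hn hE (ho x hx)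
    exact Set.mem_biUnion hQ hxQ

lemma exists_dy_subset_of_isOpen {E : Set (Rn n)} (hE : IsOpen E) {x : Rn n} (hx : x ∈ E) :
    ∃ k, dy k (idx k x) ⊆ E := by
  obtain ⟨ε, hε, hb⟩ := Metric.isOpen_iff.1 hE x hx
  obtain ⟨k, -, hk⟩ := exists_len_between (r := ε / (4 * (Real.sqrt n + 1))) (by positivity)
  refine ⟨k, fun y hy => hb ?_⟩
  rw [Metric.mem_ball, dist_eq_norm]
  refine (norm_sub_le_of_mem_dy hy (mem_dy_idx k x)).trans_lt ?_
  have h0 := len_pos k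
  have h1 : 0 ≤ Real.sqrt n := Real.sqrt_nonneg _
  have h2 : len k * (Real.sqrt n + 1) ≤ ε / 2 := by
    refine (mul_le_mul_of_nonneg_right hk (by positivity)).trans (le_of_eq ?_)
    field_simp
    norm_num
  nlinarith

/-! ### The Calderón–Zygmund decomposition -/

/-- Lebesgue differentiation over balls; the constant compares a ball with a dyadic cube whose
triple contains it. -/
lemma ae_le_maxFn (f : Rn n → ℝ≥0∞) (hf : AEMeasurable f) (hf' : ∫⁻ x, f x ≠ ∞) :
    ∀ᵐ x, f x ≤ 2 ^ n * (volume (Metric.ball (0 : Rn n) 1))⁻¹ * maxFn f x := by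
  filter_upwards [VitaliFamily.ae_tendsto_lintegral_div
    (Besicovitch.vitaliFamily (volume : Measure (Rn n))) hf hf'] with x hx
  have h1 := hx.comp (Besicovitch.tendsto_filterAt volume x)
  refine le_of_tendsto h1 ?_
  filter_upwards [self_mem_nhdsWithin] with r hr
  rw [Set.mem_Ioi] at hr
  simp only [Function.comp]
  rw [volume_closedBall _ hr.le]
  have hr0 : ENNReal.ofReal (r ^ n) ≠ 0 := by
    rw [ENNReal.ofReal_ne_zero_iff]; positivity
  refine ENNReal.div_le_of_le_mul ?_
  refine (lintegral_closedBall_le f x hr).trans (le_of_eq ?_)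
  rw [ENNReal.ofReal_mul (by norm_num), mul_pow, ENNReal.ofReal_pow hr.le]
  rw [show 2 ^ n * (volume (Metric.ball (0 : Rn n) 1))⁻¹ * maxFn f x *
    (ENNReal.ofReal r ^ n * volume (Metric.ball (0 : Rn n) 1)) =
    2 ^ n * ENNReal.ofReal r ^ n * maxFn f x * ((volume (Metric.ball (0 : Rn n) 1))⁻¹ *
      volume (Metric.ball (0 : Rn n) 1)) by ring,
    ENNReal.inv_mul_cancel volume_ball_ne_zero volume_ball_ne_top]
  simp

lemma volume_lt_maxFn_ne_top {f : Rn n → ℝ≥0∞} (hf : ∫⁻ x, f x ≠ ∞) {c : ℝ≥0∞} (hc : c ≠ 0) :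
    volume {z | c < maxFn f z} ≠ ∞ := by
  intro h
  have h1 := volume_lt_maxFn_le f c
  rw [h, ENNReal.mul_top hc, top_le_iff] at h1
  exact ENNReal.mul_ne_top (by finiteness) hf h1

lemma maxFn_dyadic_open (f : Rn n → ℝ≥0∞) (c : ℝ≥0∞) :
    ∀ x ∈ {z | c < maxFn f z}, ∃ k, dy k (idx k x) ⊆ {z | c < maxFn f z} :=
  fun _ hx => exists_dy_subset_lt_maxFn hx

lemma biUnion_whit_maxFn (hn : 1 ≤ n) {f : Rn n → ℝ≥0∞} (hf : ∫⁻ x, f x ≠ ∞) {c : ℝ≥0∞}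
    (hc : c ≠ 0) : ⋃ Q ∈ whit {z | c < maxFn f z}, dy Q.1 Q.2 = {z | c < maxFn f z} :=
  biUnion_whit hn (volume_lt_maxFn_ne_top hf hc) (maxFn_dyadic_open f c)

lemma measurableSet_lt_maxFn (hn : 1 ≤ n) {f : Rn n → ℝ≥0∞} (hf : ∫⁻ x, f x ≠ ∞) {c : ℝ≥0∞}
    (hc : c ≠ 0) : MeasurableSet {z | c < maxFn f z} := by
  rw [← biUnion_whit_maxFn hn hf hc]
  exact MeasurableSet.biUnion (Set.to_countable _) fun Q _ => measurableSet_dy _ _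

/-- By maximality the parent contains a point where the maximal function is at most `c`; the factor
`2 ^ n` is the volume ratio of parent and child. -/
lemma lintegral_dy_le_of_mem_whit {f : Rn n → ℝ≥0∞} {c : ℝ≥0∞} {Q : ℤ × (Fin n → ℤ)}
    (hQ : Q ∈ whit {z | c < maxFn f z}) :
    ∫⁻ y in dy Q.1 Q.2, f y ≤ 2 ^ n * c * dvol n Q.1 := by
  obtain ⟨z, hz, hz'⟩ := Set.not_subset.1 hQ.2
  rw [Set.mem_ofPred_eq, not_lt] at hz'
  calc ∫⁻ y in dy Q.1 Q.2, f y ≤ ∫⁻ y in tri (Q.1 - 1) (fun i => Q.2 i / 2), f y :=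
        lintegral_mono_set ((dy_subset_parent _ _).trans (dy_subset_tri _ _))
    _ ≤ dvol n (Q.1 - 1) * maxFn f z := lintegral_tri_le f hz
    _ ≤ dvol n (Q.1 - 1) * c := by gcongr
    _ = _ := by rw [dvol_sub_one]; ring

/-- The good function is the average of `f` on each maximal dyadic cube of the superlevel set and
`f` elsewhere. -/
lemma exists_good_part (hn : 1 ≤ n) {f : Rn n → ℝ} (hfm : Measurable f) (hf : Integrable f)
    {c : ℝ≥0∞} (hc : c ≠ 0) :
    ∃ g : Rn n → ℝ, Measurable g ∧
      (∀ x, ¬ c < maxFn (fun y => ‖f y‖ₑ) x → g x = f x) ∧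
      (∀ x, c < maxFn (fun y => ‖f y‖ₑ) x → ‖g x‖ₑ ≤ 2 ^ n * c) ∧
      ∀ Q ∈ whit {z | c < maxFn (fun y => ‖f y‖ₑ) z}, ∫ y in dy Q.1 Q.2, (f y - g y) = 0 := by
  classical
  set Ω := {z | c < maxFn (fun y => ‖f y‖ₑ) z} with hΩ
  have hfi : ∫⁻ x, ‖f x‖ₑ ≠ ∞ := hf.2.ne
  have hΩt : volume Ω ≠ ∞ := volume_lt_maxFn_ne_top hfi hc
  have hex : ∀ x ∈ Ω, ∃ Q ∈ whit Ω, x ∈ dy Q.1 Q.2 := fun x hx =>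
    exists_mem_whit hn hΩt (maxFn_dyadic_open _ c x hx)
  choose! q hqw hqx using hex
  let av : ℤ × (Fin n → ℤ) → ℝ := fun Q => (dvol n Q.1).toReal⁻¹ * ∫ y in dy Q.1 Q.2, f y
  have hav : ∀ Q ∈ whit Ω, ‖av Q‖ₑ ≤ 2 ^ n * c := by
    intro Q hQ
    have h1 : ‖∫ y in dy Q.1 Q.2, f y‖ₑ ≤ 2 ^ n * c * dvol n Q.1 :=
      (enorm_integral_le_lintegral_enorm _).trans (lintegral_dy_le_of_mem_whit hQ)
    have h2 : ‖(dvol n Q.1).toReal⁻¹‖ₑ = (dvol n Q.1)⁻¹ := by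
      rw [enorm_inv (ENNReal.toReal_ne_zero.2 ⟨dvol_ne_zero _, dvol_ne_top _⟩),
        Real.enorm_eq_ofReal ENNReal.toReal_nonneg, ENNReal.ofReal_toReal (dvol_ne_top _)]
    calc ‖av Q‖ₑ ≤ (dvol n Q.1)⁻¹ * (2 ^ n * c * dvol n Q.1) := by
          simp only [av]
          rw [enorm_mul, h2]; gcongr
      _ = 2 ^ n * c * ((dvol n Q.1)⁻¹ * dvol n Q.1) := by ring
      _ = _ := by rw [ENNReal.inv_mul_cancel (dvol_ne_zero _) (dvol_ne_top _), mul_one]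
  let g : Rn n → ℝ := fun x => if x ∈ Ω then av (q x) else f x
  have hgQ : ∀ Q ∈ whit Ω, ∀ x ∈ dy Q.1 Q.2, g x = av Q := by
    intro Q hQ x hx
    have hxΩ := hQ.1 hx
    simp only [g, if_pos hxΩ]
    rw [whit_eq_of_mem (hqw x hxΩ) hQ (hqx x hxΩ) hx]
  refine ⟨g, ?_, ?_, ?_, ?_⟩
  · intro s hs
    have : g ⁻¹' s = (Ωᶜ ∩ f ⁻¹' s) ∪ ⋃ Q ∈ {Q ∈ whit Ω | av Q ∈ s}, dy Q.1 Q.2 := by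
      ext x
      by_cases hx : x ∈ Ω
      · constructor
        · intro h
          refine Or.inr (Set.mem_biUnion (x := q x) ⟨hqw x hx, ?_⟩ (hqx x hx))
          simpa [g, hx] using h
        · rintro (h | h)
          · exact absurd hx h.1
          · obtain ⟨Q, ⟨hQ, hQs⟩, hxQ⟩ := Set.mem_iUnion₂.1 h
            rw [Set.mem_preimage, hgQ Q hQ x hxQ]
            exact hQs
      · constructor
        · intro h
          refine Or.inl ⟨hx, ?_⟩
          simpa [g, hx] using h
        · rintro (h | h)
          · simpa [g, hx] using h.2
          · obtain ⟨Q, ⟨hQ, hQs⟩, hxQ⟩ := Set.mem_iUnion₂.1 h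
            exact absurd (hQ.1 hxQ) hx
    rw [this]
    exact ((measurableSet_lt_maxFn hn hfi hc).compl.inter (hfm hs)).union
      (MeasurableSet.biUnion (Set.to_countable _) fun Q _ => measurableSet_dy _ _)
  · intro x hx
    exact if_neg hx
  · intro x hx
    have hx' : x ∈ Ω := hx
    simp only [g, if_pos hx']
    exact hav _ (hqw x hx')
  · intro Q hQ
    have h1 : ∫ y in dy Q.1 Q.2, (f y - g y) = ∫ y in dy Q.1 Q.2, (f y - av Q) :=
      setIntegral_congr_fun (measurableSet_dy _ _) fun y hy => by
        simp only [hgQ Q hQ y hy]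
    have hv : volume (dy Q.1 Q.2 : Set (Rn n)) ≠ ∞ := by rw [volume_dy]; exact dvol_ne_top _
    rw [h1, integral_sub hf.integrableOn (integrableOn_const hv), setIntegral_const,
      Measure.real, volume_dy, smul_eq_mul]
    simp only [av]
    rw [mul_inv_cancel_left₀ (ENNReal.toReal_ne_zero.2 ⟨dvol_ne_zero _, dvol_ne_top _⟩), sub_self]

end NTMax
end

noncomputable section
namespace NTMax

variable {n : ℕ} {k : ℝ → Rn n → Rn n → ℝ} {δ C : ℝ}

/-! ### The weak type estimate -/

lemma RegKernel.exists_y_diff_le (hk : RegKernel k δ C) (hn : 1 ≤ n) :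
    ∃ K : ℝ, 0 ≤ K ∧ ∀ (t l : ℝ) (z y y' : Rn n), 0 < t → 0 < l → ‖y' - y‖ ≤ Real.sqrt n * l →
      2 * (Real.sqrt n * l) ≤ ‖z - y‖ → |k t z y' - k t z y| ≤ K * pk n δ l ‖z - y‖ := by
  have hC := hk.nonneg
  have hδ := hk.pos
  have hn1 : 1 ≤ Real.sqrt n := by
    rw [Real.one_le_sqrt]; exact_mod_cast hn
  refine ⟨C * (Real.sqrt n ^ δ * 2 ^ ((n : ℝ) + δ)), by positivity, ?_⟩
  intro t l z y y' ht hl hy hz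
  have h0 := norm_le_enorm2 t (z - y)
  have h1 := hk.y_reg t z y (y' - y) ht (by linarith)
  rw [add_sub_cancel] at h1
  refine h1.trans ?_
  rw [mul_assoc]
  gcongr
  have hln : l ≤ Real.sqrt n * l := le_mul_of_one_le_left hl.le hn1
  calc ‖y' - y‖ ^ δ / enorm2 t (z - y) ^ ((n : ℝ) + δ)
      ≤ (Real.sqrt n * l) ^ δ / ((l + ‖z - y‖) / 2) ^ ((n : ℝ) + δ) := by
        gcongr
        linarith
    _ = _ := by
        unfold pk
        rw [Real.mul_rpow (by positivity) hl.le, Real.div_rpow (by positivity) (by norm_num)]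
        field_simp

lemma measurable_pk (δ h : ℝ) :
    Measurable fun p : Rn n × Rn n => ENNReal.ofReal (pk n δ h ‖p.1 - p.2‖) := by
  unfold pk
  fun_prop

/-- Away from dilates of the cubes, the vanishing mean allows subtracting `k t z (yc Q)` on each
cube. The resulting bound does not involve `t`, so the supremum over `t` costs nothing, and its
integral in `z` is at most a multiple of the `L_1` norm of `b`. The dilates themselves have total
measure at most a multiple of that of the cubes. -/
lemma RegKernel.exists_vertSup_le_of_cancellation (hk : RegKernel k δ C) (hn : 1 ≤ n) :
    ∃ K : ℝ≥0, ∀ (b : Rn n → ℝ) (𝒬 : Set (ℤ × (Fin n → ℤ))) (c : ℝ≥0∞), Measurable b →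
      Integrable b → (𝒬.PairwiseDisjoint fun Q => (dy Q.1 Q.2 : Set (Rn n))) →
      (∀ x, x ∉ ⋃ Q ∈ 𝒬, (dy Q.1 Q.2 : Set (Rn n)) → b x = 0) →
      (∀ Q ∈ 𝒬, ∫ y in dy Q.1 Q.2, b y = 0) →
      c * volume {z | c < vertSup (Sstar k b) z} ≤
        K * (∫⁻ y, ‖b y‖ₑ) + K * (c * volume (⋃ Q ∈ 𝒬, (dy Q.1 Q.2 : Set (Rn n)))) := by
  obtain ⟨K₀, hK₀, hdiff⟩ := hk.exists_y_diff_le hn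
  obtain ⟨K₁, hpk⟩ := exists_lintegral_pk_le n hk.pos
  set V : ℝ≥0∞ := volume (Metric.ball (0 : Rn n) 1) with hV
  set D : ℝ≥0∞ := ENNReal.ofReal ((3 * Real.sqrt n) ^ n) * V with hD
  have hDt : D ≠ ∞ := ENNReal.mul_ne_top ENNReal.ofReal_ne_top volume_ball_ne_top
  refine ⟨K₀.toNNReal * (K₁ * 3 ^ n) + D.toNNReal, fun b 𝒬 c hbm hb hdis hsupp hcanc => ?_⟩
  set Ω : Set (Rn n) := ⋃ Q ∈ 𝒬, (dy Q.1 Q.2 : Set (Rn n)) with hΩ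
  have hcount : 𝒬.Countable := Set.to_countable _
  have hmeas : ∀ Q ∈ 𝒬, MeasurableSet (dy Q.1 Q.2 : Set (Rn n)) := fun Q _ =>
    measurableSet_dy _ _
  have hne : ∀ Q : ℤ × (Fin n → ℤ), ∃ y : Rn n, y ∈ dy Q.1 Q.2 := by
    intro Q
    refine nonempty_of_measure_ne_zero (μ := volume) ?_
    rw [volume_dy]
    exact dvol_ne_zero _
  choose yc hyc using hne
  set B : Rn n → ℝ≥0∞ := fun z => ∑' Q : 𝒬, ∫⁻ y in dy Q.1.1 Q.1.2,
    ENNReal.ofReal K₀ * (ENNReal.ofReal (pk n δ (len Q.1.1) ‖z - y‖) * ‖b y‖ₑ) with hB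
  have hjm : ∀ Q : 𝒬, Measurable fun p : Rn n × Rn n =>
      ENNReal.ofReal K₀ * (ENNReal.ofReal (pk n δ (len Q.1.1) ‖p.1 - p.2‖) * ‖b p.2‖ₑ) :=
    fun Q => ((measurable_pk δ (len Q.1.1)).mul
      (hbm.comp measurable_snd).enorm).const_mul _
  have hBm : Measurable B := by
    refine Measurable.tsum fun Q => ?_
    exact (hjm Q).lintegral_prod_right'
  -- Outside the ball of radius `3 √n len` about `yc Q`, every `y` in the cube is at distance at
  -- least `2 √n len` from `z`, as `RegKernel.exists_y_diff_le` requires.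
  set Ωs : Set (Rn n) := ⋃ Q ∈ 𝒬, Metric.closedBall (yc Q) (3 * Real.sqrt n * len Q.1) with hΩs
  have hvolΩ : volume Ω = ∑' Q : 𝒬, dvol n Q.1.1 := by
    rw [hΩ, measure_biUnion hcount hdis hmeas]
    simp_rw [volume_dy]
  have hvolΩs : volume Ωs ≤ D * volume Ω := by
    rw [hvolΩ, ← ENNReal.tsum_mul_left]
    refine (measure_biUnion_le _ hcount _).trans (ENNReal.tsum_le_tsum fun Q => ?_)
    rw [volume_closedBall _ (by have := len_pos Q.1.1; positivity), mul_pow,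
      ENNReal.ofReal_mul (by positivity), hD, dvol, ENNReal.ofReal_pow (len_pos _).le]
    exact le_of_eq (by ring)
  have hpt : ∀ z ∉ Ωs, vertSup (Sstar k b) z ≤ B z := by
    intro z hz
    refine iSup₂_le fun t ht => ?_
    have hInt := hk.integrable_mul hb ht z
    have e1 : Sstar k b t z = ∑' Q : 𝒬, ∫ y in dy Q.1.1 Q.1.2, k t z y * b y := by
      have h1 := hasSum_integral_iUnion (μ := volume) (f := fun y => k t z y * b y)
        (s := fun Q : 𝒬 => (dy Q.1.1 Q.1.2 : Set (Rn n))) (fun Q => measurableSet_dy _ _)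
        (fun Q Q' h => hdis Q.2 Q'.2 (fun h' => h (Subtype.ext h'))) hInt.integrableOn
      rw [h1.tsum_eq]
      unfold Sstar
      rw [setIntegral_eq_integral_of_forall_compl_eq_zero]
      intro y hy
      rw [hsupp y (by rwa [hΩ, Set.biUnion_eq_iUnion]), mul_zero]
    rw [e1]
    refine enorm_tsum_le_tsum_enorm.trans (ENNReal.tsum_le_tsum fun Q => ?_)
    have e2 : ∫ y in dy Q.1.1 Q.1.2, k t z y * b y =
        ∫ y in dy Q.1.1 Q.1.2, (k t z y - k t z (yc Q)) * b y := by
      simp_rw [sub_mul]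
      rw [integral_sub hInt.integrableOn (hb.integrableOn.const_mul _), integral_const_mul,
        hcanc Q.1 Q.2, mul_zero, sub_zero]
    rw [e2]
    refine (enorm_integral_le_lintegral_enorm _).trans ?_
    refine setLIntegral_mono' (measurableSet_dy _ _) fun y hy => ?_
    rw [enorm_mul, ← mul_assoc]
    gcongr
    rw [← ofReal_norm, ← ENNReal.ofReal_mul hK₀, Real.norm_eq_abs, abs_sub_comm]
    refine ENNReal.ofReal_le_ofReal (hdiff t _ z y (yc Q) ht (len_pos _)
      (norm_sub_le_of_mem_dy (hyc Q) hy) ?_)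
    have h3 : 3 * Real.sqrt n * len Q.1.1 < ‖z - yc Q‖ := by
      by_contra hcon
      refine hz (Set.mem_biUnion Q.2 ?_)
      rw [Metric.mem_closedBall, dist_eq_norm]
      exact not_lt.1 hcon
    have h4 : ‖z - yc Q‖ ≤ ‖z - y‖ + ‖y - yc Q‖ := norm_sub_le_norm_sub_add_norm_sub _ _ _
    have h5 := norm_sub_le_of_mem_dy hy (hyc Q)
    linarith
  have hBint : ∫⁻ z, B z ≤ (K₀.toNNReal * (K₁ * 3 ^ n) : ℝ≥0) * ∫⁻ y, ‖b y‖ₑ := by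
    rw [hB, lintegral_tsum fun Q => (hjm Q).lintegral_prod_right'.aemeasurable]
    calc ∑' Q : 𝒬, ∫⁻ z, ∫⁻ y in dy Q.1.1 Q.1.2,
          ENNReal.ofReal K₀ * (ENNReal.ofReal (pk n δ (len Q.1.1) ‖z - y‖) * ‖b y‖ₑ)
        ≤ ∑' Q : 𝒬, ∫⁻ y in dy Q.1.1 Q.1.2,
          (K₀.toNNReal * (K₁ * 3 ^ n) : ℝ≥0) * ‖b y‖ₑ := by
          refine ENNReal.tsum_le_tsum fun Q => ?_
          rw [lintegral_lintegral_swap (hjm Q).aemeasurable]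
          refine lintegral_mono fun y => ?_
          -- Total mass of the radial kernel, read off from the maximal bound for the constant
          -- function `1`.
          have h1 : ∫⁻ z, ENNReal.ofReal (pk n δ (len Q.1.1) ‖z - y‖) ≤ K₁ * 3 ^ n := by
            have h2 := hpk (fun _ => 1) (len Q.1.1) y aemeasurable_const (len_pos _)
            simp only [mul_one] at h2
            simp_rw [norm_sub_rev y] at h2
            refine h2.trans ?_
            gcongr
            simpa using maxFn_le_of_ae_le (f := fun _ : Rn n => 1) (c := 1) (by simp) y
          simp_rw [← mul_assoc]
          rw [lintegral_mul_const' _ _ (by simp), lintegral_const_mul' _ _ (by simp)]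
          push_cast
          rw [show (K₀.toNNReal : ℝ≥0∞) = ENNReal.ofReal K₀ from rfl, mul_assoc _ (K₁ : ℝ≥0∞)]
          exact mul_le_mul' (mul_le_mul' le_rfl h1) le_rfl
      _ = (K₀.toNNReal * (K₁ * 3 ^ n) : ℝ≥0) * ∫⁻ y in Ω, ‖b y‖ₑ := by
          rw [hΩ, lintegral_biUnion hcount hmeas hdis, ← ENNReal.tsum_mul_left]
          congr with Q
          rw [lintegral_const_mul' _ _ ENNReal.coe_ne_top]
      _ ≤ _ := by
          gcongr
          exact Measure.restrict_le_self
  have hsub : {z | c < vertSup (Sstar k b) z} ⊆ {z | c ≤ B z} ∪ Ωs := by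
    intro z hz
    by_cases hzs : z ∈ Ωs
    · exact Or.inr hzs
    · exact Or.inl ((le_of_lt hz).trans (hpt z hzs))
  calc c * volume {z | c < vertSup (Sstar k b) z}
      ≤ c * (volume {z | c ≤ B z} + volume Ωs) := by
        gcongr
        exact (measure_mono hsub).trans (measure_union_le _ _)
    _ ≤ (K₀.toNNReal * (K₁ * 3 ^ n) : ℝ≥0) * (∫⁻ y, ‖b y‖ₑ) + D * (c * volume Ω) := by
        rw [mul_add]
        refine add_le_add ((mul_meas_ge_le_lintegral hBm c).trans hBint) ?_
        rw [mul_left_comm]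
        gcongr
    _ ≤ _ := by
        gcongr
        · exact_mod_cast le_self_add
        · rw [← ENNReal.coe_toNNReal hDt]
          exact_mod_cast le_add_self

lemma vertSup_add_le (hk : RegKernel k δ C) {g b : Rn n → ℝ} (hg : Integrable g)
    (hb : Integrable b) (z : Rn n) :
    vertSup (Sstar k fun y => g y + b y) z ≤
      vertSup (Sstar k g) z + vertSup (Sstar k b) z := by
  refine iSup₂_le fun t ht => ?_
  have : Sstar k (fun y => g y + b y) t z = Sstar k g t z + Sstar k b t z := by
    unfold Sstar
    simp_rw [mul_add]
    exact integral_add (hk.integrable_mul hg ht z) (hk.integrable_mul hb ht z)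
  rw [this]
  exact (enorm_add_le _ _).trans (add_le_add (le_vertSup _ z ht) (le_vertSup _ z ht))

lemma lintegral_ntMax_sq_le {α : ℝ} {L : ℝ≥0}
    (hL : ∀ f : Rn n → ℝ, MemLp f 2 volume →
      eLpNorm (ntMax α (Sstar k f)) 2 volume ≤ L * eLpNorm f 2 volume)
    {f : Rn n → ℝ} (hf : MemLp f 2 volume) :
    ∫⁻ z, ntMax α (Sstar k f) z ^ 2 ≤ L ^ 2 * ∫⁻ y, ‖f y‖ₑ ^ 2 := by
  have h1 := eLpNorm_nnreal_pow_eq_lintegral (μ := (volume : Measure (Rn n)))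
    (f := ntMax α (Sstar k f)) (p := 2) (by norm_num)
  have h2 := eLpNorm_nnreal_pow_eq_lintegral (μ := (volume : Measure (Rn n)))
    (f := f) (p := 2) (by norm_num)
  have h3 := hL f hf
  simp only [NNReal.coe_ofNat, ENNReal.rpow_ofNat, ENNReal.coe_ofNat, enorm_eq_self] at h1 h2
  rw [← h1, ← h2, ← mul_pow]
  gcongr

/-- Calderón–Zygmund decomposition at height `c`. The good part is handled by Chebyshev's inequality
in `L_2` for `ntMax`; passing from `ntMax` to the vertical supremum adds a maximal function that is
at most a multiple of `c` everywhere, since `g` is. -/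
theorem RegKernel.exists_vertSup_weak_type (hk : RegKernel k δ C) (hn : 1 ≤ n) {α : ℝ}
    (hα : 0 < α) (hL : L2NontangentialEstimate k α) :
    ∃ A K : ℝ≥0, ∀ (f : Rn n → ℝ) (c : ℝ≥0∞), Measurable f → Integrable f → c ≠ 0 → c ≠ ∞ →
      c * volume {z | A * c < vertSup (Sstar k f) z} ≤ K * ∫⁻ y, ‖f y‖ₑ := by
  obtain ⟨L, hL⟩ := hL
  obtain ⟨K₁, hK₁⟩ := hk.exists_vertSup_le hα
  obtain ⟨K₂, hK₂⟩ := hk.exists_vertSup_le_of_cancellation hn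
  set V : ℝ≥0∞ := volume (Metric.ball (0 : Rn n) 1) with hV
  obtain ⟨G, hG⟩ : ∃ G : ℝ≥0, (G : ℝ≥0∞) = 2 ^ n + 2 ^ n * V⁻¹ :=
    ⟨_, ENNReal.coe_toNNReal (by
      have : V⁻¹ ≠ ∞ := ENNReal.inv_ne_top.2 volume_ball_ne_zero
      finiteness)⟩
  -- In the threshold, `K₁ * (3 ^ n * G)` absorbs the maximal function of `g`, and the two units are
  -- for `ntMax` of the good part and the vertical supremum of the bad part.
  refine ⟨K₁ * (3 ^ n * G) + 2, L ^ 2 * G * (1 + 2 ^ n * 9 ^ n) +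
    (K₂ * (2 + 2 ^ n * 9 ^ n) + K₂ * 9 ^ n), fun f c hfm hf hc0 hct => ?_⟩
  have hfi : ∫⁻ x, ‖f x‖ₑ ≠ ∞ := hf.2.ne
  obtain ⟨g, hgm, hg1, hg2, hcanc⟩ := exists_good_part hn hfm hf hc0
  set Ω := {z | c < maxFn (fun y => ‖f y‖ₑ) z} with hΩ
  have hΩm : MeasurableSet Ω := measurableSet_lt_maxFn hn hfi hc0
  have hΩv : c * volume Ω ≤ 9 ^ n * ∫⁻ y, ‖f y‖ₑ := volume_lt_maxFn_le _ c
  have hgG : ∀ᵐ x, ‖g x‖ₑ ≤ G * c := by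
    filter_upwards [ae_le_maxFn (fun y => ‖f y‖ₑ) hfm.enorm.aemeasurable hfi] with x hx
    rw [hG, add_mul]
    by_cases hxΩ : c < maxFn (fun y => ‖f y‖ₑ) x
    · exact (hg2 x hxΩ).trans le_self_add
    · rw [hg1 x hxΩ]
      refine le_trans (hx.trans ?_) le_add_self
      gcongr
      exact not_lt.1 hxΩ
  have hgL1 : ∫⁻ y, ‖g y‖ₑ ≤ (1 + 2 ^ n * 9 ^ n) * ∫⁻ y, ‖f y‖ₑ := by
    rw [← lintegral_add_compl _ hΩm, add_comm, add_mul, one_mul]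
    refine add_le_add ?_ ?_
    · calc ∫⁻ y in Ωᶜ, ‖g y‖ₑ = ∫⁻ y in Ωᶜ, ‖f y‖ₑ :=
            setLIntegral_congr_fun hΩm.compl fun y hy => by simp only [hg1 y hy]
        _ ≤ _ := setLIntegral_le_lintegral _ _
    · calc ∫⁻ y in Ω, ‖g y‖ₑ ≤ ∫⁻ y in Ω, 2 ^ n * c :=
            setLIntegral_mono' hΩm fun y hy => hg2 y hy
        _ = 2 ^ n * (c * volume Ω) := by rw [setLIntegral_const, mul_assoc]
        _ ≤ _ := by rw [mul_assoc]; gcongr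
  have hgint : Integrable g :=
    ⟨hgm.aestronglyMeasurable, hgL1.trans_lt (ENNReal.mul_lt_top (by finiteness) hfi.lt_top)⟩
  have hgL2 : ∫⁻ y, ‖g y‖ₑ ^ 2 ≤ c * (G * (1 + 2 ^ n * 9 ^ n) * ∫⁻ y, ‖f y‖ₑ) := by
    calc ∫⁻ y, ‖g y‖ₑ ^ 2 ≤ ∫⁻ y, G * c * ‖g y‖ₑ := by
          refine lintegral_mono_ae ?_
          filter_upwards [hgG] with y hy
          rw [pow_two]; gcongr
      _ = G * c * ∫⁻ y, ‖g y‖ₑ := lintegral_const_mul' _ _ (by finiteness)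
      _ ≤ G * c * ((1 + 2 ^ n * 9 ^ n) * ∫⁻ y, ‖f y‖ₑ) := by gcongr
      _ = _ := by ring
  have hgmem : MemLp g 2 volume := by
    refine ⟨hgm.aestronglyMeasurable, ?_⟩
    have h2 := eLpNorm_nnreal_pow_eq_lintegral (μ := (volume : Measure (Rn n)))
      (f := g) (p := 2) (by norm_num)
    simp only [NNReal.coe_ofNat, ENNReal.rpow_ofNat, ENNReal.coe_ofNat] at h2
    have h3 : eLpNorm g 2 volume ^ 2 < ∞ := by
      rw [h2]
      exact hgL2.trans_lt (ENNReal.mul_lt_top hct.lt_top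
        (ENNReal.mul_lt_top (by finiteness) hfi.lt_top))
    exact (ENNReal.pow_lt_top_iff (n := 2)).1 h3 |>.resolve_right (by norm_num)
  have hgood : c * volume {z | c ≤ ntMax α (Sstar k g) z} ≤
      L ^ 2 * G * (1 + 2 ^ n * 9 ^ n) * ∫⁻ y, ‖f y‖ₑ := by
    have h1 : c ^ 2 * volume {z | c ^ 2 ≤ ntMax α (Sstar k g) z ^ 2} ≤
        L ^ 2 * ∫⁻ y, ‖g y‖ₑ ^ 2 :=
      (mul_meas_ge_le_lintegral ((measurable_ntMax α _).pow_const 2) (c ^ 2)).trans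
        (lintegral_ntMax_sq_le hL hgmem)
    have h2 : {z | c ≤ ntMax α (Sstar k g) z} ⊆ {z | c ^ 2 ≤ ntMax α (Sstar k g) z ^ 2} :=
      fun z hz => Set.mem_ofPred_eq ▸ pow_le_pow_left' (show c ≤ _ from hz) 2
    have h3 : c * (c * volume {z | c ≤ ntMax α (Sstar k g) z}) ≤
        c * (L ^ 2 * G * (1 + 2 ^ n * 9 ^ n) * ∫⁻ y, ‖f y‖ₑ) := by
      calc _ = c ^ 2 * volume {z | c ≤ ntMax α (Sstar k g) z} := by ring
        _ ≤ c ^ 2 * volume {z | c ^ 2 ≤ ntMax α (Sstar k g) z ^ 2} := by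
            gcongr
        _ ≤ L ^ 2 * (c * (G * (1 + 2 ^ n * 9 ^ n) * ∫⁻ y, ‖f y‖ₑ)) :=
            h1.trans (by gcongr)
        _ = _ := by ring
    exact (ENNReal.mul_le_mul_iff_right hc0 hct).1 h3
  set b : Rn n → ℝ := fun y => f y - g y with hb
  have hbint : Integrable b := hf.sub hgint
  have hbL1 : ∫⁻ y, ‖b y‖ₑ ≤ (2 + 2 ^ n * 9 ^ n) * ∫⁻ y, ‖f y‖ₑ := by
    calc ∫⁻ y, ‖b y‖ₑ ≤ ∫⁻ y, (‖f y‖ₑ + ‖g y‖ₑ) := lintegral_mono fun y => enorm_sub_le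
      _ = (∫⁻ y, ‖f y‖ₑ) + ∫⁻ y, ‖g y‖ₑ := lintegral_add_left hfm.enorm _
      _ ≤ (∫⁻ y, ‖f y‖ₑ) + (1 + 2 ^ n * 9 ^ n) * ∫⁻ y, ‖f y‖ₑ := by gcongr
      _ = _ := by ring
  have hbad := hK₂ b (whit Ω) c (hfm.sub hgm) hbint (pairwiseDisjoint_whit Ω) (by
    intro x hx
    rw [biUnion_whit_maxFn hn hfi hc0] at hx
    simp only [hb, hg1 x hx, sub_self]) hcanc
  rw [biUnion_whit_maxFn hn hfi hc0] at hbad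
  have hbad' : c * volume {z | c < vertSup (Sstar k b) z} ≤
      (K₂ * (2 + 2 ^ n * 9 ^ n) + K₂ * 9 ^ n) * ∫⁻ y, ‖f y‖ₑ := by
    refine hbad.trans ?_
    rw [add_mul, mul_assoc, mul_assoc]
    exact add_le_add (mul_le_mul' le_rfl hbL1) (mul_le_mul' le_rfl hΩv)
  have hfgb : f = fun y => g y + b y := by ext y; simp [hb]
  have hsub : {z | ((K₁ * (3 ^ n * G) + 2 : ℝ≥0) : ℝ≥0∞) * c < vertSup (Sstar k f) z} ⊆
      {z | c ≤ ntMax α (Sstar k g) z} ∪ {z | c < vertSup (Sstar k b) z} := by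
    intro z hz
    by_contra hcon
    simp only [Set.mem_union, Set.mem_ofPred_eq, not_or, not_le, not_lt] at hcon
    rw [Set.mem_ofPred_eq] at hz
    refine absurd hz (not_lt.2 ?_)
    calc vertSup (Sstar k f) z ≤ vertSup (Sstar k g) z + vertSup (Sstar k b) z := by
          rw [hfgb]; exact vertSup_add_le hk hgint hbint z
      _ ≤ (c + K₁ * (3 ^ n * (G * c))) + c := by
          refine add_le_add ((hK₁ g z hgint).trans (add_le_add hcon.1.le ?_)) hcon.2
          gcongr
          exact maxFn_le_of_ae_le hgG z
      _ = _ := by push_cast; ring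
  calc c * volume {z | ((K₁ * (3 ^ n * G) + 2 : ℝ≥0) : ℝ≥0∞) * c < vertSup (Sstar k f) z}
      ≤ c * (volume {z | c ≤ ntMax α (Sstar k g) z} +
          volume {z | c < vertSup (Sstar k b) z}) := by
        gcongr
        exact (measure_mono hsub).trans (measure_union_le _ _)
    _ ≤ _ := by
        rw [mul_add]
        refine (add_le_add hgood hbad').trans (le_of_eq ?_)
        push_cast
        ring

end NTMax
end

noncomputable section
namespace NTMax

variable {n : ℕ} {k : ℝ → Rn n → Rn n → ℝ} {δ C : ℝ}

/-! ### Sparse domination -/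

lemma tri_subset_tri_of_le {k k' : ℤ} (h : k ≤ k') {m m' : Fin n → ℤ} {x : Rn n}
    (hx : x ∈ dy k m) (hx' : x ∈ dy k' m') : (tri k' m' : Set (Rn n)) ⊆ tri k m := by
  obtain ⟨j, rfl⟩ := Int.le.dest h
  intro y hy i
  have hy := hy i
  have hx : idx k x = m := hx
  have hx' : idx (k + j) x = m' := hx'
  subst hx hx'
  rw [idx_div k j x, idx_div k j y]
  have hJ : (0 : ℤ) < 2 ^ j := by positivity
  generalize (2 : ℤ) ^ j = J at *
  generalize idx (k + j) x i = X at *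
  generalize idx (k + j) y i = Y at *
  constructor
  · have h1 : (X - J) / J ≤ Y / J := Int.ediv_le_ediv hJ (by omega)
    rwa [show X - J = X + (-1) * J by ring, Int.add_mul_ediv_right _ _ hJ.ne'] at h1
  · have h1 : Y / J ≤ (X + J) / J := Int.ediv_le_ediv hJ (by omega)
    rwa [show X + J = X + 1 * J by ring, Int.add_mul_ediv_right _ _ hJ.ne'] at h1

lemma measurableSet_of_dyadic_open {E : Set (Rn n)}
    (ho : ∀ x ∈ E, ∃ k, dy k (idx k x) ⊆ E) : MeasurableSet E := by
  have : E = ⋃ Q ∈ {Q : ℤ × (Fin n → ℤ) | dy Q.1 Q.2 ⊆ E}, dy Q.1 Q.2 := by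
    apply Set.Subset.antisymm
    · intro x hx
      obtain ⟨k, hk⟩ := ho x hx
      exact Set.mem_biUnion (x := (k, idx k x)) hk (mem_dy_idx k x)
    · exact Set.iUnion₂_subset fun Q hQ => hQ
  rw [this]
  exact MeasurableSet.biUnion (Set.to_countable _) fun Q _ => measurableSet_dy _ _

/-- The set where `S^* f` or the maximal function of `f` is large. -/
def largeSet (k : ℝ → Rn n → Rn n → ℝ) (β : ℝ) (c : ℝ≥0∞) (f : Rn n → ℝ) : Set (Rn n) :=
  {z | c < coneSup β (Sstar k f) z} ∪ {z | c < maxFn (fun y => ‖f y‖ₑ) z}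

lemma largeSet_dyadic_open (β : ℝ) (c : ℝ≥0∞) (f : Rn n → ℝ) :
    ∀ x ∈ largeSet k β c f, ∃ j, dy j (idx j x) ⊆ largeSet k β c f := by
  rintro x (hx | hx)
  · obtain ⟨j, hj⟩ := exists_dy_subset_of_isOpen (isOpen_lt_coneSup β (Sstar k f) c) hx
    exact ⟨j, hj.trans Set.subset_union_left⟩
  · obtain ⟨j, hj⟩ := maxFn_dyadic_open _ c x hx
    exact ⟨j, hj.trans Set.subset_union_right⟩

/-- The weak type bounds for the cone supremum and the maximal function, at a large multiple of the
average of `|f|` over volume `v`. The maximal function is included because the stopping argument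
needs both quantities small at one point. -/
lemma RegKernel.exists_volume_largeSet_le (hk : RegKernel k δ C) (hn : 1 ≤ n) {α β : ℝ}
    (hα : 0 < α) (hβ : 0 < β) (hL : L2NontangentialEstimate k α) :
    ∃ A : ℝ≥0, ∀ (f : Rn n → ℝ) (v : ℝ≥0∞), Measurable f → Integrable f → v ≠ 0 → v ≠ ∞ →
      2 * volume (largeSet k β (A * (v⁻¹ * ∫⁻ y, ‖f y‖ₑ)) f) ≤ v := by
  obtain ⟨A₀, K, hK⟩ := hk.exists_vertSup_weak_type hn hα hL
  obtain ⟨K₁, hK₁⟩ := hk.exists_coneSup_le hβ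
  -- Twice the sum of the two weak type constants, so that at most half of `v` is exceptional.
  set s : ℝ≥0 := 2 * (K + 9 ^ n) with hs
  have hs0 : s ≠ 0 := by positivity
  refine ⟨(A₀ + K₁ + 1) * s, fun f v hfm hf hv0 hvt => ?_⟩
  have hfi : ∫⁻ y, ‖f y‖ₑ ≠ ∞ := hf.2.ne
  set a : ℝ≥0∞ := v⁻¹ * ∫⁻ y, ‖f y‖ₑ with ha
  have hat : a ≠ ∞ := ENNReal.mul_ne_top (ENNReal.inv_ne_top.2 hv0) hfi
  have hva : v * a = ∫⁻ y, ‖f y‖ₑ := by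
    rw [ha, ← mul_assoc, ENNReal.mul_inv_cancel hv0 hvt, one_mul]
  -- The weak type bound excludes level zero; there `f` vanishes almost everywhere and the
  -- exceptional set is empty.
  rcases eq_or_ne a 0 with ha0 | ha0
  · have hz : ∫⁻ y, ‖f y‖ₑ = 0 := by rw [← hva, ha0, mul_zero]
    have hae : f =ᵐ[volume] 0 := by
      have := (lintegral_eq_zero_iff hfm.enorm).1 hz
      filter_upwards [this] with y hy
      simpa using hy
    have hempty : largeSet k β (((A₀ + K₁ + 1) * s : ℝ≥0) * a) f = ∅ := by
      rw [Set.eq_empty_iff_forall_notMem]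
      rintro z (hz' | hz')
      · refine absurd (show _ < coneSup β (Sstar k f) z from hz') (not_lt.2 ?_)
        refine iSup₂_le fun P hP => ?_
        have : Sstar k f P.1 P.2 = 0 := by
          unfold Sstar
          refine integral_eq_zero_of_ae ?_
          filter_upwards [hae] with y hy
          simp [hy]
        simp [this]
      · refine absurd (show _ < maxFn (fun y => ‖f y‖ₑ) z from hz') (not_lt.2 ?_)
        refine (maxFn_le_of_ae_le (c := 0) ?_ z).trans (by simp)
        filter_upwards [hae] with y hy
        simp [hy]
    rw [hempty]
    simp
  · set c : ℝ≥0∞ := s * a with hc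
    have hc0 : c ≠ 0 := mul_ne_zero (by exact_mod_cast hs0) ha0
    have hct : c ≠ ∞ := ENNReal.mul_ne_top ENNReal.coe_ne_top hat
    have h1 := hK f c hfm hf hc0 hct
    have h2 := volume_lt_maxFn_le (fun y => ‖f y‖ₑ) c
    have hsub : largeSet k β (((A₀ + K₁ + 1) * s : ℝ≥0) * a) f ⊆
        {z | A₀ * c < vertSup (Sstar k f) z} ∪ {z | c < maxFn (fun y => ‖f y‖ₑ) z} := by
      have e : (((A₀ + K₁ + 1) * s : ℝ≥0) : ℝ≥0∞) * a = A₀ * c + K₁ * c + c := by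
        rw [hc]; push_cast; ring
      rw [e]
      intro z hz
      by_contra hcon
      simp only [Set.mem_union, Set.mem_ofPred_eq, not_or, not_lt] at hcon
      rcases hz with hz | hz
      · refine absurd (show _ < coneSup β (Sstar k f) z from hz) (not_lt.2 ?_)
        refine (hK₁ f z hf).trans (le_trans (add_le_add hcon.1 ?_) le_self_add)
        gcongr
        exact hcon.2
      · refine absurd (show _ < maxFn (fun y => ‖f y‖ₑ) z from hz) (not_lt.2 ?_)
        exact hcon.2.trans le_add_self
    have h3 : c * volume (largeSet k β (((A₀ + K₁ + 1) * s : ℝ≥0) * a) f) ≤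
        (K + 9 ^ n) * (v * a) := by
      rw [hva, add_mul (K : ℝ≥0∞)]
      refine le_trans ?_ (add_le_add h1 h2)
      rw [← mul_add]
      gcongr
      exact (measure_mono hsub).trans (measure_union_le _ _)
    have h4 : ((K + 9 ^ n : ℝ≥0∞) * a) *
        (2 * volume (largeSet k β (((A₀ + K₁ + 1) * s : ℝ≥0) * a) f)) ≤
        ((K + 9 ^ n : ℝ≥0∞) * a) * v := by
      refine le_trans (le_of_eq ?_) (h3.trans (le_of_eq ?_))
      · rw [hc, hs]; push_cast; ring
      · ring
    exact (ENNReal.mul_le_mul_iff_right (mul_ne_zero (by simp) ha0)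
      (ENNReal.mul_ne_top (by finiteness) hat)).1 h4

lemma enorm_indicator_le' (s : Set (Rn n)) (f : Rn n → ℝ) (y : Rn n) :
    ‖s.indicator f y‖ₑ ≤ ‖f y‖ₑ := enorm_indicator_le_enorm_self f y

lemma Sstar_indicator_add (hk : RegKernel k δ C) {f : Rn n → ℝ} (hf : Integrable f)
    {s : Set (Rn n)} (hs : MeasurableSet s) {t : ℝ} (ht : 0 < t) (x : Rn n) :
    Sstar k f t x = Sstar k (s.indicator f) t x + Sstar k (sᶜ.indicator f) t x := by
  unfold Sstar
  rw [← integral_add (hk.integrable_mul (hf.indicator hs) ht x)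
    (hk.integrable_mul (hf.indicator hs.compl) ht x)]
  congr 1
  ext y
  rw [← mul_add, ← Pi.add_apply, Set.indicator_self_add_compl]

/-- Localisation. The part of `f` outside the tripled cube is at distance at least `l` from `z`, so
its value at `(t, x)` can be compared, at scale `t + l`, with its value at `(t + l, z')`. That value
is the one for `f` minus that of the near part, and the near part at height `t + l` is bounded
through the kernel size by the maximal function at `z'`. -/
lemma RegKernel.exists_coneSup_le_add (hk : RegKernel k δ C) {β : ℝ} (hβ : 0 < β) :
    ∃ K : ℝ≥0, ∀ (f : Rn n → ℝ) (j : ℤ) (m : Fin n → ℤ) (z z' : Rn n), Integrable f →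
      z ∈ dy j m → z' ∈ dy (j - 1) (fun i => m i / 2) →
      coneSup β (Sstar k f) z ≤ coneSup β (Sstar k ((tri j m).indicator f)) z +
        (coneSup β (Sstar k f) z' + K * maxFn (fun y => ‖f y‖ₑ) z') := by
  have hs0 : 0 ≤ Real.sqrt n := Real.sqrt_nonneg _
  obtain ⟨K, hK⟩ := hk.exists_enorm_Sstar_le_add (A := 1 + 2 * Real.sqrt n + β)
    (c := (1 + (2 + 2 * Real.sqrt n) * (1 + β))⁻¹) (by positivity) (by positivity)
  refine ⟨K + C.toNNReal * 2 ^ n, fun f j m z z' hf hz hz' => iSup₂_le fun P hP => ?_⟩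
  obtain ⟨ht, hx⟩ := hP
  set t := P.1
  set x := P.2
  have hT : MeasurableSet (tri j m : Set (Rn n)) := measurableSet_tri _ _
  set l := len j with hl
  have hl0 : 0 < l := len_pos j
  set g := (tri j m : Set (Rn n))ᶜ.indicator f with hg
  have hgi : Integrable g := hf.indicator hT.compl
  have hzz : ‖z' - z‖ ≤ 2 * Real.sqrt n * l := by
    have := norm_sub_le_of_mem_dy hz' (dy_subset_parent j m hz)
    rw [len_sub_one] at this
    linarith
  have htl : 0 < t + l := by linarith
  have h1 : ‖Sstar k g t x‖ₑ ≤ ‖Sstar k g (t + l) z'‖ₑ + K * maxFn (fun y => ‖g y‖ₑ) z' := by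
    refine hK g t (t + l) (t + l) x z' z' hgi ht htl (by linarith) le_rfl ?_ ?_
    · refine (enorm2_le _ _).trans ?_
      rw [add_sub_cancel_left, abs_of_pos hl0]
      have h2 : ‖z' - x‖ ≤ ‖z' - z‖ + ‖z - x‖ := norm_sub_le_norm_sub_add_norm_sub _ _ _
      rw [norm_sub_rev z x] at h2
      have h3 : 0 ≤ β * l := by positivity
      have h4 : 0 ≤ Real.sqrt n * t := by positivity
      nlinarith
    · intro y hy
      have hyT : y ∉ tri j m := by
        intro hyT
        exact hy (by rw [hg, Set.indicator_of_notMem (by simpa using hyT)])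
      rw [inv_mul_le_iff₀ (by positivity)]
      have h2 := len_le_norm_sub_of_notMem_tri hz hyT
      rw [norm_sub_rev, ← hl] at h2
      have h3 : ‖z' - y‖ ≤ ‖z' - z‖ + ‖z - y‖ := norm_sub_le_norm_sub_add_norm_sub _ _ _
      have h4 : ‖z - y‖ ≤ ‖z - x‖ + ‖x - y‖ := norm_sub_le_norm_sub_add_norm_sub _ _ _
      rw [norm_sub_rev z x] at h4
      have h5 := norm_le_enorm2 t (x - y)
      have h6 := (le_abs_self t).trans (abs_le_enorm2 t (x - y))
      have h7 : β * t ≤ β * enorm2 t (x - y) := by gcongr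
      have h8 : ‖z - y‖ ≤ (1 + β) * enorm2 t (x - y) := by linarith
      have h9 : Real.sqrt n * l ≤ Real.sqrt n * ‖z - y‖ := by gcongr
      have h10 : (2 + 2 * Real.sqrt n) * ‖z - y‖ ≤
          (2 + 2 * Real.sqrt n) * ((1 + β) * enorm2 t (x - y)) := by gcongr
      linarith
  have h2 : ‖Sstar k ((tri j m).indicator f) (t + l) z'‖ₑ ≤
      (C.toNNReal * 2 ^ n : ℝ≥0) * maxFn (fun y => ‖f y‖ₑ) z' := by
    refine (hk.enorm_Sstar_le htl z').trans ?_
    have h3 : ∫⁻ y, ‖(tri j m).indicator f y‖ₑ ≤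
        2 ^ n * dvol n j * maxFn (fun y => ‖f y‖ₑ) z' := by
      calc ∫⁻ y, ‖(tri j m).indicator f y‖ₑ = ∫⁻ y in tri j m, ‖f y‖ₑ := by
            rw [← lintegral_indicator hT]
            congr with y
            rw [enorm_indicator_eq_indicator_enorm]
        _ ≤ ∫⁻ y in tri (j - 1) (fun i => m i / 2), ‖f y‖ₑ :=
            lintegral_mono_set (tri_subset_tri_of_le (by omega) (dy_subset_parent j m hz) hz)
        _ ≤ _ := by
            rw [← dvol_sub_one]
            exact lintegral_tri_le _ hz'
    have h4 : ENNReal.ofReal (C * ((t + l) ^ n)⁻¹) * dvol n j ≤ C.toNNReal := by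
      rw [dvol, ← ENNReal.ofReal_pow (len_pos j).le, ← ENNReal.ofReal_mul (by
        have := hk.nonneg; positivity)]
      refine ENNReal.ofReal_le_ofReal ?_
      rw [mul_assoc]
      refine mul_le_of_le_one_right hk.nonneg ?_
      rw [inv_mul_le_iff₀ (by positivity), mul_one]
      gcongr
      linarith
    calc _ ≤ ENNReal.ofReal (C * ((t + l) ^ n)⁻¹) *
          (2 ^ n * dvol n j * maxFn (fun y => ‖f y‖ₑ) z') := by gcongr
      _ = (ENNReal.ofReal (C * ((t + l) ^ n)⁻¹) * dvol n j) *
          (2 ^ n * maxFn (fun y => ‖f y‖ₑ) z') := by ring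
      _ ≤ C.toNNReal * (2 ^ n * maxFn (fun y => ‖f y‖ₑ) z') := by gcongr
      _ = _ := by push_cast; ring
  have h5 : ‖Sstar k g (t + l) z'‖ₑ ≤ coneSup β (Sstar k f) z' +
      (C.toNNReal * 2 ^ n : ℝ≥0) * maxFn (fun y => ‖f y‖ₑ) z' := by
    have e : Sstar k g (t + l) z' =
        Sstar k f (t + l) z' - Sstar k ((tri j m).indicator f) (t + l) z' := by
      rw [Sstar_indicator_add hk hf hT htl z']; ring
    rw [e]
    refine enorm_sub_le.trans (add_le_add (le_coneSup _ htl ?_) h2)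
    rw [sub_self, norm_zero]; positivity
  rw [Sstar_indicator_add hk hf hT ht x]
  refine (enorm_add_le _ _).trans (add_le_add (le_coneSup _ ht hx) ?_)
  refine h1.trans ?_
  calc ‖Sstar k g (t + l) z'‖ₑ + K * maxFn (fun y => ‖g y‖ₑ) z'
      ≤ (coneSup β (Sstar k f) z' +
      (C.toNNReal * 2 ^ n : ℝ≥0) * maxFn (fun y => ‖f y‖ₑ) z') +
        K * maxFn (fun y => ‖f y‖ₑ) z' := by
        gcongr
        exact maxFn_mono (fun y => enorm_indicator_le' _ f y) z'
    _ = _ := by push_cast; ring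

/-- The normalized integral of `|f|` over the tripled cube. -/
def triAvg (f : Rn n → ℝ) (Q : ℤ × (Fin n → ℤ)) : ℝ≥0∞ :=
  (dvol n Q.1)⁻¹ * ∫⁻ y in tri Q.1 Q.2, ‖f y‖ₑ

/-- The part of `f` in the tripled cube. -/
def triPart (f : Rn n → ℝ) (Q : ℤ × (Fin n → ℤ)) : Rn n → ℝ :=
  (tri Q.1 Q.2 : Set (Rn n)).indicator f

/-- The exceptional set of a cube. -/
def excSet (k : ℝ → Rn n → Rn n → ℝ) (β : ℝ) (A : ℝ≥0) (f : Rn n → ℝ)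
    (Q : ℤ × (Fin n → ℤ)) : Set (Rn n) :=
  largeSet k β (A * triAvg f Q) (triPart f Q)

/-- The generations of stopping cubes below `Q₀`. -/
def sparseGen (k : ℝ → Rn n → Rn n → ℝ) (β : ℝ) (A : ℝ≥0) (f : Rn n → ℝ)
    (Q₀ : ℤ × (Fin n → ℤ)) : ℕ → Set (ℤ × (Fin n → ℤ))
  | 0 => {Q₀}
  | i + 1 => {P | ∃ Q ∈ sparseGen k β A f Q₀ i,
      P ∈ whit (excSet k β A f Q) ∧ (dy P.1 P.2 : Set (Rn n)) ⊆ dy Q.1 Q.2}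

lemma sparseGen_eq_of_mem {β : ℝ} {A : ℝ≥0} {f : Rn n → ℝ} {Q₀ : ℤ × (Fin n → ℤ)} {i : ℕ} :
    ∀ {Q Q' : ℤ × (Fin n → ℤ)}, Q ∈ sparseGen k β A f Q₀ i → Q' ∈ sparseGen k β A f Q₀ i →
      ∀ {x : Rn n}, x ∈ dy Q.1 Q.2 → x ∈ dy Q'.1 Q'.2 → Q = Q' := by
  induction i with
  | zero =>
    intro Q Q' hQ hQ' x _ _
    exact (show Q = Q₀ from hQ).trans (show Q' = Q₀ from hQ').symm
  | succ i ih =>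
    rintro Q Q' ⟨R, hR, hQR, hs⟩ ⟨R', hR', hQR', hs'⟩ x hx hx'
    obtain rfl := ih hR hR' (hs hx) (hs' hx')
    exact whit_eq_of_mem hQR hQR' hx hx'

/-- Each cube keeps the set `F Q` of its points outside the exceptional set, at least half its
measure. A point in `F Q` is controlled by the average of `Q`, and each step from an ancestor to a
stopping child costs the average of the ancestor. The points that survive all generations form a
null set, since each generation at least halves the measure. -/
theorem RegKernel.exists_sparse (hk : RegKernel k δ C) (hn : 1 ≤ n) {α β : ℝ}
    (hα : 0 < α) (hβ : 0 < β) (hL : L2NontangentialEstimate k α) :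
    ∃ K : ℝ≥0, ∀ (f : Rn n → ℝ) (Q₀ : ℤ × (Fin n → ℤ)), Measurable f → Integrable f →
      ∃ (G : ℕ → Set (ℤ × (Fin n → ℤ))) (F : ℤ × (Fin n → ℤ) → Set (Rn n)),
        (∀ Q, MeasurableSet (F Q)) ∧ (∀ Q, F Q ⊆ dy Q.1 Q.2) ∧
        (∀ Q, dvol n Q.1 ≤ 2 * volume (F Q)) ∧
        (Pairwise (Function.onFun Disjoint fun i : Σ j, G j => F i.2)) ∧
        ∀ᵐ z, z ∈ dy Q₀.1 Q₀.2 → coneSup β (Sstar k (triPart f Q₀)) z ≤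
          K * ∑' i : Σ j, G j, (dy i.2.1.1 i.2.1.2).indicator (fun _ => triAvg f i.2) z := by
  obtain ⟨A, hA⟩ := hk.exists_volume_largeSet_le hn hα hβ hL
  obtain ⟨K, hK⟩ := hk.exists_coneSup_le_add hβ
  refine ⟨A + K * A, fun f Q₀ hfm hf => ?_⟩
  set E := excSet k β A f with hE
  set G := sparseGen k β A f Q₀ with hG
  have hTi : ∀ Q, Integrable (triPart f Q) := fun Q => hf.indicator (measurableSet_tri _ _)
  have hTm : ∀ Q, Measurable (triPart f Q) := fun Q => hfm.indicator (measurableSet_tri _ _)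
  have hEv : ∀ Q, 2 * volume (E Q) ≤ dvol n Q.1 := by
    intro Q
    have := hA (triPart f Q) (dvol n Q.1) (hTm Q) (hTi Q) (dvol_ne_zero _) (dvol_ne_top _)
    have e : ∫⁻ y, ‖triPart f Q y‖ₑ = ∫⁻ y in tri Q.1 Q.2, ‖f y‖ₑ := by
      rw [← lintegral_indicator (measurableSet_tri _ _)]
      congr with y
      rw [triPart, enorm_indicator_eq_indicator_enorm]
    rwa [e] at this
  have hEo : ∀ Q, ∀ x ∈ E Q, ∃ j, dy j (idx j x) ⊆ E Q := fun Q =>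
    largeSet_dyadic_open β _ _
  have hEm : ∀ Q, MeasurableSet (E Q) := fun Q => measurableSet_of_dyadic_open (hEo Q)
  have hEt : ∀ Q, volume (E Q) ≠ ∞ := by
    intro Q h
    have := hEv Q
    rw [h] at this
    simp [dvol_ne_top] at this
  -- the stopping children cover the exceptional set
  have hcover : ∀ Q, ∀ x ∈ dy Q.1 Q.2, x ∈ E Q →
      ∃ P ∈ whit (E Q), x ∈ dy P.1 P.2 ∧ (dy P.1 P.2 : Set (Rn n)) ⊆ dy Q.1 Q.2 := by
    intro Q x hxQ hxE
    obtain ⟨P, hP, hxP⟩ := exists_mem_whit hn (hEt Q) (hEo Q x hxE)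
    refine ⟨P, hP, hxP, ?_⟩
    rcases le_total Q.1 P.1 with h | h
    · exact dy_subset_of_le h hxQ hxP
    -- A maximal cube at least as large as `Q` would force `E Q` to contain `Q`, against `2 |E Q| ≤
    -- |Q|`.
    · exfalso
      have h1 := dy_subset_of_le h hxP hxQ
      have h2 : dvol n Q.1 ≤ volume (E Q) := by
        rw [← volume_dy Q.1 Q.2]; exact measure_mono (h1.trans hP.1)
      have h3 : 2 * dvol n Q.1 ≤ 1 * dvol n Q.1 := by
        rw [one_mul]; exact (mul_le_mul' le_rfl h2).trans (hEv Q)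
      rw [ENNReal.mul_le_mul_iff_left (dvol_ne_zero _) (dvol_ne_top _)] at h3
      norm_num at h3
  let U : ℕ → Set (Rn n) := fun i => ⋃ Q ∈ G i, dy Q.1 Q.2
  have hUanti : Antitone U := by
    refine antitone_nat_of_succ_le fun i => ?_
    refine Set.iUnion₂_subset fun P hP => ?_
    obtain ⟨Q, hQ, -, hPQ⟩ := hP
    exact hPQ.trans (Set.subset_biUnion_of_mem (u := fun Q : ℤ × (Fin n → ℤ) => dy Q.1 Q.2) hQ)
  have hnot : ∀ i, ∀ Q ∈ G i, ∀ x ∈ dy Q.1 Q.2, x ∉ E Q → x ∉ U (i + 1) := by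
    intro i Q hQ x hx hxE hxU
    obtain ⟨P, ⟨R, hR, hPR, hs⟩, hxP⟩ := Set.mem_iUnion₂.1 hxU
    obtain rfl : R = Q := sparseGen_eq_of_mem hR hQ (hs hxP) hx
    exact hxE (hPR.1 hxP)
  have hpd : ∀ i, (G i).PairwiseDisjoint fun Q => (dy Q.1 Q.2 : Set (Rn n)) := by
    intro i Q hQ Q' hQ' hne
    rw [Function.onFun, Set.disjoint_left]
    intro x hx hx'
    exact hne (sparseGen_eq_of_mem hQ hQ' hx hx')
  have hUv : ∀ i, 2 * volume (U (i + 1)) ≤ volume (U i) := by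
    intro i
    have hsub : U (i + 1) ⊆ ⋃ Q ∈ G i, E Q := by
      refine Set.iUnion₂_subset fun P hP => ?_
      obtain ⟨Q, hQ, hPQ, -⟩ := hP
      exact hPQ.1.trans (Set.subset_biUnion_of_mem (u := E) hQ)
    calc 2 * volume (U (i + 1)) ≤ 2 * ∑' Q : G i, volume (E Q) := by
          gcongr
          exact (measure_mono hsub).trans (measure_biUnion_le _ (Set.to_countable _) _)
      _ ≤ ∑' Q : G i, dvol n Q.1.1 := by
          rw [← ENNReal.tsum_mul_left]
          exact ENNReal.tsum_le_tsum fun Q => hEv Q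
      _ = volume (U i) := by
          simp only [U]
          rw [measure_biUnion (Set.to_countable _) (hpd i) fun Q _ => measurableSet_dy _ _]
          simp_rw [volume_dy]
  have hUnull : volume (⋂ i, U i) = 0 := by
    have h1 : ∀ i, volume (⋂ i, U i) ≤ (2⁻¹ : ℝ≥0∞) ^ i * dvol n Q₀.1 := by
      intro i
      refine (measure_mono (Set.iInter_subset _ i)).trans ?_
      induction i with
      | zero =>
        simp only [U, hG, sparseGen, Set.mem_singleton_iff, Set.iUnion_iUnion_eq_left, volume_dy]
        simp
      | succ i ih =>
        have h2 : volume (U (i + 1)) ≤ 2⁻¹ * volume (U i) := by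
          rw [mul_comm, ← div_eq_mul_inv, ENNReal.le_div_iff_mul_le (by simp) (by simp), mul_comm]
          exact hUv i
        refine h2.trans ?_
        rw [pow_succ', mul_assoc]
        gcongr
    have h2 : Filter.Tendsto (fun i : ℕ => (2⁻¹ : ℝ≥0∞) ^ i * dvol n Q₀.1) Filter.atTop
        (nhds 0) := by
      have := ENNReal.Tendsto.mul_const (b := dvol n Q₀.1)
        (ENNReal.tendsto_pow_atTop_nhds_zero_of_lt_one (r := 2⁻¹) (by norm_num))
        (Or.inr (dvol_ne_top _))
      simpa using this
    exact le_antisymm (ge_of_tendsto' h2 h1) zero_le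
  -- one step of the domination
  have hstep : ∀ Q, ∀ P ∈ whit (E Q), (dy P.1 P.2 : Set (Rn n)) ⊆ dy Q.1 Q.2 →
      ∀ z ∈ dy P.1 P.2, coneSup β (Sstar k (triPart f Q)) z ≤
        coneSup β (Sstar k (triPart f P)) z + (A + K * A : ℝ≥0) * triAvg f Q := by
    intro Q P hP hPQ z hz
    -- The parent of a maximal cube leaves `E Q`; at such a point both the cone supremum and the
    -- maximal function are at most `A * triAvg f Q`.
    obtain ⟨z', hz', hz'E⟩ := Set.not_subset.1 hP.2
    have h1 := hK (triPart f Q) P.1 P.2 z z' (hTi Q) hz hz'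
    have hsub : (tri P.1 P.2 : Set (Rn n)) ⊆ tri Q.1 Q.2 := by
      rcases le_total Q.1 P.1 with h | h
      · exact tri_subset_tri_of_le h (hPQ hz) hz
      · have hvol : dvol n P.1 ≤ dvol n Q.1 := by
          rw [← volume_dy P.1 P.2, ← volume_dy Q.1 Q.2]; exact measure_mono hPQ
        -- The order of generations is recovered from volumes, since inclusion is only known between
        -- the sets.
        have hle : Q.1 ≤ P.1 := by
          by_contra hlt
          rw [not_le] at hlt
          have h4 : len Q.1 < len P.1 := zpow_lt_zpow_right₀ (by norm_num) (by omega)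
          have h5 : dvol n Q.1 < dvol n P.1 := by
            unfold dvol
            exact ENNReal.pow_lt_pow_left (by omega)
              ((ENNReal.ofReal_lt_ofReal_iff (len_pos _)).2 h4)
          exact absurd hvol (not_le.2 h5)
        exact tri_subset_tri_of_le hle (hPQ hz) hz
    have e : (tri P.1 P.2 : Set (Rn n)).indicator (triPart f Q) = triPart f P := by
      rw [triPart, Set.indicator_indicator, Set.inter_eq_left.2 hsub, triPart]
    rw [e] at h1
    refine h1.trans (add_le_add le_rfl ?_)
    have hz'1 : coneSup β (Sstar k (triPart f Q)) z' ≤ A * triAvg f Q := by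
      by_contra hcon
      exact hz'E (Or.inl (not_le.1 hcon))
    have hz'2 : maxFn (fun y => ‖triPart f Q y‖ₑ) z' ≤ A * triAvg f Q := by
      by_contra hcon
      exact hz'E (Or.inr (not_le.1 hcon))
    calc _ ≤ A * triAvg f Q + K * (A * triAvg f Q) := by gcongr
      _ = _ := by push_cast; ring
  set τ : ℕ → Rn n → ℝ≥0∞ := fun j z =>
    ∑' Q : G j, (dy Q.1.1 Q.1.2).indicator (fun _ => triAvg f Q) z with hτ
  have hτle : ∀ j, ∀ Q ∈ G j, ∀ z ∈ dy Q.1 Q.2, triAvg f Q ≤ τ j z := by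
    intro j Q hQ z hz
    refine le_trans ?_ (ENNReal.le_tsum (⟨Q, hQ⟩ : G j))
    rw [Set.indicator_of_mem hz]
  have hind : ∀ i, ∀ Q ∈ G i, ∀ z ∈ dy Q.1 Q.2, coneSup β (Sstar k (triPart f Q₀)) z ≤
      coneSup β (Sstar k (triPart f Q)) z +
        (A + K * A : ℝ≥0) * ∑ j ∈ Finset.range i, τ j z := by
    intro i
    induction i with
    | zero =>
      intro Q hQ z hz
      obtain rfl : Q = Q₀ := hQ
      exact le_self_add
    | succ i ih =>
      rintro P ⟨Q, hQ, hP, hPQ⟩ z hz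
      refine (ih Q hQ z (hPQ hz)).trans ?_
      rw [Finset.sum_range_succ, mul_add, add_comm ((A + K * A : ℝ≥0) * _ : ℝ≥0∞), ← add_assoc]
      refine add_le_add ((hstep Q P hP hPQ z hz).trans (add_le_add le_rfl ?_)) le_rfl
      gcongr
      exact hτle i Q hQ z (hPQ hz)
  refine ⟨G, fun Q => dy Q.1 Q.2 \ E Q, fun Q => (measurableSet_dy _ _).diff (hEm Q),
    fun Q => Set.sdiff_subset, fun Q => ?_, ?_, ?_⟩
  · have h1 : dvol n Q.1 ≤ volume (dy Q.1 Q.2 \ E Q) + volume (E Q) := by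
      rw [← volume_dy Q.1 Q.2]
      refine (measure_mono ?_).trans (measure_union_le _ _)
      rw [Set.sdiff_union_self]
      exact Set.subset_union_left
    have h2 : dvol n Q.1 + dvol n Q.1 ≤ 2 * volume (dy Q.1 Q.2 \ E Q) + dvol n Q.1 := by
      calc dvol n Q.1 + dvol n Q.1 = 2 * dvol n Q.1 := (two_mul _).symm
        _ ≤ 2 * (volume (dy Q.1 Q.2 \ E Q) + volume (E Q)) := by gcongr
        _ = 2 * volume (dy Q.1 Q.2 \ E Q) + 2 * volume (E Q) := by ring
        _ ≤ _ := by gcongr; exact hEv Q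
    exact (ENNReal.add_le_add_iff_right (dvol_ne_top _)).1 h2
  · rintro ⟨i, Q, hQ⟩ ⟨i', Q', hQ'⟩ hne
    rw [Function.onFun, Set.disjoint_left]
    rintro x ⟨hx, hxE⟩ ⟨hx', hxE'⟩
    have hU : ∀ {i i' : ℕ} {Q Q' : ℤ × (Fin n → ℤ)}, Q ∈ G i → Q' ∈ G i' → x ∈ dy Q.1 Q.2 →
        x ∉ E Q → x ∈ dy Q'.1 Q'.2 → i' ≤ i := by
      intro i i' Q Q' hQ hQ' hx hxE hx'
      by_contra hlt
      exact hnot i Q hQ x hx hxE (hUanti (show i + 1 ≤ i' by omega)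
        (Set.mem_biUnion hQ' hx'))
    obtain rfl : i = i' := le_antisymm (hU hQ' hQ hx' hxE' hx) (hU hQ hQ' hx hxE hx')
    obtain rfl : Q = Q' := sparseGen_eq_of_mem hQ hQ' hx hx'
    exact hne rfl
  · filter_upwards [measure_eq_zero_iff_ae_notMem.1 hUnull] with z hzU hz
    have hz0 : z ∈ U 0 := Set.mem_biUnion (x := Q₀) rfl hz
    -- The last generation whose union contains `z`; its cube at `z` is not exceptional at `z`.
    obtain ⟨i, hi, hi'⟩ : ∃ i, z ∈ U i ∧ z ∉ U (i + 1) := by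
      by_contra hcon
      push Not at hcon
      exact hzU (Set.mem_iInter.2 fun i => Nat.rec hz0 (fun i hi => hcon i hi) i)
    obtain ⟨Q, hQ, hzQ⟩ := Set.mem_iUnion₂.1 hi
    have hzE : z ∉ E Q := by
      intro hzE
      obtain ⟨P, hP, hzP, hPQ⟩ := hcover Q z hzQ hzE
      exact hi' (Set.mem_biUnion (x := P) ⟨Q, hQ, hP, hPQ⟩ hzP)
    have h1 : coneSup β (Sstar k (triPart f Q)) z ≤ A * triAvg f Q := by
      by_contra hcon
      exact hzE (Or.inl (not_le.1 hcon))
    rw [ENNReal.tsum_sigma']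
    calc coneSup β (Sstar k (triPart f Q₀)) z
        ≤ A * triAvg f Q + (A + K * A : ℝ≥0) * ∑ j ∈ Finset.range i, τ j z :=
          (hind i Q hQ z hzQ).trans (add_le_add h1 le_rfl)
      _ ≤ (A + K * A : ℝ≥0) * τ i z + (A + K * A : ℝ≥0) * ∑ j ∈ Finset.range i, τ j z := by
          gcongr
          · exact_mod_cast le_self_add
          · exact hτle i Q hQ z hzQ
      _ = (A + K * A : ℝ≥0) * ∑ j ∈ Finset.range (i + 1), τ j z := by
          rw [Finset.sum_range_succ, mul_add, add_comm]
      _ ≤ _ := by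
          gcongr
          exact ENNReal.sum_le_tsum _

end NTMax
end

noncomputable section
namespace NTMax

/-! ### Weighted estimates for sparse families -/

/-- Layer cake formula for a single value, from the Dirac measure; the value `∞` is reached from
finite ones by monotonicity. Keeping `t` real allows Tonelli's theorem later. -/
lemma rpow_eq_lintegral (a : ℝ≥0∞) {s : ℝ} (hs : 0 < s) :
    a ^ s = ∫⁻ t in Set.Ioi (0 : ℝ), ENNReal.ofReal (s * t ^ (s - 1)) *
      Set.indicator {t : ℝ | ENNReal.ofReal t < a} 1 t := by
  have hfin : ∀ a : ℝ, 0 ≤ a → ENNReal.ofReal (a ^ s) =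
      ∫⁻ t in Set.Ioi (0 : ℝ), ENNReal.ofReal (s * t ^ (s - 1)) *
        Set.indicator {t : ℝ | ENNReal.ofReal t < ENNReal.ofReal a} 1 t := by
    intro a ha
    have h := lintegral_rpow_eq_lintegral_meas_lt_mul (Measure.dirac ()) (f := fun _ => a)
      (Filter.Eventually.of_forall fun _ => ha) aemeasurable_const hs
    rw [lintegral_dirac] at h
    rw [h, ← lintegral_const_mul' _ _ ENNReal.ofReal_ne_top]
    refine setLIntegral_congr_fun measurableSet_Ioi fun t ht => ?_
    have ht : 0 < t := ht
    rw [ENNReal.ofReal_mul hs.le, mul_assoc]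
    congr 1
    rw [mul_comm]
    congr 1
    by_cases hta : t < a
    · have : ENNReal.ofReal t < ENNReal.ofReal a :=
        (ENNReal.ofReal_lt_ofReal_iff (ht.trans hta)).2 hta
      simp [Set.indicator, hta, this]
    · have : ¬ ENNReal.ofReal t < ENNReal.ofReal a :=
        not_lt.2 (ENNReal.ofReal_le_ofReal (not_lt.1 hta))
      simp [Set.indicator, hta, this]
  rcases eq_or_ne a ∞ with rfl | ha
  · rw [ENNReal.top_rpow_of_pos hs]
    symm
    refine ENNReal.eq_top_of_forall_nnreal_le fun r => ?_
    have h1 := hfin ((r : ℝ) ^ (s⁻¹)) (by positivity)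
    rw [← Real.rpow_mul (NNReal.coe_nonneg r), inv_mul_cancel₀ hs.ne', Real.rpow_one,
      ENNReal.ofReal_coe_nnreal] at h1
    rw [h1]
    refine lintegral_mono fun t => ?_
    gcongr
    exact le_top
  · have h1 := hfin a.toReal ENNReal.toReal_nonneg
    rwa [ENNReal.ofReal_toReal ha, ENNReal.toReal_rpow,
      ENNReal.ofReal_toReal (ENNReal.rpow_ne_top_of_nonneg hs.le ha)] at h1

section Abstract

variable {X ι : Type*} [MeasurableSpace X]

/-- Values of `f` not exceeding `c` contribute at most `c` to an average, so an average above `2 c`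
leaves at least `c` for the part of `f` above `c`. Nestedness then sums this without overlap, for
any measure, doubling or not. -/
lemma measure_biUnion_avg_lt_le (σ : Measure X) {T : ι → Set X}
    (hT : ∀ i, MeasurableSet (T i))
    (hn : ∀ i j, (T i ∩ T j).Nonempty → T i ⊆ T j ∨ T j ⊆ T i)
    (h0 : ∀ i, σ (T i) ≠ 0) (ht : ∀ i, σ (T i) ≠ ∞) {f : X → ℝ≥0∞} (hf : Measurable f)
    (s : Finset ι) (c : ℝ≥0∞) (hct : c ≠ ∞)
    (hs : ∀ i ∈ s, 2 * c < (σ (T i))⁻¹ * ∫⁻ x in T i, f x ∂σ) :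
    c * σ (⋃ i ∈ s, T i) ≤ ∫⁻ x in {x | c < f x}, f x ∂σ := by
  have hm : MeasurableSet {x | c < f x} := measurableSet_lt measurable_const hf
  have key : ∀ i : s, c * σ (T i) ≤ ∫⁻ x in T i, {x | c < f x}.indicator f x ∂σ := by
    intro i
    have h1 : 2 * c * σ (T i) ≤ ∫⁻ x in T i, f x ∂σ := by
      have := mul_le_mul_left (hs i i.2).le (σ (T i))
      rwa [mul_right_comm (σ (T i))⁻¹, ENNReal.inv_mul_cancel (h0 i) (ht i), one_mul] at this
    have h2 : ∫⁻ x in T i, f x ∂σ ≤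
        (∫⁻ x in T i, {x | c < f x}.indicator f x ∂σ) + c * σ (T i) := by
      rw [← setLIntegral_const, ← lintegral_add_left (hf.indicator hm)]
      refine lintegral_mono fun x => ?_
      by_cases hx : c < f x
      · rw [Set.indicator_of_mem (by exact hx)]; exact le_self_add
      · exact (not_lt.1 hx).trans le_add_self
    have h3 : c * σ (T i) + c * σ (T i) ≤
        (∫⁻ x in T i, {x | c < f x}.indicator f x ∂σ) + c * σ (T i) := by
      refine le_trans (le_of_eq ?_) (h1.trans h2)
      ring
    exact (ENNReal.add_le_add_iff_right (ENNReal.mul_ne_top hct (ht i))).1 h3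
  have h4 := measure_iUnion_le_of_nested (c • σ) (σ.withDensity ({x | c < f x}.indicator f))
    (fun i : s => T i) (fun i => hT i) (fun i j => hn i j) (fun i => by
      rw [Measure.smul_apply, smul_eq_mul, withDensity_apply _ (hT i)]
      exact key i)
  rw [Measure.smul_apply, smul_eq_mul] at h4
  have e : (⋃ i : s, T i) = ⋃ i ∈ s, T i := by
    ext x; simp
  rw [e] at h4
  refine h4.trans ((measure_mono (Set.subset_univ _)).trans ?_)
  rw [withDensity_apply _ MeasurableSet.univ, Measure.restrict_univ, lintegral_indicator hm]

/-- Carleson embedding, with a constant independent of `σ`. The disjoint sets `F i` bound each level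
by the measure of a union of the `T i`, which the weak type bound controls; integration over levels
gives the power `r`. -/
lemma sum_avg_rpow_mul_le (σ : Measure X) [SFinite σ] {T F : ι → Set X}
    (hT : ∀ i, MeasurableSet (T i)) (hF : ∀ i, MeasurableSet (F i)) (hFT : ∀ i, F i ⊆ T i)
    (hd : Pairwise (Function.onFun Disjoint F))
    (hn : ∀ i j, (T i ∩ T j).Nonempty → T i ⊆ T j ∨ T j ⊆ T i)
    (h0 : ∀ i, σ (T i) ≠ 0) (ht : ∀ i, σ (T i) ≠ ∞) {f : X → ℝ≥0∞} (hf : Measurable f)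
    (s : Finset ι) {r : ℝ} (hr : 1 < r) :
    ∑ i ∈ s, ((σ (T i))⁻¹ * ∫⁻ x in T i, f x ∂σ) ^ r * σ (F i) ≤
      ENNReal.ofReal (2 ^ r * (r / (r - 1))) * ∫⁻ x, f x ^ r ∂σ := by
  classical
  have hr0 : 0 < r := by linarith
  have hr1 : 0 < r - 1 := by linarith
  set a : ι → ℝ≥0∞ := fun i => (σ (T i))⁻¹ * ∫⁻ x in T i, f x ∂σ with ha
  have hind : ∀ b : ℝ≥0∞, Measurable
      (Set.indicator {t : ℝ | ENNReal.ofReal t < b} (1 : ℝ → ℝ≥0∞)) := fun b =>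
    measurable_one.indicator (measurableSet_lt ENNReal.measurable_ofReal measurable_const)
  have hφ : ∀ u : ℝ, Measurable fun t : ℝ => ENNReal.ofReal (u * t ^ (u - 1)) := by
    intro u; fun_prop
  have hφi : ∀ (u : ℝ) (b : ℝ≥0∞), Measurable fun t : ℝ => ENNReal.ofReal (u * t ^ (u - 1)) *
      Set.indicator {t : ℝ | ENNReal.ofReal t < b} 1 t := fun u b => (hφ u).mul (hind b)
  have hlevel : ∀ t : ℝ, 0 < t →
      ∑ i ∈ s, Set.indicator {t : ℝ | ENNReal.ofReal t < a i} (1 : ℝ → ℝ≥0∞) t * σ (F i) ≤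
        ENNReal.ofReal (2 / t) * ∫⁻ x in {x | ENNReal.ofReal (t / 2) < f x}, f x ∂σ := by
    intro t htpos
    set s' := s.filter fun i => ENNReal.ofReal t < a i with hs'
    have h1 : ∑ i ∈ s, Set.indicator {t : ℝ | ENNReal.ofReal t < a i} (1 : ℝ → ℝ≥0∞) t * σ (F i)
        = ∑ i ∈ s', σ (F i) := by
      rw [hs', Finset.sum_filter]
      refine Finset.sum_congr rfl fun i _ => ?_
      by_cases h : ENNReal.ofReal t < a i <;> simp [Set.indicator, h]
    have h2 : ∑ i ∈ s', σ (F i) ≤ σ (⋃ i ∈ s', T i) := by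
      rw [← measure_biUnion_finset (fun i _ j _ hij => hd hij) fun i _ => hF i]
      exact measure_mono (Set.iUnion₂_mono fun i _ => hFT i)
    have h3 := measure_biUnion_avg_lt_le σ hT hn h0 ht hf s' (ENNReal.ofReal (t / 2))
      ENNReal.ofReal_ne_top (fun i hi => by
        have e : 2 * ENNReal.ofReal (t / 2) = ENNReal.ofReal t := by
          rw [← ENNReal.ofReal_ofNat 2, ← ENNReal.ofReal_mul (by norm_num)]
          congr 1; ring
        rw [e]
        exact (Finset.mem_filter.1 hi).2)
    rw [h1]
    refine h2.trans ?_
    calc σ (⋃ i ∈ s', T i)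
        = ENNReal.ofReal (2 / t) * (ENNReal.ofReal (t / 2) * σ (⋃ i ∈ s', T i)) := by
          rw [← mul_assoc, ← ENNReal.ofReal_mul (by positivity)]
          rw [show 2 / t * (t / 2) = 1 by field_simp]
          simp
      _ ≤ _ := by gcongr
  calc ∑ i ∈ s, a i ^ r * σ (F i)
      = ∑ i ∈ s, ∫⁻ t in Set.Ioi (0 : ℝ), ENNReal.ofReal (r * t ^ (r - 1)) *
          (Set.indicator {t : ℝ | ENNReal.ofReal t < a i} 1 t * σ (F i)) := by
        refine Finset.sum_congr rfl fun i _ => ?_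
        rw [rpow_eq_lintegral (a i) hr0, ← lintegral_mul_const _ (hφi r (a i))]
        simp_rw [mul_assoc]
    _ = ∫⁻ t in Set.Ioi (0 : ℝ), ENNReal.ofReal (r * t ^ (r - 1)) *
          ∑ i ∈ s, (Set.indicator {t : ℝ | ENNReal.ofReal t < a i} 1 t * σ (F i)) := by
        simp_rw [Finset.mul_sum, ← mul_assoc]
        rw [← lintegral_finsetSum _ fun i _ => (hφi r (a i)).mul_const _]
    _ ≤ ∫⁻ t in Set.Ioi (0 : ℝ), ENNReal.ofReal (r * t ^ (r - 1)) *
          (ENNReal.ofReal (2 / t) * ∫⁻ x in {x | ENNReal.ofReal (t / 2) < f x}, f x ∂σ) :=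
        setLIntegral_mono' measurableSet_Ioi fun t ht => by
          gcongr; exact hlevel t ht
    -- The factor `2 / t` lowers the exponent, and `r - 1 > 0` makes the new density that of the
    -- layer cake formula for `(2 f) ^ (r - 1)`.
    _ = ∫⁻ t in Set.Ioi (0 : ℝ), ∫⁻ x, ENNReal.ofReal (2 * r / (r - 1)) *
          (f x * (ENNReal.ofReal ((r - 1) * t ^ (r - 1 - 1)) *
            Set.indicator {t : ℝ | ENNReal.ofReal t < 2 * f x} 1 t)) ∂σ := by
        refine setLIntegral_congr_fun measurableSet_Ioi fun t ht => ?_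
        have ht : 0 < t := ht
        rw [← mul_assoc, ← ENNReal.ofReal_mul (by positivity),
          ← lintegral_indicator (measurableSet_lt measurable_const hf),
          ← lintegral_const_mul' _ _ ENNReal.ofReal_ne_top]
        refine lintegral_congr fun x => ?_
        have e1 : r * t ^ (r - 1) * (2 / t) =
            2 * r / (r - 1) * ((r - 1) * t ^ (r - 1 - 1)) := by
          rw [Real.rpow_sub_one ht.ne' (r - 1)]
          field_simp
        have e2 : ENNReal.ofReal (t / 2) < f x ↔ ENNReal.ofReal t < 2 * f x := by
          rw [ENNReal.ofReal_div_of_pos (by norm_num), ENNReal.ofReal_ofNat,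
            ENNReal.div_lt_iff (by simp) (by simp), mul_comm]
        rw [e1, ENNReal.ofReal_mul (by positivity)]
        by_cases h : ENNReal.ofReal (t / 2) < f x
        · have h' := e2.1 h
          rw [Set.indicator_of_mem (by exact h), Set.indicator_of_mem (by exact h')]
          simp only [Pi.one_apply]
          ring
        · have h' := fun h' => h (e2.2 h')
          rw [Set.indicator_of_notMem (by exact h), Set.indicator_of_notMem (by exact h')]
          simp
    _ = ∫⁻ x, (∫⁻ t in Set.Ioi (0 : ℝ), ENNReal.ofReal (2 * r / (r - 1)) *
          (f x * (ENNReal.ofReal ((r - 1) * t ^ (r - 1 - 1)) *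
            Set.indicator {t : ℝ | ENNReal.ofReal t < 2 * f x} 1 t))) ∂σ := by
        refine lintegral_lintegral_swap (Measurable.aemeasurable ?_)
        have h1 : MeasurableSet {p : ℝ × X | ENNReal.ofReal p.1 < 2 * f p.2} :=
          measurableSet_lt (ENNReal.measurable_ofReal.comp measurable_fst)
            ((hf.comp measurable_snd).const_mul _)
        have h2 := (measurable_one (α := ℝ≥0∞)).indicator h1
        have h3 : Measurable fun p : ℝ × X => ENNReal.ofReal (2 * r / (r - 1)) *
          (f p.2 * (ENNReal.ofReal ((r - 1) * p.1 ^ (r - 1 - 1)) *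
            Set.indicator {p : ℝ × X | ENNReal.ofReal p.1 < 2 * f p.2} 1 p)) :=
          ((hf.comp measurable_snd).mul
            (((hφ (r - 1)).comp measurable_fst).mul h2)).const_mul _
        exact h3
    _ = ∫⁻ x, ENNReal.ofReal (2 ^ r * (r / (r - 1))) * f x ^ r ∂σ := by
        refine lintegral_congr fun x => ?_
        rw [lintegral_const_mul _ ((hφi (r - 1) _).const_mul _),
          lintegral_const_mul _ (hφi (r - 1) _),
          ← rpow_eq_lintegral (2 * f x) hr1, ENNReal.mul_rpow_of_nonneg _ _ hr1.le]
        have e1 : f x * f x ^ (r - 1) = f x ^ r := by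
          conv_lhs => rw [← ENNReal.rpow_one (f x), ← ENNReal.rpow_mul, one_mul,
            ← ENNReal.rpow_add_of_nonneg _ _ (by norm_num) hr1.le]
          congr 1; ring
        have e2 : ENNReal.ofReal (2 * r / (r - 1)) * 2 ^ (r - 1) =
            ENNReal.ofReal (2 ^ r * (r / (r - 1))) := by
          rw [← ENNReal.ofReal_ofNat 2, ENNReal.ofReal_rpow_of_pos (by norm_num),
            ← ENNReal.ofReal_mul (by positivity)]
          congr 1
          rw [Real.rpow_sub_one (by norm_num)]
          field_simp
        rw [← e2, ← e1]
        ring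
    _ = _ := lintegral_const_mul' _ _ ENNReal.ofReal_ne_top

end Abstract

end NTMax
end

/-! ### The bilinear estimate for sparse families -/

noncomputable section
namespace NTMax

/-- The sharp exponent comes from here. The `A_r` condition is used once and gives `WT * ST / T ≤ K
* T ^ (r - 1) * ST ^ (2 - r)`. Since `2 - r ≤ 0`, replacing `ST` by the smaller `SF` only increases
the bound, and `T ≤ η F` with Hölder's inequality on `F` converts `T ^ (r - 1)`. The exponents add
up because `(r - 1) / r' + 2 - r = 1 / r`. -/
lemma sparse_term_le_real {r r' K η T WT ST F WF SF : ℝ} (hr : 2 ≤ r)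
    (hrr : 1 / r + 1 / r' = 1) (hK : 0 ≤ K) (hη : 0 ≤ η) (hT : 0 < T) (hST : 0 < ST)
    (hWF : 0 < WF) (hSF : 0 < SF)
    (hA : WT * ST ^ (r - 1) ≤ K * T ^ r) (hTF : T ≤ η * F) (hS : SF ≤ ST)
    (hH : F ≤ WF ^ (1 / r) * SF ^ (1 / r')) :
    T⁻¹ * (WT * ST) ≤ η ^ (r - 1) * K * (SF ^ (1 / r) * WF ^ (1 / r')) := by
  have hr0 : 0 < r := by linarith
  have hr1 : 0 ≤ r - 1 := by linarith
  have e1 : 1 / r' = 1 - 1 / r := by linarith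
  have h1 : T⁻¹ * (WT * ST) ≤ K * T ^ (r - 1) * ST ^ (2 - r) := by
    have h2 : WT ≤ K * T ^ r / ST ^ (r - 1) := by
      rw [le_div_iff₀ (by positivity)]; exact hA
    calc T⁻¹ * (WT * ST) ≤ T⁻¹ * (K * T ^ r / ST ^ (r - 1) * ST) := by gcongr
      _ = K * (T ^ r / T) * (ST / ST ^ (r - 1)) := by field_simp
      _ = _ := by
        rw [← Real.rpow_sub_one hT.ne']
        congr 1
        conv_lhs => rw [← Real.rpow_one ST, ← Real.rpow_mul hST.le, one_mul, ← Real.rpow_sub hST]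
        congr 1; ring
  have h2 : ST ^ (2 - r) ≤ SF ^ (2 - r) :=
    Real.rpow_le_rpow_of_nonpos hSF hS (by linarith)
  have h3 : T ^ (r - 1) ≤ η ^ (r - 1) * (WF ^ (1 / r) * SF ^ (1 / r')) ^ (r - 1) := by
    rw [← Real.mul_rpow hη (by positivity)]
    exact Real.rpow_le_rpow hT.le (hTF.trans (by gcongr)) hr1
  calc T⁻¹ * (WT * ST) ≤ K * T ^ (r - 1) * ST ^ (2 - r) := h1
    _ ≤ K * (η ^ (r - 1) * (WF ^ (1 / r) * SF ^ (1 / r')) ^ (r - 1)) * SF ^ (2 - r) := by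
        gcongr
    _ = η ^ (r - 1) * K *
        ((SF ^ (1 / r')) ^ (r - 1) * SF ^ (2 - r) * (WF ^ (1 / r)) ^ (r - 1)) := by
        rw [Real.mul_rpow (by positivity) (by positivity)]; ring
    _ = _ := by
        congr 2
        · rw [← Real.rpow_mul hSF.le, ← Real.rpow_add hSF]
          congr 1
          rw [e1]
          field_simp
          ring
        · rw [← Real.rpow_mul hWF.le]
          congr 1
          rw [e1]
          field_simp

lemma sparse_term_le {r r' : ℝ} {K η T WT ST F WF SF : ℝ≥0∞} (hr : 2 ≤ r)
    (hrr : 1 / r + 1 / r' = 1) (hK : K ≠ ∞) (hη : η ≠ ∞) (hT : T ≠ 0) (hTt : T ≠ ∞)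
    (hST : ST ≠ 0) (hSTt : ST ≠ ∞) (hWTt : WT ≠ ∞) (hFT : F ≤ T) (hWF : WF ≤ WT)
    (hA : WT * ST ^ (r - 1) ≤ K * T ^ r) (hTF : T ≤ η * F) (hS : SF ≤ ST)
    (hH : F ≤ WF ^ (1 / r) * SF ^ (1 / r')) :
    T⁻¹ * (WT * ST) ≤ η ^ (r - 1) * K * (SF ^ (1 / r) * WF ^ (1 / r')) := by
  have hr0 : 0 < r := by linarith
  have hr1 : 0 ≤ r - 1 := by linarith
  have hr'0 : 0 < 1 / r' := by
    have : 1 / r ≤ 1 / 2 := one_div_le_one_div_of_le (by norm_num) hr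
    linarith
  have hF0 : F ≠ 0 := by
    rintro rfl
    rw [mul_zero] at hTF
    exact hT (le_antisymm hTF zero_le)
  have hFt : F ≠ ∞ := ne_top_of_le_ne_top hTt hFT
  have hWFt : WF ≠ ∞ := ne_top_of_le_ne_top hWTt hWF
  have hSFt : SF ≠ ∞ := ne_top_of_le_ne_top hSTt hS
  have hWF0 : WF ≠ 0 := by
    rintro rfl
    rw [ENNReal.zero_rpow_of_pos (by positivity), zero_mul] at hH
    exact hF0 (le_antisymm hH zero_le)
  have hSF0 : SF ≠ 0 := by
    rintro rfl
    rw [ENNReal.zero_rpow_of_pos hr'0, mul_zero] at hH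
    exact hF0 (le_antisymm hH zero_le)
  have nt : ∀ {a : ℝ≥0∞} {s : ℝ}, 0 ≤ s → a ≠ ∞ → a ^ s ≠ ∞ := fun hs ha =>
    ENNReal.rpow_ne_top_of_nonneg hs ha
  have hrhs : η ^ (r - 1) * K * (SF ^ (1 / r) * WF ^ (1 / r')) ≠ ∞ :=
    ENNReal.mul_ne_top (ENNReal.mul_ne_top (nt hr1 hη) hK)
      (ENNReal.mul_ne_top (nt (by positivity) hSFt) (nt hr'0.le hWFt))
  have hlhs : T⁻¹ * (WT * ST) ≠ ∞ :=
    ENNReal.mul_ne_top (ENNReal.inv_ne_top.2 hT) (ENNReal.mul_ne_top hWTt hSTt)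
  have pos : ∀ {a : ℝ≥0∞}, a ≠ 0 → a ≠ ∞ → 0 < a.toReal := fun h h' => ENNReal.toReal_pos h h'
  have hA' := ENNReal.toReal_mono (ENNReal.mul_ne_top hK (nt hr0.le hTt)) hA
  have hTF' := ENNReal.toReal_mono (ENNReal.mul_ne_top hη hFt) hTF
  have hS' := ENNReal.toReal_mono hSTt hS
  have hH' := ENNReal.toReal_mono
    (ENNReal.mul_ne_top (nt (by positivity) hWFt) (nt hr'0.le hSFt)) hH
  simp only [ENNReal.toReal_mul, ← ENNReal.toReal_rpow] at hA' hTF' hH'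
  rw [← ENNReal.toReal_le_toReal hlhs hrhs]
  simp only [ENNReal.toReal_mul, ← ENNReal.toReal_rpow, ENNReal.toReal_inv]
  exact sparse_term_le_real hr hrr ENNReal.toReal_nonneg ENNReal.toReal_nonneg (pos hT hTt)
    (pos hST hSTt) (pos hWF0 hWFt) (pos hSF0 hSFt) hA' hTF' hS' hH'

/-- The constant in the bilinear estimate for sparse families. -/
def sparseConst (η : ℝ≥0) (r r' : ℝ) : ℝ≥0∞ :=
  (η : ℝ≥0∞) ^ (r - 1) * (ENNReal.ofReal (2 ^ r * (r / (r - 1))) ^ (1 / r) *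
    ENNReal.ofReal (2 ^ r' * (r' / (r' - 1))) ^ (1 / r'))

lemma sparseConst_ne_top (η : ℝ≥0) {r r' : ℝ} (hr : 1 < r) (hr' : 1 < r') :
    sparseConst η r r' ≠ ∞ := by
  unfold sparseConst
  refine ENNReal.mul_ne_top ?_ (ENNReal.mul_ne_top ?_ ?_)
  · exact ENNReal.rpow_ne_top_of_nonneg (by linarith) ENNReal.coe_ne_top
  · exact ENNReal.rpow_ne_top_of_nonneg (by positivity) ENNReal.ofReal_ne_top
  · exact ENNReal.rpow_ne_top_of_nonneg (by positivity) ENNReal.ofReal_ne_top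

/-- A nested family of sets `T i` with disjoint subsets `F i` of comparable measure, together with
two weights that are finite and positive on it and satisfy Hölder's inequality on the `F i`. -/
structure SparseFamily {X ι : Type*} [MeasurableSpace X] (μ w σ : Measure X)
    (T F : ι → Set X) (η : ℝ≥0) (r r' : ℝ) : Prop where
  mT : ∀ i, MeasurableSet (T i)
  mF : ∀ i, MeasurableSet (F i)
  sub : ∀ i, F i ⊆ T i
  disj : Pairwise (Function.onFun Disjoint F)
  nested : ∀ i j, (T i ∩ T j).Nonempty → T i ⊆ T j ∨ T j ⊆ T i
  μ0 : ∀ i, μ (T i) ≠ 0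
  μt : ∀ i, μ (T i) ≠ ∞
  w0 : ∀ i, w (T i) ≠ 0
  wt : ∀ i, w (T i) ≠ ∞
  σ0 : ∀ i, σ (T i) ≠ 0
  σt : ∀ i, σ (T i) ≠ ∞
  le : ∀ i, μ (T i) ≤ η * μ (F i)
  holder : ∀ i, μ (F i) ≤ w (F i) ^ (1 / r) * σ (F i) ^ (1 / r')

lemma SparseFamily.symm {X ι : Type*} [MeasurableSpace X] {μ w σ : Measure X}
    {T F : ι → Set X} {η : ℝ≥0} {r r' : ℝ} (h : SparseFamily μ w σ T F η r r') :
    SparseFamily μ σ w T F η r' r :=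
  { h with
    w0 := h.σ0, wt := h.σt, σ0 := h.w0, σt := h.wt
    holder := fun i => by rw [mul_comm]; exact h.holder i }

section Abstract

variable {X ι : Type*} [MeasurableSpace X] {μ w σ : Measure X} [SFinite w] [SFinite σ]
  {T F : ι → Set X} {η : ℝ≥0} {r r' : ℝ}

/-- Writing integrals over `T i` as weighted measure times average, `sparse_term_le` moves the
measures to `F i`; Hölder's inequality in `i` then leaves one Carleson embedding for `σ` and one for
`w`. -/
lemma SparseFamily.bilinear_le_of_two_le (h : SparseFamily μ w σ T F η r r')
    (hr : 2 ≤ r) (hrr : r.HolderConjugate r') {K : ℝ≥0∞} (hK : K ≠ ∞)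
    (hA : ∀ i, w (T i) * σ (T i) ^ (r - 1) ≤ K * μ (T i) ^ r)
    {f g : X → ℝ≥0∞} (hf : Measurable f) (hg : Measurable g) (s : Finset ι) :
    ∑ i ∈ s, (μ (T i))⁻¹ * ((∫⁻ x in T i, f x ∂σ) * ∫⁻ x in T i, g x ∂w) ≤
      sparseConst η r r' * K *
        ((∫⁻ x, f x ^ r ∂σ) ^ (1 / r) * (∫⁻ x, g x ^ r' ∂w) ^ (1 / r')) := by
  have hrr' : 1 / r + 1 / r' = 1 := by simpa using hrr.inv_add_inv_eq_one
  have hr0 := hrr.pos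
  have hr'0 := hrr.symm.pos
  set a : ι → ℝ≥0∞ := fun i => (σ (T i))⁻¹ * ∫⁻ x in T i, f x ∂σ with ha
  set b : ι → ℝ≥0∞ := fun i => (w (T i))⁻¹ * ∫⁻ x in T i, g x ∂w with hb
  have hterm : ∀ i, (μ (T i))⁻¹ * ((∫⁻ x in T i, f x ∂σ) * ∫⁻ x in T i, g x ∂w) ≤
      (η : ℝ≥0∞) ^ (r - 1) * K * ((a i * σ (F i) ^ (1 / r)) * (b i * w (F i) ^ (1 / r'))) := by
    intro i
    have e1 : ∫⁻ x in T i, f x ∂σ = σ (T i) * a i := by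
      rw [ha, ← mul_assoc, ENNReal.mul_inv_cancel (h.σ0 i) (h.σt i), one_mul]
    have e2 : ∫⁻ x in T i, g x ∂w = w (T i) * b i := by
      rw [hb, ← mul_assoc, ENNReal.mul_inv_cancel (h.w0 i) (h.wt i), one_mul]
    have h1 := sparse_term_le hr hrr' hK (ENNReal.coe_ne_top (r := η)) (h.μ0 i) (h.μt i) (h.σ0 i)
      (h.σt i) (h.wt i) (measure_mono (h.sub i)) (measure_mono (h.sub i)) (hA i) (h.le i)
      (measure_mono (h.sub i)) (h.holder i)
    rw [e1, e2]
    calc (μ (T i))⁻¹ * (σ (T i) * a i * (w (T i) * b i))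
        = (μ (T i))⁻¹ * (w (T i) * σ (T i)) * (a i * b i) := by ring
      _ ≤ (η : ℝ≥0∞) ^ (r - 1) * K * (σ (F i) ^ (1 / r) * w (F i) ^ (1 / r')) *
          (a i * b i) := by gcongr
      _ = _ := by ring
  have hsa : ∑ i ∈ s, (a i * σ (F i) ^ (1 / r)) ^ r ≤
      ENNReal.ofReal (2 ^ r * (r / (r - 1))) * ∫⁻ x, f x ^ r ∂σ := by
    refine le_trans (le_of_eq ?_)
      (sum_avg_rpow_mul_le σ h.mT h.mF h.sub h.disj h.nested h.σ0 h.σt hf s hrr.lt)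
    refine Finset.sum_congr rfl fun i _ => ?_
    rw [ENNReal.mul_rpow_of_nonneg _ _ hr0.le, ← ENNReal.rpow_mul,
      one_div_mul_cancel hr0.ne', ENNReal.rpow_one]
  have hsb : ∑ i ∈ s, (b i * w (F i) ^ (1 / r')) ^ r' ≤
      ENNReal.ofReal (2 ^ r' * (r' / (r' - 1))) * ∫⁻ x, g x ^ r' ∂w := by
    refine le_trans (le_of_eq ?_)
      (sum_avg_rpow_mul_le w h.mT h.mF h.sub h.disj h.nested h.w0 h.wt hg s hrr.symm.lt)
    refine Finset.sum_congr rfl fun i _ => ?_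
    rw [ENNReal.mul_rpow_of_nonneg _ _ hr'0.le, ← ENNReal.rpow_mul,
      one_div_mul_cancel hr'0.ne', ENNReal.rpow_one]
  calc _ ≤ ∑ i ∈ s, (η : ℝ≥0∞) ^ (r - 1) * K *
        ((a i * σ (F i) ^ (1 / r)) * (b i * w (F i) ^ (1 / r'))) :=
        Finset.sum_le_sum fun i _ => hterm i
    _ = (η : ℝ≥0∞) ^ (r - 1) * K *
        ∑ i ∈ s, (a i * σ (F i) ^ (1 / r)) * (b i * w (F i) ^ (1 / r')) := by
        rw [Finset.mul_sum]
    _ ≤ (η : ℝ≥0∞) ^ (r - 1) * K *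
        ((ENNReal.ofReal (2 ^ r * (r / (r - 1))) * ∫⁻ x, f x ^ r ∂σ) ^ (1 / r) *
         (ENNReal.ofReal (2 ^ r' * (r' / (r' - 1))) * ∫⁻ x, g x ^ r' ∂w) ^ (1 / r')) := by
        gcongr
        refine (ENNReal.inner_le_Lp_mul_Lq s _ _ hrr).trans ?_
        gcongr
    _ = _ := by
        rw [ENNReal.mul_rpow_of_nonneg _ _ (by positivity),
          ENNReal.mul_rpow_of_nonneg _ _ (by positivity), sparseConst]
        ring

/-- For `r ≤ 2` exchange `w` and `σ`: the form is symmetric, `r' ≥ 2`, and raising the `A_r`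
condition to the power `1 / (r - 1)` gives the dual one with `K ^ (1 / (r - 1))`. -/
lemma SparseFamily.bilinear_le (h : SparseFamily μ w σ T F η r r')
    (hrr : r.HolderConjugate r') {K : ℝ≥0∞} (hK : K ≠ ∞) (hK1 : 1 ≤ K)
    (hA : ∀ i, w (T i) * σ (T i) ^ (r - 1) ≤ K * μ (T i) ^ r)
    {f g : X → ℝ≥0∞} (hf : Measurable f) (hg : Measurable g) (s : Finset ι) :
    ∑ i ∈ s, (μ (T i))⁻¹ * ((∫⁻ x in T i, f x ∂σ) * ∫⁻ x in T i, g x ∂w) ≤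
      (sparseConst η r r' + sparseConst η r' r) * K ^ max 1 (1 / (r - 1)) *
        ((∫⁻ x, f x ^ r ∂σ) ^ (1 / r) * (∫⁻ x, g x ^ r' ∂w) ^ (1 / r')) := by
  have hr1 : 0 < r - 1 := hrr.sub_one_pos
  rcases le_total 2 r with hr | hr
  · refine (h.bilinear_le_of_two_le hr hrr hK hA hf hg s).trans ?_
    gcongr
    · exact le_self_add
    · conv_lhs => rw [← ENNReal.rpow_one K]
      exact ENNReal.rpow_le_rpow_of_exponent_le hK1 (le_max_left _ _)
  · have hrp : r' - 1 = 1 / (r - 1) := by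
      have := hrr.sub_one_mul_conj
      field_simp
      nlinarith
    have hr' : 2 ≤ r' := by
      have : 1 ≤ 1 / (r - 1) := by rw [le_div_iff₀ hr1]; linarith
      linarith
    have hA' : ∀ i, σ (T i) * w (T i) ^ (r' - 1) ≤ K ^ (1 / (r - 1)) * μ (T i) ^ r' := by
      intro i
      have h1 := ENNReal.rpow_le_rpow (hA i) (z := 1 / (r - 1)) (by positivity)
      rw [ENNReal.mul_rpow_of_nonneg _ _ (by positivity),
        ENNReal.mul_rpow_of_nonneg _ _ (by positivity), ← ENNReal.rpow_mul, ← ENNReal.rpow_mul,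
        mul_one_div_cancel hr1.ne', ENNReal.rpow_one] at h1
      rw [hrp, mul_comm]
      refine h1.trans (le_of_eq ?_)
      congr 2
      have := hrr.sub_one_mul_conj
      field_simp
      linarith
    have h2 := h.symm.bilinear_le_of_two_le hr' hrr.symm
      (ENNReal.rpow_ne_top_of_nonneg (by positivity) hK) hA' hg hf s
    calc _ = ∑ i ∈ s, (μ (T i))⁻¹ * ((∫⁻ x in T i, g x ∂w) * ∫⁻ x in T i, f x ∂σ) := by
          refine Finset.sum_congr rfl fun i _ => ?_
          rw [mul_comm (∫⁻ x in T i, f x ∂σ)]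
      _ ≤ _ := h2
      _ ≤ (sparseConst η r r' + sparseConst η r' r) * K ^ max 1 (1 / (r - 1)) *
        ((∫⁻ x, g x ^ r' ∂w) ^ (1 / r') * (∫⁻ x, f x ^ r ∂σ) ^ (1 / r)) := by
          gcongr
          · exact le_add_self
          exact le_max_right _ _
      _ = _ := by rw [mul_comm ((∫⁻ x, g x ^ r' ∂w) ^ (1 / r'))]

/-- Test the bilinear estimate on `g = H ^ (r - 1)`, where `H` is the sparse sum: the left side is
the integral `I` of `H ^ r`, and the norm of `g` is `I ^ (1 / r')`. Sums are finite so that `I < ∞`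
and this factor can be cancelled. -/
lemma SparseFamily.lintegral_sum_rpow_le (h : SparseFamily μ w σ T F η r r')
    (hrr : r.HolderConjugate r') {K : ℝ≥0∞} (hK : K ≠ ∞) (hK1 : 1 ≤ K)
    (hA : ∀ i, w (T i) * σ (T i) ^ (r - 1) ≤ K * μ (T i) ^ r)
    {f : X → ℝ≥0∞} (hf : Measurable f) (hfi : ∀ i, ∫⁻ x in T i, f x ∂σ ≠ ∞) (s : Finset ι) :
    ∫⁻ x, (∑ i ∈ s, (T i).indicator (fun _ => (μ (T i))⁻¹ * ∫⁻ y in T i, f y ∂σ) x) ^ r ∂w ≤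
      ((sparseConst η r r' + sparseConst η r' r) * K ^ max 1 (1 / (r - 1))) ^ r *
        ∫⁻ x, f x ^ r ∂σ := by
  have hr0 := hrr.pos
  have hr1 : 0 < r - 1 := hrr.sub_one_pos
  have hr'0 := hrr.symm.pos
  set c : ι → ℝ≥0∞ := fun i => (μ (T i))⁻¹ * ∫⁻ y in T i, f y ∂σ with hc
  have hct : ∀ i, c i ≠ ∞ := fun i =>
    ENNReal.mul_ne_top (ENNReal.inv_ne_top.2 (h.μ0 i)) (hfi i)
  set H : X → ℝ≥0∞ := fun x => ∑ i ∈ s, (T i).indicator (fun _ => c i) x with hH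
  have hHm : Measurable H :=
    Finset.measurable_fun_sum _ fun i _ => measurable_const.indicator (h.mT i)
  set M := (sparseConst η r r' + sparseConst η r' r) * K ^ max 1 (1 / (r - 1)) with hM
  set I := ∫⁻ x, H x ^ r ∂w with hI
  -- finiteness
  have hIt : I ≠ ∞ := by
    set B : ℝ≥0∞ := ∑ i ∈ s, c i with hB
    have hBt : B ≠ ∞ := (ENNReal.sum_lt_top.2 fun i _ => (hct i).lt_top).ne
    have h1 : ∀ x, H x ^ r ≤ (⋃ i ∈ s, T i).indicator (fun _ => B ^ r) x := by
      intro x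
      by_cases hx : x ∈ ⋃ i ∈ s, T i
      · rw [Set.indicator_of_mem hx]
        refine ENNReal.rpow_le_rpow (Finset.sum_le_sum fun i _ => ?_) hr0.le
        exact Set.indicator_le_self' (fun _ _ => zero_le) x
      · rw [Set.indicator_of_notMem hx]
        have : H x = 0 := by
          refine Finset.sum_eq_zero fun i hi => Set.indicator_of_notMem (fun hxi => hx ?_) _
          exact Set.mem_biUnion (Finset.mem_coe.2 hi) hxi
        rw [this, ENNReal.zero_rpow_of_pos hr0]
    refine ne_top_of_le_ne_top ?_ (lintegral_mono h1)
    rw [lintegral_indicator_const (s.measurableSet_biUnion fun i _ => h.mT i)]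
    refine ENNReal.mul_ne_top (ENNReal.rpow_ne_top_of_nonneg hr0.le hBt) ?_
    refine ne_top_of_le_ne_top ?_ (measure_biUnion_finset_le s T)
    exact (ENNReal.sum_lt_top.2 fun i _ => (h.wt i).lt_top).ne
  have hbil := h.bilinear_le hrr hK hK1 hA hf (hHm.pow_const (r - 1)) s
  have e1 : ∑ i ∈ s, (μ (T i))⁻¹ * ((∫⁻ x in T i, f x ∂σ) * ∫⁻ x in T i, H x ^ (r - 1) ∂w) = I := by
    calc _ = ∑ i ∈ s, ∫⁻ x, (T i).indicator (fun _ => c i) x * H x ^ (r - 1) ∂w := by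
          refine Finset.sum_congr rfl fun i _ => ?_
          rw [← mul_assoc, ← lintegral_const_mul _ (hHm.pow_const _),
            ← lintegral_indicator (h.mT i)]
          refine lintegral_congr fun x => ?_
          by_cases hx : x ∈ T i <;> simp [hx, hc]
      _ = ∫⁻ x, H x * H x ^ (r - 1) ∂w := by
          have hm : ∀ i ∈ s, Measurable
              (fun x => (T i).indicator (fun _ => c i) x * H x ^ (r - 1)) := fun i _ =>
            (measurable_const.indicator (h.mT i)).mul (hHm.pow_const _)
          rw [← lintegral_finsetSum _ hm]
          refine lintegral_congr fun x => ?_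
          rw [← Finset.sum_mul]
      _ = I := by
          refine lintegral_congr fun x => ?_
          conv_lhs => rw [← ENNReal.rpow_one (H x), ← ENNReal.rpow_mul, one_mul,
            ← ENNReal.rpow_add_of_nonneg _ _ (by norm_num) hr1.le]
          congr 1; ring
  have e2 : ∫⁻ x, (H x ^ (r - 1)) ^ r' ∂w = I := by
    refine lintegral_congr fun x => ?_
    rw [← ENNReal.rpow_mul, hrr.sub_one_mul_conj]
  rw [e1, e2] at hbil
  rcases eq_or_ne I 0 with hI0 | hI0
  · rw [hI0]; exact zero_le
  have h1 : I ^ (1 / r) ≤ M * (∫⁻ x, f x ^ r ∂σ) ^ (1 / r) := by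
    have h2 : I ^ (1 / r) * I ^ (1 / r') ≤
        M * (∫⁻ x, f x ^ r ∂σ) ^ (1 / r) * I ^ (1 / r') := by
      rw [← ENNReal.rpow_add _ _ hI0 hIt]
      have : 1 / r + 1 / r' = 1 := by simpa using hrr.inv_add_inv_eq_one
      rw [this, ENNReal.rpow_one, mul_assoc]
      exact hbil
    refine (ENNReal.mul_le_mul_iff_left ?_ ?_).1 h2
    · exact (ENNReal.rpow_pos (pos_iff_ne_zero.2 hI0) hIt).ne'
    · exact ENNReal.rpow_ne_top_of_nonneg (by positivity) hIt
  have h2 := ENNReal.rpow_le_rpow h1 hr0.le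
  rwa [ENNReal.mul_rpow_of_nonneg _ _ hr0.le, ← ENNReal.rpow_mul, ← ENNReal.rpow_mul,
    one_div_mul_cancel hr0.ne', ENNReal.rpow_one, ENNReal.rpow_one] at h2

lemma SparseFamily.lintegral_tsum_rpow_le [Countable ι] (h : SparseFamily μ w σ T F η r r')
    (hrr : r.HolderConjugate r') {K : ℝ≥0∞} (hK : K ≠ ∞) (hK1 : 1 ≤ K)
    (hA : ∀ i, w (T i) * σ (T i) ^ (r - 1) ≤ K * μ (T i) ^ r)
    {f : X → ℝ≥0∞} (hf : Measurable f) (hfi : ∀ i, ∫⁻ x in T i, f x ∂σ ≠ ∞) :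
    ∫⁻ x, (∑' i, (T i).indicator (fun _ => (μ (T i))⁻¹ * ∫⁻ y in T i, f y ∂σ) x) ^ r ∂w ≤
      ((sparseConst η r r' + sparseConst η r' r) * K ^ max 1 (1 / (r - 1))) ^ r *
        ∫⁻ x, f x ^ r ∂σ := by
  have hr0 := hrr.pos
  set φ : ι → X → ℝ≥0∞ := fun i => (T i).indicator
    (fun _ => (μ (T i))⁻¹ * ∫⁻ y in T i, f y ∂σ) with hφ
  have e : ∀ x, (∑' i, φ i x) ^ r = ⨆ s : Finset ι, (∑ i ∈ s, φ i x) ^ r := by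
    intro x
    rw [ENNReal.tsum_eq_iSup_sum]
    exact (ENNReal.orderIsoRpow r hr0).map_iSup _
  rw [show ∫⁻ x, (∑' i, φ i x) ^ r ∂w = ∫⁻ x, ⨆ s : Finset ι, (∑ i ∈ s, φ i x) ^ r ∂w from
    lintegral_congr e, lintegral_iSup_directed_of_measurable]
  · exact iSup_le fun s => h.lintegral_sum_rpow_le hrr hK hK1 hA hf hfi s
  · intro s
    exact (Finset.measurable_fun_sum _ fun i _ => measurable_const.indicator (h.mT i)).pow_const r
  · refine Monotone.directed_le fun s t hst x => ?_
    exact ENNReal.rpow_le_rpow (Finset.sum_le_sum_of_subset hst) hr0.le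

end Abstract

end NTMax
end

/-! ### Muckenhoupt weights and their duals -/

noncomputable section
namespace NTMax

variable {n : ℕ} {p q : ℝ} {ν : Rn n → ℝ}

/-- A representative of an `A_q` weight that is measurable and positive everywhere. -/
structure IsStrictAqWeight (q : ℝ) (ν : Rn n → ℝ) : Prop where
  measurable : Measurable ν
  pos : ∀ x, 0 < ν x
  char_lt_top : aqChar q ν < ∞

lemma aqChar_congr {ν' : Rn n → ℝ} (h : ν =ᵐ[volume] ν') : aqChar q ν = aqChar q ν' := by
  have h1 : ∀ a l, (⨍⁻ x in cube a l, ENNReal.ofReal (ν x) ∂volume) =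
      ⨍⁻ x in cube a l, ENNReal.ofReal (ν' x) ∂volume := fun a l => by
    rw [setLAverage_eq, setLAverage_eq]
    congr 1
    refine lintegral_congr_ae (ae_restrict_of_ae ?_)
    filter_upwards [h] with x hx
    rw [hx]
  have h2 : ∀ a l, (⨍⁻ x in cube a l, ENNReal.ofReal (ν x ^ (-1 / (q - 1))) ∂volume) =
      ⨍⁻ x in cube a l, ENNReal.ofReal (ν' x ^ (-1 / (q - 1))) ∂volume := fun a l => by
    rw [setLAverage_eq, setLAverage_eq]
    congr 1
    refine lintegral_congr_ae (ae_restrict_of_ae ?_)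
    filter_upwards [h] with x hx
    rw [hx]
  simp only [aqChar, h1, h2]

lemma IsAqWeight.exists_strict (h : IsAqWeight q ν) :
    ∃ ν' : Rn n → ℝ, IsStrictAqWeight q ν' ∧ weightMeasure ν' = weightMeasure ν ∧
      aqChar q ν' = aqChar q ν := by
  set g := h.aemeasurable.mk ν with hg
  have hgm : Measurable g := h.aemeasurable.measurable_mk
  set ν' : Rn n → ℝ := fun x => if 0 < g x then g x else 1 with hν'
  have hae : ν' =ᵐ[volume] ν := by
    filter_upwards [h.aemeasurable.ae_eq_mk, h.pos] with x hx hp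
    rw [hx] at hp
    simp only [hν', hg, if_pos hp, hx]
  refine ⟨ν', ⟨Measurable.ite (measurableSet_lt measurable_const hgm) hgm measurable_const,
    fun x => ?_, ?_⟩, ?_, aqChar_congr hae⟩
  · simp only [hν']
    split_ifs with h1
    · exact h1
    · exact one_pos
  · rw [aqChar_congr hae]; exact h.char_lt_top
  · refine withDensity_congr_ae ?_
    filter_upwards [hae] with x hx
    rw [hx]

/-- The dual weight `ν^{-1/(q-1)}`. -/
def dualWeight (q : ℝ) (ν : Rn n → ℝ) (x : Rn n) : ℝ := ν x ^ (-1 / (q - 1))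

lemma IsStrictAqWeight.measurable_dual (h : IsStrictAqWeight q ν) :
    Measurable (dualWeight q ν) :=
  h.measurable.pow_const _

lemma dualWeight_pos (h : ∀ x, 0 < ν x) (x : Rn n) : 0 < dualWeight q ν x :=
  Real.rpow_pos_of_pos (h x) _

lemma absolutelyContinuous_weightMeasure (hm : Measurable ν) (h : ∀ x, 0 < ν x) :
    volume ≪ weightMeasure ν :=
  withDensity_absolutelyContinuous' hm.ennreal_ofReal.aemeasurable
    (Filter.Eventually.of_forall fun x => (ENNReal.ofReal_pos.2 (h x)).ne')

lemma lintegral_weightMeasure (hm : Measurable ν) {g : Rn n → ℝ≥0∞} (hg : Measurable g)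
    {E : Set (Rn n)} (hE : MeasurableSet E) :
    ∫⁻ x in E, g x ∂(weightMeasure ν) = ∫⁻ x in E, ENNReal.ofReal (ν x) * g x := by
  rw [weightMeasure, restrict_withDensity hE,
    lintegral_withDensity_eq_lintegral_mul _ hm.ennreal_ofReal hg]
  rfl

lemma weightMeasure_apply (ν : Rn n → ℝ) {E : Set (Rn n)} (hE : MeasurableSet E) :
    weightMeasure ν E = ∫⁻ x in E, ENNReal.ofReal (ν x) :=
  withDensity_apply _ hE

/-- The function `|f| ν^{1/(q-1)}`, the density of `|f| dx` with respect to the dual weight. -/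
def dualDensity (q : ℝ) (ν f : Rn n → ℝ) (x : Rn n) : ℝ≥0∞ :=
  ENNReal.ofReal (ν x ^ (1 / (q - 1))) * ‖f x‖ₑ

lemma measurable_dualDensity (hm : Measurable ν) {f : Rn n → ℝ} (hf : Measurable f) :
    Measurable (dualDensity q ν f) :=
  (hm.pow_const _).ennreal_ofReal.mul hf.enorm

lemma lintegral_dualDensity (h : IsStrictAqWeight q ν) {f : Rn n → ℝ} (hf : Measurable f)
    {E : Set (Rn n)} (hE : MeasurableSet E) :
    ∫⁻ x in E, dualDensity q ν f x ∂(weightMeasure (dualWeight q ν)) = ∫⁻ x in E, ‖f x‖ₑ := by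
  rw [lintegral_weightMeasure h.measurable_dual (measurable_dualDensity h.measurable hf) hE]
  refine lintegral_congr fun x => ?_
  rw [dualDensity, dualWeight, ← mul_assoc,
    ← ENNReal.ofReal_mul (Real.rpow_pos_of_pos (h.pos x) _).le, ← Real.rpow_add (h.pos x)]
  have : -1 / (q - 1) + 1 / (q - 1) = 0 := by ring
  rw [this, Real.rpow_zero, ENNReal.ofReal_one, one_mul]

/-- Writing `|f| = h σ` with `σ` the dual weight, `|f| ^ q ν = h ^ q σ`: the one-weight bound
becomes the two-measure bound for sparse families. -/
lemma lintegral_dualDensity_rpow (hq : 1 < q) (h : IsStrictAqWeight q ν) {f : Rn n → ℝ}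
    (hf : Measurable f) :
    ∫⁻ x, dualDensity q ν f x ^ q ∂(weightMeasure (dualWeight q ν)) =
      ∫⁻ x, ‖f x‖ₑ ^ q ∂(weightMeasure ν) := by
  have e1 := lintegral_weightMeasure h.measurable_dual
    ((measurable_dualDensity (q := q) h.measurable hf).pow_const q) MeasurableSet.univ
  have e2 := lintegral_weightMeasure h.measurable (hf.enorm.pow_const q) MeasurableSet.univ
  simp only [Measure.restrict_univ] at e1 e2
  rw [e1, e2]
  refine lintegral_congr fun x => ?_
  have hx := h.pos x
  have hq1 : q - 1 ≠ 0 := by linarith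
  rw [dualDensity, dualWeight, ENNReal.mul_rpow_of_nonneg _ _ (by linarith), ← mul_assoc,
    ENNReal.ofReal_rpow_of_nonneg (Real.rpow_pos_of_pos hx _).le (by linarith),
    ← ENNReal.ofReal_mul (Real.rpow_pos_of_pos hx _).le, ← Real.rpow_mul hx.le,
    ← Real.rpow_add hx]
  congr 3
  have : -1 / (q - 1) + 1 / (q - 1) * q = 1 := by field_simp; ring
  rw [this, Real.rpow_one]

lemma holderConjugate_of (hq : 1 < q) (hpq : 1 / p + 1 / q = 1) : q.HolderConjugate p := by
  rw [Real.holderConjugate_iff]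
  exact ⟨hq, by simpa [add_comm] using hpq⟩

/-- Hölder's inequality against a weight and its dual. -/
lemma setLIntegral_enorm_le (hqp : q.HolderConjugate p) (h : IsStrictAqWeight q ν)
    {f : Rn n → ℝ} (hf : Measurable f) {E : Set (Rn n)} (hE : MeasurableSet E) :
    ∫⁻ x in E, ‖f x‖ₑ ≤ (∫⁻ x in E, ‖f x‖ₑ ^ q ∂(weightMeasure ν)) ^ (1 / q) *
      weightMeasure (dualWeight q ν) E ^ (1 / p) := by
  have hq := hqp.lt
  have hq0 : 0 < q := by linarith
  have hp0 := hqp.symm.pos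
  have hq1 : q - 1 ≠ 0 := by linarith
  have h1 := ENNReal.lintegral_mul_le_Lp_mul_Lq (volume.restrict E) hqp
    (f := fun x => ENNReal.ofReal (ν x ^ (1 / q)) * ‖f x‖ₑ)
    (g := fun x => ENNReal.ofReal (ν x ^ (-(1 / q))))
    ((h.measurable.pow_const _).ennreal_ofReal.mul hf.enorm).aemeasurable
    (h.measurable.pow_const _).ennreal_ofReal.aemeasurable
  rw [lintegral_weightMeasure h.measurable (hf.enorm.pow_const q) hE, weightMeasure_apply _ hE]
  convert h1 using 1
  · refine lintegral_congr fun x => ?_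
    have hx := h.pos x
    simp only [Pi.mul_apply]
    rw [mul_right_comm, ← ENNReal.ofReal_mul (Real.rpow_pos_of_pos hx _).le,
      ← Real.rpow_add hx, add_neg_cancel, Real.rpow_zero, ENNReal.ofReal_one, one_mul]
  · congr 2
    · refine lintegral_congr fun x => ?_
      have hx := h.pos x
      rw [ENNReal.mul_rpow_of_nonneg _ _ hq0.le,
        ENNReal.ofReal_rpow_of_nonneg (Real.rpow_pos_of_pos hx _).le hq0.le,
        ← Real.rpow_mul hx.le, one_div_mul_cancel hq0.ne', Real.rpow_one]
    · refine lintegral_congr fun x => ?_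
      have hx := h.pos x
      rw [ENNReal.ofReal_rpow_of_nonneg (Real.rpow_pos_of_pos hx _).le hp0.le,
        ← Real.rpow_mul hx.le, dualWeight]
      congr 2
      have := hqp.sub_one_mul_conj
      field_simp
      linarith

lemma volume_le_weightMeasure (hqp : q.HolderConjugate p) (h : IsStrictAqWeight q ν)
    {E : Set (Rn n)} (hE : MeasurableSet E) :
    volume E ≤ weightMeasure ν E ^ (1 / q) * weightMeasure (dualWeight q ν) E ^ (1 / p) := by
  have h1 := setLIntegral_enorm_le hqp h (f := fun _ => 1) measurable_const hE
  simpa using h1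

lemma volume_rpow_le (hqp : q.HolderConjugate p) (h : IsStrictAqWeight q ν)
    {E : Set (Rn n)} (hE : MeasurableSet E) :
    volume E ^ q ≤ weightMeasure ν E * weightMeasure (dualWeight q ν) E ^ (q - 1) := by
  have h1 := ENNReal.rpow_le_rpow (volume_le_weightMeasure hqp h hE) hqp.nonneg
  rw [ENNReal.mul_rpow_of_nonneg _ _ hqp.nonneg, ← ENNReal.rpow_mul, ← ENNReal.rpow_mul,
    one_div_mul_cancel hqp.ne_zero, ENNReal.rpow_one] at h1
  convert h1 using 3
  have := hqp.sub_one_mul_conj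
  have := hqp.symm.ne_zero
  field_simp
  linarith

lemma cube_weight_mul_le (hq : 1 < q) (ν : Rn n → ℝ) (a : Rn n) {l : ℝ} (hl : 0 < l) :
    weightMeasure ν (cube a l) * weightMeasure (dualWeight q ν) (cube a l) ^ (q - 1) ≤
      aqChar q ν * volume (cube a l) ^ q := by
  have hv : volume (cube a l) = ENNReal.ofReal l ^ n := volume_cube a hl.le
  have hv0 : volume (cube a l) ≠ 0 := by
    rw [hv]; exact pow_ne_zero _ (ENNReal.ofReal_pos.2 hl).ne'
  have hvt : volume (cube a l) ≠ ∞ := by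
    rw [hv]; exact ENNReal.pow_ne_top ENNReal.ofReal_ne_top
  have h1 : (⨍⁻ x in cube a l, ENNReal.ofReal (ν x) ∂volume) *
      (⨍⁻ x in cube a l, ENNReal.ofReal (ν x ^ (-1 / (q - 1))) ∂volume) ^ (q - 1) ≤
      aqChar q ν :=
    le_iSup_of_le a (le_iSup_of_le l (le_iSup_of_le hl le_rfl))
  rw [setLAverage_eq, setLAverage_eq] at h1
  rw [weightMeasure_apply _ (measurableSet_cube a l),
    weightMeasure_apply _ (measurableSet_cube a l)]
  refine le_trans (le_of_eq ?_) (mul_le_mul_left h1 (volume (cube a l) ^ q))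
  set V := volume (cube a l)
  rw [ENNReal.div_rpow_of_nonneg _ _ (by linarith : 0 ≤ q - 1)]
  have e : V ^ q = V * V ^ (q - 1) := by
    conv_rhs => rw [← ENNReal.rpow_one V, ← ENNReal.rpow_mul, one_mul,
      ← ENNReal.rpow_add _ _ hv0 hvt]
    congr 1; ring
  have c0 : V ^ (q - 1) ≠ 0 := (ENNReal.rpow_pos (pos_iff_ne_zero.2 hv0) hvt).ne'
  have ct : V ^ (q - 1) ≠ ∞ := ENNReal.rpow_ne_top_of_nonneg (by linarith) hvt
  simp only [dualWeight]
  rw [e, mul_mul_mul_comm, ENNReal.div_mul_cancel hv0 hvt, ENNReal.div_mul_cancel c0 ct]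

lemma weightMeasure_ne_zero (hm : Measurable ν) (h : ∀ x, 0 < ν x) {E : Set (Rn n)}
    (hE : volume E ≠ 0) : weightMeasure ν E ≠ 0 :=
  fun h0 => hE (absolutelyContinuous_weightMeasure hm h h0)

lemma volume_cube_ne_zero (a : Rn n) {l : ℝ} (hl : 0 < l) : volume (cube a l) ≠ 0 := by
  rw [volume_cube a hl.le]; exact pow_ne_zero _ (ENNReal.ofReal_pos.2 hl).ne'

lemma volume_cube_ne_top (a : Rn n) {l : ℝ} (hl : 0 < l) : volume (cube a l) ≠ ∞ := by
  rw [volume_cube a hl.le]; exact ENNReal.pow_ne_top ENNReal.ofReal_ne_top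

/-- The `A_q` product is finite and neither factor is zero, so neither is infinite. -/
lemma weight_cube_ne_top (hq : 1 < q) (h : IsStrictAqWeight q ν) (a : Rn n) {l : ℝ} (hl : 0 < l) :
    weightMeasure ν (cube a l) ≠ ∞ ∧ weightMeasure (dualWeight q ν) (cube a l) ≠ ∞ := by
  have hq1 : 0 < q - 1 := by linarith
  have h1 := cube_weight_mul_le hq ν a hl
  have hw := weightMeasure_ne_zero h.measurable h.pos (volume_cube_ne_zero a hl)
  have hs := weightMeasure_ne_zero h.measurable_dual (dualWeight_pos h.pos)
    (volume_cube_ne_zero (n := n) a hl)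
  have ht : aqChar q ν * volume (cube a l) ^ q ≠ ∞ :=
    ENNReal.mul_ne_top h.char_lt_top.ne
      (ENNReal.rpow_ne_top_of_nonneg (by linarith) (volume_cube_ne_top a hl))
  have hp := ne_top_of_le_ne_top ht h1
  constructor
  · intro h2
    rw [h2, ENNReal.top_mul] at hp
    · exact hp rfl
    · exact fun h3 => hs ((ENNReal.rpow_eq_zero_iff_of_pos hq1).1 h3)
  · intro h2
    rw [h2, ENNReal.top_rpow_of_pos hq1, ENNReal.mul_top hw] at hp
    exact hp rfl

/-- Hölder's inequality on the unit cube. It permits enlarging exponents of the characteristic. -/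
lemma one_le_aqChar (hqp : q.HolderConjugate p) (h : IsStrictAqWeight q ν) : 1 ≤ aqChar q ν := by
  have h1 := (volume_rpow_le hqp h (measurableSet_cube (0 : Rn n) 1)).trans
    (cube_weight_mul_le hqp.lt ν 0 one_pos)
  rw [volume_cube _ zero_le_one] at h1
  simpa using h1

end NTMax
end

/-! ### Absolute convergence of the integral defining `S^* f` -/

noncomputable section
namespace NTMax

variable {n : ℕ} {p q : ℝ} {ν : Rn n → ℝ}

/-- The cube `[-2^i, 2^i)ⁿ`. -/
def bigCube (n i : ℕ) : Set (Rn n) := cube (WithLp.toLp 2 fun _ => -(2 : ℝ) ^ i) (2 * 2 ^ i)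

lemma mem_bigCube {i : ℕ} {y : Rn n} :
    y ∈ bigCube n i ↔ ∀ j, -(2 : ℝ) ^ i ≤ y j ∧ y j < 2 ^ i := by
  simp only [bigCube, cube, Set.mem_ofPred_eq, Set.mem_Ico]
  refine forall_congr' fun j => ?_
  have : -(2 : ℝ) ^ i + 2 * 2 ^ i = 2 ^ i := by ring
  rw [this]

lemma measurableSet_bigCube (i : ℕ) : MeasurableSet (bigCube n i) := measurableSet_cube _ _

lemma volume_bigCube (i : ℕ) : volume (bigCube n i) = (2 * 2 ^ i) ^ n := by
  rw [bigCube, volume_cube _ (by positivity), ENNReal.ofReal_mul (by norm_num),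
    ENNReal.ofReal_pow (by norm_num)]
  simp

lemma bigCube_mono {i j : ℕ} (h : i ≤ j) : bigCube n i ⊆ bigCube n j := by
  intro y hy
  rw [mem_bigCube] at hy ⊢
  have : (2 : ℝ) ^ i ≤ 2 ^ j := pow_le_pow_right₀ (by norm_num) h
  exact fun l => ⟨by linarith [(hy l).1], by linarith [(hy l).2]⟩

lemma le_norm_of_notMem_bigCube {i : ℕ} {y : Rn n} (h : y ∉ bigCube n i) : (2 : ℝ) ^ i ≤ ‖y‖ := by
  by_contra hlt
  push Not at hlt
  refine h (mem_bigCube.2 fun j => ?_)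
  have h1 := abs_coord_le y j
  have := abs_lt.1 (lt_of_le_of_lt h1 hlt)
  exact ⟨this.1.le, this.2⟩

lemma exists_mem_bigCube (y : Rn n) : ∃ i, y ∈ bigCube n i := by
  obtain ⟨i, hi⟩ := pow_unbounded_of_one_lt ‖y‖ (by norm_num : (1 : ℝ) < 2)
  exact ⟨i, by_contra fun h => absurd (le_norm_of_notMem_bigCube h) (not_le.2 hi)⟩

lemma volume_bigCube_succ_le (hn : 1 ≤ n) (i : ℕ) :
    volume (bigCube n (i + 1)) ≤ 2 * volume (bigCube n (i + 1) \ bigCube n i) := by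
  have ht : volume (bigCube n i) ≠ ∞ := by
    rw [volume_bigCube]
    exact ENNReal.pow_ne_top (ENNReal.mul_ne_top (by simp) (ENNReal.pow_ne_top (by simp)))
  have h2 : 2 * volume (bigCube n i) ≤ volume (bigCube n (i + 1)) := by
    rw [volume_bigCube, volume_bigCube, pow_succ (2 : ℝ≥0∞) i,
      show (2 : ℝ≥0∞) * (2 ^ i * 2) = 2 * (2 * 2 ^ i) by ring, mul_pow 2 (2 * 2 ^ i : ℝ≥0∞)]
    gcongr
    exact le_self_pow (by norm_num) (by omega)
  rw [measure_sdiff (bigCube_mono (Nat.le_succ i)) (measurableSet_bigCube i).nullMeasurableSet ht,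
    ENNReal.mul_sub (fun _ _ => by simp)]
  refine ENNReal.le_sub_of_add_le_right (ENNReal.mul_ne_top (by simp) ht) ?_
  rw [two_mul (volume (bigCube n (i + 1)))]
  gcongr

/-- The `A_q` condition on the larger cube and Hölder's inequality on the shell, which has at least
half of its volume, show that the shell carries a fixed fraction of the weight. -/
lemma bigCube_weight_growth (hn : 1 ≤ n) (hqp : q.HolderConjugate p) (h : IsStrictAqWeight q ν)
    (i : ℕ) :
    weightMeasure ν (bigCube n i) * (1 + (2 ^ q * aqChar q ν)⁻¹) ≤
      weightMeasure ν (bigCube n (i + 1)) := by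
  set w := weightMeasure ν
  set σ := weightMeasure (dualWeight q ν)
  set B := bigCube n i
  set B' := bigCube n (i + 1) with hB'
  have hl : (0 : ℝ) < 2 * 2 ^ (i + 1) := by positivity
  have hB'm : MeasurableSet B' := measurableSet_bigCube _
  have hBm : MeasurableSet B := measurableSet_bigCube _
  have hsub : B ⊆ B' := bigCube_mono (Nat.le_succ i)
  have hV0 : volume B' ≠ 0 := volume_cube_ne_zero _ hl
  have hVt : volume B' ≠ ∞ := volume_cube_ne_top _ hl
  have hσt : σ B' ≠ ∞ := (weight_cube_ne_top hqp.lt h _ hl).2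
  have hσ0 : σ B' ≠ 0 := weightMeasure_ne_zero h.measurable_dual (dualWeight_pos h.pos) hV0
  have hq1 : 0 ≤ q - 1 := hqp.sub_one_pos.le
  set s := σ B' ^ (q - 1) with hs
  have hs0 : s ≠ 0 := (ENNReal.rpow_pos (pos_iff_ne_zero.2 hσ0) hσt).ne'
  have hst : s ≠ ∞ := ENNReal.rpow_ne_top_of_nonneg hq1 hσt
  have hc0 : 2 ^ q * aqChar q ν ≠ 0 :=
    mul_ne_zero (ENNReal.rpow_pos (by simp) (by simp)).ne'
      (lt_of_lt_of_le one_pos (one_le_aqChar hqp h)).ne'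
  have hct : 2 ^ q * aqChar q ν ≠ ∞ :=
    ENNReal.mul_ne_top (ENNReal.rpow_ne_top_of_nonneg hqp.nonneg (by simp)) h.char_lt_top.ne
  have h1 : w B' ≤ 2 ^ q * aqChar q ν * w (B' \ B) := by
    have h2 := cube_weight_mul_le hqp.lt ν (WithLp.toLp 2 fun _ => -(2 : ℝ) ^ (i + 1)) hl
    have h3 : volume B' ^ q ≤ 2 ^ q * (w (B' \ B) * s) := by
      calc volume B' ^ q ≤ (2 * volume (B' \ B)) ^ q :=
            ENNReal.rpow_le_rpow (volume_bigCube_succ_le hn i) hqp.nonneg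
        _ = 2 ^ q * volume (B' \ B) ^ q := ENNReal.mul_rpow_of_nonneg _ _ hqp.nonneg
        _ ≤ 2 ^ q * (w (B' \ B) * σ (B' \ B) ^ (q - 1)) := by
            gcongr
            exact volume_rpow_le hqp h (hB'm.diff hBm)
        _ ≤ _ := by
            gcongr
            exact ENNReal.rpow_le_rpow (measure_mono Set.sdiff_subset) hq1
    have h4 : w B' * s ≤ 2 ^ q * aqChar q ν * w (B' \ B) * s := by
      calc w B' * s ≤ aqChar q ν * volume B' ^ q := h2
        _ ≤ aqChar q ν * (2 ^ q * (w (B' \ B) * s)) := by gcongr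
        _ = _ := by ring
    exact (ENNReal.mul_le_mul_iff_left hs0 hst).1 h4
  calc w B * (1 + (2 ^ q * aqChar q ν)⁻¹)
      = w B + (2 ^ q * aqChar q ν)⁻¹ * w B := by ring
    _ ≤ w B + (2 ^ q * aqChar q ν)⁻¹ * (2 ^ q * aqChar q ν * w (B' \ B)) := by
        gcongr
        exact (measure_mono hsub).trans h1
    _ = w B + w (B' \ B) := by
        rw [← mul_assoc, ENNReal.inv_mul_cancel hc0 hct, one_mul]
    _ = w B' := by
        rw [← measure_inter_add_sdiff B' hBm, Set.inter_eq_self_of_subset_right hsub]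

lemma tsum_bigCube_weight_lt_top (hn : 1 ≤ n) (hqp : q.HolderConjugate p)
    (h : IsStrictAqWeight q ν) :
    ∑' i, (weightMeasure ν (bigCube n i))⁻¹ ^ (1 / q) < ∞ := by
  set w := weightMeasure ν
  set θ : ℝ≥0∞ := 1 + (2 ^ q * aqChar q ν)⁻¹ with hθ
  have hct : 2 ^ q * aqChar q ν ≠ ∞ :=
    ENNReal.mul_ne_top (ENNReal.rpow_ne_top_of_nonneg hqp.nonneg (by simp)) h.char_lt_top.ne
  have hq0 : 0 < 1 / q := by have := hqp.pos; positivity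
  have hθ1 : 1 < θ :=
    ENNReal.lt_add_right (by simp) (ENNReal.inv_ne_zero.2 hct)
  have hgrow : ∀ i, w (bigCube n 0) * θ ^ i ≤ w (bigCube n i) := by
    intro i
    induction i with
    | zero => simp
    | succ i ih =>
      rw [pow_succ, ← mul_assoc]
      exact (mul_le_mul_left ih θ).trans (bigCube_weight_growth hn hqp h i)
  have hw0 : w (bigCube n 0) ≠ 0 :=
    weightMeasure_ne_zero h.measurable h.pos (volume_cube_ne_zero _ (by positivity))
  have hwt : w (bigCube n 0) ≠ ∞ := (weight_cube_ne_top hqp.lt h _ (by positivity)).1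
  have hterm : ∀ i, (w (bigCube n i))⁻¹ ^ (1 / q) ≤
      (w (bigCube n 0))⁻¹ ^ (1 / q) * (θ⁻¹ ^ (1 / q)) ^ i := by
    intro i
    have h1 : (w (bigCube n i))⁻¹ ≤ (w (bigCube n 0))⁻¹ * θ⁻¹ ^ i := by
      rw [← ENNReal.inv_pow, ← ENNReal.mul_inv (Or.inl hw0) (Or.inl hwt)]
      exact ENNReal.inv_le_inv.2 (hgrow i)
    refine (ENNReal.rpow_le_rpow h1 hq0.le).trans (le_of_eq ?_)
    rw [ENNReal.mul_rpow_of_nonneg _ _ hq0.le, ← ENNReal.rpow_natCast, ← ENNReal.rpow_natCast,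
      ← ENNReal.rpow_mul, ← ENNReal.rpow_mul, mul_comm (i : ℝ)]
  refine (ENNReal.tsum_le_tsum hterm).trans_lt ?_
  rw [ENNReal.tsum_mul_left, ENNReal.tsum_geometric]
  refine ENNReal.mul_lt_top ?_ ?_
  · exact (ENNReal.rpow_ne_top_of_nonneg hq0.le (ENNReal.inv_ne_top.2 hw0)).lt_top
  · rw [ENNReal.inv_lt_top]
    refine tsub_pos_of_lt ?_
    exact ENNReal.rpow_lt_one (ENNReal.inv_lt_one.2 hθ1) hq0

/-- For fixed `(t, x)` the kernel is bounded near the origin and decays like `|y| ^ (-n)`, the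
reciprocal volume, up to a constant, of the least `bigCube` containing `y`. -/
lemma RegKernel.enorm_le_tsum {k : ℝ → Rn n → Rn n → ℝ} {δ C : ℝ} (hk : RegKernel k δ C)
    {t : ℝ} (ht : 0 < t) (x : Rn n) : ∃ A : ℝ≥0, ∀ y,
      ‖k t x y‖ₑ ≤ A * ∑' i, (bigCube n i).indicator (fun _ => (volume (bigCube n i))⁻¹) y := by
  set A₁ : ℝ := C * (t ^ n)⁻¹ * 2 ^ n with hA₁
  set A₂ : ℝ := C * (4 * (1 + ‖x‖ / t)) ^ n with hA₂
  have hC := hk.nonneg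
  have h1 : 0 ≤ A₁ := by positivity
  have h2 : 0 ≤ A₂ := by positivity
  have hvol : ∀ i : ℕ, (volume (bigCube n i))⁻¹ = ENNReal.ofReal (((2 * 2 ^ i) ^ n)⁻¹) := by
    intro i
    rw [ENNReal.ofReal_inv_of_pos (by positivity), bigCube, volume_cube _ (by positivity),
      ENNReal.ofReal_pow (by positivity)]
  refine ⟨(A₁ + A₂).toNNReal, fun y => ?_⟩
  suffices H : ∃ i, y ∈ bigCube n i ∧ |k t x y| ≤ (A₁ + A₂) * ((2 * 2 ^ i) ^ n)⁻¹ by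
    obtain ⟨i, hi, hle⟩ := H
    calc ‖k t x y‖ₑ = ENNReal.ofReal |k t x y| := by rw [← Real.norm_eq_abs, ofReal_norm]
      _ ≤ ENNReal.ofReal ((A₁ + A₂) * ((2 * 2 ^ i) ^ n)⁻¹) := ENNReal.ofReal_le_ofReal hle
      _ = (A₁ + A₂).toNNReal * (bigCube n i).indicator (fun _ => (volume (bigCube n i))⁻¹) y := by
          rw [ENNReal.ofReal_mul (by positivity), Set.indicator_of_mem hi, hvol]
          rfl
      _ ≤ _ := by
          gcongr
          exact ENNReal.le_tsum i
  classical
  -- Minimality gives `|y| ≥ 2 ^ (i - 1)` when `i > 0`; for `i = 0` the bound by the height alone is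
  -- used.
  set i := Nat.find (exists_mem_bigCube y) with hi
  have hmem : y ∈ bigCube n i := Nat.find_spec (exists_mem_bigCube y)
  refine ⟨i, hmem, ?_⟩
  rcases Nat.eq_zero_or_pos i with h0 | h0
  · rw [h0]
    refine (hk.abs_le ht x y).trans ?_
    have : A₁ * ((2 * 2 ^ 0) ^ n)⁻¹ = C * (t ^ n)⁻¹ := by
      rw [hA₁]; simp [mul_assoc]
    rw [← this]
    gcongr
    linarith
  · obtain ⟨j, hj⟩ : ∃ j, i = j + 1 := ⟨i - 1, by omega⟩
    have hnot : y ∉ bigCube n j := Nat.find_min (exists_mem_bigCube y) (by omega)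
    have hy := le_norm_of_notMem_bigCube hnot
    have ht' : t ≤ enorm2 t (x - y) := by
      rw [enorm2]
      exact Real.le_sqrt_of_sq_le (by nlinarith [sq_nonneg ‖x - y‖])
    have hx' : ‖x - y‖ ≤ enorm2 t (x - y) := by
      rw [enorm2]
      exact Real.le_sqrt_of_sq_le (by nlinarith [sq_nonneg t])
    have h3 : (2 : ℝ) ^ j ≤ (1 + ‖x‖ / t) * enorm2 t (x - y) := by
      have h4 : ‖y‖ ≤ ‖x‖ + ‖x - y‖ := by
        have := norm_sub_le x (x - y)
        rwa [sub_sub_cancel] at this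
      have h5 : ‖x‖ ≤ ‖x‖ / t * enorm2 t (x - y) := by
        rw [div_mul_eq_mul_div, le_div_iff₀ ht]
        gcongr
      nlinarith
    have he : 0 < enorm2 t (x - y) := lt_of_lt_of_le ht ht'
    refine (hk.size t x y ht).trans ?_
    have h6 : (enorm2 t (x - y) ^ n)⁻¹ ≤ (4 * (1 + ‖x‖ / t)) ^ n * ((2 * 2 ^ i) ^ n)⁻¹ := by
      rw [← div_eq_mul_inv, inv_eq_one_div, div_le_div_iff₀ (by positivity) (by positivity),
        one_mul, ← mul_pow]
      refine pow_le_pow_left₀ (by positivity) ?_ n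
      rw [hj, pow_succ]
      nlinarith
    calc C * (enorm2 t (x - y) ^ n)⁻¹ ≤ C * ((4 * (1 + ‖x‖ / t)) ^ n * ((2 * 2 ^ i) ^ n)⁻¹) := by
          gcongr
      _ = A₂ * ((2 * 2 ^ i) ^ n)⁻¹ := by rw [hA₂]; ring
      _ ≤ _ := by gcongr; linarith

/-- Hölder's inequality against `ν`, after which the `A_q` condition trades the dual measure of the
cube for its `ν`-measure. The remaining factor is summable by `tsum_bigCube_weight_lt_top`. -/
lemma avg_bigCube_le (hqp : q.HolderConjugate p) (h : IsStrictAqWeight q ν)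
    {f : Rn n → ℝ} (hf : Measurable f) (i : ℕ) :
    (volume (bigCube n i))⁻¹ * ∫⁻ y in bigCube n i, ‖f y‖ₑ ≤
      (∫⁻ x, ‖f x‖ₑ ^ q ∂(weightMeasure ν)) ^ (1 / q) * aqChar q ν ^ (1 / q) *
        (weightMeasure ν (bigCube n i))⁻¹ ^ (1 / q) := by
  have hl : (0 : ℝ) < 2 * 2 ^ i := by positivity
  have hq0 := hqp.pos
  have hq' : 0 ≤ 1 / q := by positivity
  set B := bigCube n i with hB
  set w := weightMeasure ν
  set σ := weightMeasure (dualWeight q ν)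
  have hV0 : volume B ≠ 0 := volume_cube_ne_zero _ hl
  have hVt : volume B ≠ ∞ := volume_cube_ne_top _ hl
  have hw0 : w B ≠ 0 := weightMeasure_ne_zero h.measurable h.pos hV0
  have hwt : w B ≠ ∞ := (weight_cube_ne_top hqp.lt h _ hl).1
  have h1 := setLIntegral_enorm_le hqp h hf (measurableSet_bigCube (n := n) i)
  have h2 : σ B ^ (1 / p) ≤ aqChar q ν ^ (1 / q) * volume B * (w B)⁻¹ ^ (1 / q) := by
    have h3 := cube_weight_mul_le hqp.lt ν (WithLp.toLp 2 fun _ => -(2 : ℝ) ^ i) hl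
    have h4 : σ B ^ (q - 1) ≤ aqChar q ν * volume B ^ q * (w B)⁻¹ := by
      calc σ B ^ (q - 1) = w B * σ B ^ (q - 1) * (w B)⁻¹ := by
            rw [mul_right_comm, ENNReal.mul_inv_cancel hw0 hwt, one_mul]
        _ ≤ _ := mul_le_mul_left h3 _
    have h5 := ENNReal.rpow_le_rpow h4 hq'
    rw [ENNReal.mul_rpow_of_nonneg _ _ hq', ENNReal.mul_rpow_of_nonneg _ _ hq',
      ← ENNReal.rpow_mul, ← ENNReal.rpow_mul, mul_one_div_cancel hq0.ne', ENNReal.rpow_one] at h5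
    convert h5 using 2
    have := hqp.sub_one_mul_conj
    have := hqp.symm.ne_zero
    field_simp
    linarith
  calc (volume B)⁻¹ * ∫⁻ y in B, ‖f y‖ₑ
      ≤ (volume B)⁻¹ * ((∫⁻ x, ‖f x‖ₑ ^ q ∂w) ^ (1 / q) *
        (aqChar q ν ^ (1 / q) * volume B * (w B)⁻¹ ^ (1 / q))) := by
        gcongr
        refine h1.trans ?_
        gcongr
        exact Measure.restrict_le_self
    _ = (volume B)⁻¹ * volume B * ((∫⁻ x, ‖f x‖ₑ ^ q ∂w) ^ (1 / q) *
        aqChar q ν ^ (1 / q) * (w B)⁻¹ ^ (1 / q)) := by ring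
    _ = _ := by rw [ENNReal.inv_mul_cancel hV0 hVt, one_mul]

lemma RegKernel.integrable_mul_of_memLp {k : ℝ → Rn n → Rn n → ℝ} {δ C : ℝ}
    (hk : RegKernel k δ C) (hn : 1 ≤ n) (hqp : q.HolderConjugate p) (h : IsStrictAqWeight q ν)
    {f : Rn n → ℝ} (hf : Measurable f) (hfi : ∫⁻ x, ‖f x‖ₑ ^ q ∂(weightMeasure ν) ≠ ∞)
    {t : ℝ} (ht : 0 < t) (x : Rn n) : Integrable (fun y => k t x y * f y) volume := by
  refine ⟨((hk.continuous ht x).measurable.mul hf).aestronglyMeasurable, ?_⟩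
  obtain ⟨A, hA⟩ := hk.enorm_le_tsum ht x
  have hq' : 0 ≤ 1 / q := by have := hqp.pos; positivity
  have hm : ∀ i, Measurable (fun y =>
      (bigCube n i).indicator (fun _ => (volume (bigCube n i))⁻¹) y * ‖f y‖ₑ) := fun i =>
    (measurable_const.indicator (measurableSet_bigCube i)).mul hf.enorm
  have h1 : ∫⁻ y, ‖k t x y * f y‖ₑ ≤
      A * ∑' i, (volume (bigCube n i))⁻¹ * ∫⁻ y in bigCube n i, ‖f y‖ₑ := by
    calc ∫⁻ y, ‖k t x y * f y‖ₑ ≤ ∫⁻ y, A * ∑' i,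
          (bigCube n i).indicator (fun _ => (volume (bigCube n i))⁻¹) y * ‖f y‖ₑ := by
          refine lintegral_mono fun y => ?_
          rw [enorm_mul, ENNReal.tsum_mul_right, ← mul_assoc]
          gcongr
          exact hA y
      _ = A * ∑' i, ∫⁻ y,
          (bigCube n i).indicator (fun _ => (volume (bigCube n i))⁻¹) y * ‖f y‖ₑ := by
          rw [lintegral_const_mul _ (Measurable.tsum hm),
            lintegral_tsum fun i => (hm i).aemeasurable]
      _ = _ := by
          congr 2
          funext i
          rw [← lintegral_const_mul _ hf.enorm, ← lintegral_indicator (measurableSet_bigCube i)]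
          refine lintegral_congr fun y => ?_
          by_cases hy : y ∈ bigCube n i <;> simp [hy]
  refine h1.trans_lt (ENNReal.mul_lt_top ENNReal.coe_lt_top ?_)
  refine (ENNReal.tsum_le_tsum fun i => avg_bigCube_le hqp h hf i).trans_lt ?_
  rw [ENNReal.tsum_mul_left]
  refine ENNReal.mul_lt_top (ENNReal.mul_lt_top ?_ ?_) (tsum_bigCube_weight_lt_top hn hqp h)
  · exact (ENNReal.rpow_ne_top_of_nonneg hq' hfi).lt_top
  · exact (ENNReal.rpow_ne_top_of_nonneg hq' h.char_lt_top.ne).lt_top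

end NTMax
end

/-! ### From sparse domination to the weighted estimate -/

noncomputable section
namespace NTMax

variable {n : ℕ} {p q : ℝ} {ν : Rn n → ℝ}

lemma tri_weight (h : IsStrictAqWeight q ν) (hq : 1 < q) (k : ℤ) (m : Fin n → ℤ) :
    (weightMeasure ν (tri k m) ≠ 0 ∧ weightMeasure ν (tri k m) ≠ ∞) ∧
    (weightMeasure (dualWeight q ν) (tri k m) ≠ 0 ∧
      weightMeasure (dualWeight q ν) (tri k m) ≠ ∞) ∧
    weightMeasure ν (tri k m) * weightMeasure (dualWeight q ν) (tri k m) ^ (q - 1) ≤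
      aqChar q ν * volume (tri k m) ^ q := by
  have hl : 0 < 3 * len k := by have := len_pos k; positivity
  rw [tri_eq_cube]
  exact ⟨⟨weightMeasure_ne_zero h.measurable h.pos (volume_cube_ne_zero _ hl),
    (weight_cube_ne_top hq h _ hl).1⟩,
    ⟨weightMeasure_ne_zero h.measurable_dual (dualWeight_pos h.pos) (volume_cube_ne_zero _ hl),
    (weight_cube_ne_top hq h _ hl).2⟩, cube_weight_mul_le hq ν _ hl⟩

instance (ν : Rn n → ℝ) : SFinite (weightMeasure ν) := by
  unfold weightMeasure; infer_instance

lemma tsum_eq_sum_tsum_fiber {ι κ : Type*} [Fintype κ] (cl : ι → κ) (g : ι → ℝ≥0∞) :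
    ∑' i, g i = ∑ c, ∑' i : {i // cl i = c}, g i := by
  rw [← (Equiv.sigmaFiberEquiv cl).tsum_eq, ENNReal.tsum_sigma', tsum_fintype]
  rfl

/-- The weighted bound for a sparse operator over tripled dyadic cubes. -/
lemma lintegral_sparse_tri_le (hqp : q.HolderConjugate p) (h : IsStrictAqWeight q ν)
    {f : Rn n → ℝ} (hf : Measurable f) (hfi : Integrable f volume) {ι : Type*} [Countable ι]
    (Q : ι → ℤ × (Fin n → ℤ)) (F : ι → Set (Rn n)) (hFm : ∀ i, MeasurableSet (F i))
    (hF : ∀ i, F i ⊆ dy (Q i).1 (Q i).2) (hFv : ∀ i, dvol n (Q i).1 ≤ 2 * volume (F i))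
    (hFd : Pairwise (Function.onFun Disjoint F)) :
    ∫⁻ z, (∑' i, (dy (Q i).1 (Q i).2).indicator (fun _ => triAvg f (Q i)) z) ^ q
        ∂(weightMeasure ν) ≤
      (Fintype.card (Fin n → ZMod 3) : ℝ≥0∞) ^ q *
        (3 ^ n * ((sparseConst (2 * 3 ^ n) q p + sparseConst (2 * 3 ^ n) p q) *
          aqChar q ν ^ max 1 (1 / (q - 1)))) ^ q * ∫⁻ x, ‖f x‖ₑ ^ q ∂(weightMeasure ν) := by
  set w := weightMeasure ν
  set σ := weightMeasure (dualWeight q ν)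
  set T : ι → Set (Rn n) := fun i => tri (Q i).1 (Q i).2 with hT
  set cl : ι → Fin n → ZMod 3 := fun i => triClass (Q i).1 (Q i).2 with hcl
  set a : ι → ℝ≥0∞ := fun i => (volume (T i))⁻¹ * ∫⁻ y in T i, dualDensity q ν f y ∂σ with ha
  have hTm : ∀ i, MeasurableSet (T i) := fun i => measurableSet_tri _ _
  have hq0 := hqp.pos
  have h3 : (3 : ℝ≥0∞) ^ n ≠ 0 := pow_ne_zero _ (by norm_num)
  have h3t : (3 : ℝ≥0∞) ^ n ≠ ∞ := ENNReal.pow_ne_top (by simp)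
  have hInt : ∀ i, ∫⁻ y in T i, dualDensity q ν f y ∂σ = ∫⁻ y in T i, ‖f y‖ₑ := fun i =>
    lintegral_dualDensity h hf (hTm i)
  have havg : ∀ i, triAvg f (Q i) = 3 ^ n * a i := by
    intro i
    simp only [ha, triAvg, hInt]
    simp only [hT]
    rw [volume_tri, ENNReal.mul_inv (Or.inl h3) (Or.inl h3t), ← mul_assoc, ← mul_assoc,
      ENNReal.mul_inv_cancel h3 h3t, one_mul]
  -- The sum is split by residue class, and each `dy` is enlarged to `tri`, since only the tripled
  -- cubes of one class carry both the averages and the nesting.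
  set H : (Fin n → ZMod 3) → Rn n → ℝ≥0∞ := fun c z =>
    ∑' i : {i // cl i = c}, (T i).indicator (fun _ => a i) z with hH
  have hHm : ∀ c, Measurable (H c) := fun c =>
    Measurable.tsum fun i => measurable_const.indicator (hTm i)
  have hpt : ∀ z, ∑' i, (dy (Q i).1 (Q i).2).indicator (fun _ => triAvg f (Q i)) z ≤
      3 ^ n * ∑ c, H c z := by
    intro z
    rw [hH, ← tsum_eq_sum_tsum_fiber cl (fun i => (T i).indicator (fun _ => a i) z),
      ← ENNReal.tsum_mul_left]
    refine ENNReal.tsum_le_tsum fun i => ?_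
    rw [havg]
    by_cases hz : z ∈ dy (Q i).1 (Q i).2
    · rw [Set.indicator_of_mem hz, Set.indicator_of_mem (dy_subset_tri _ _ hz)]
    · rw [Set.indicator_of_notMem hz]; exact zero_le
  have hclass : ∀ c, ∫⁻ z, H c z ^ q ∂w ≤
      ((sparseConst (2 * 3 ^ n) q p + sparseConst (2 * 3 ^ n) p q) *
          aqChar q ν ^ max 1 (1 / (q - 1))) ^ q * ∫⁻ x, ‖f x‖ₑ ^ q ∂w := by
    intro c
    -- The constant `2 * 3 ^ n` combines `|tri| = 3 ^ n |dy|` with `|dy| ≤ 2 |F i|`.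
    have hS : SparseFamily volume w σ (fun i : {i // cl i = c} => T i)
        (fun i : {i // cl i = c} => F i) (2 * 3 ^ n) q p :=
      { mT := fun i => hTm i
        mF := fun i => hFm i
        sub := fun i => (hF i).trans (dy_subset_tri _ _)
        disj := fun i j hij => hFd fun h => hij (Subtype.ext h)
        nested := fun i j hne => tri_nested (i.2.trans j.2.symm) hne
        μ0 := fun i => by
          simp only [hT]; rw [volume_tri]; exact mul_ne_zero h3 (dvol_ne_zero _)
        μt := fun i => by
          simp only [hT]; rw [volume_tri]; exact ENNReal.mul_ne_top h3t (dvol_ne_top _)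
        w0 := fun i => (tri_weight h hqp.lt _ _).1.1
        wt := fun i => (tri_weight h hqp.lt _ _).1.2
        σ0 := fun i => (tri_weight h hqp.lt _ _).2.1.1
        σt := fun i => (tri_weight h hqp.lt _ _).2.1.2
        le := fun i => by
          simp only [hT]
          rw [volume_tri]
          calc 3 ^ n * dvol n (Q i).1 ≤ 3 ^ n * (2 * volume (F i)) := by gcongr; exact hFv i
            _ = _ := by push_cast; ring
        holder := fun i => volume_le_weightMeasure hqp h (hFm i) }
    have := hS.lintegral_tsum_rpow_le hqp h.char_lt_top.ne (one_le_aqChar hqp h)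
      (fun i => (tri_weight h hqp.lt _ _).2.2) (measurable_dualDensity h.measurable hf)
      (fun i => by
        rw [hInt]
        exact ((setLIntegral_le_lintegral _ _).trans_lt hfi.2).ne)
    rwa [lintegral_dualDensity_rpow hqp.lt h hf] at this
  set N : ℝ≥0∞ := (Fintype.card (Fin n → ZMod 3) : ℝ≥0∞) with hN
  set B := (sparseConst (2 * 3 ^ n) q p + sparseConst (2 * 3 ^ n) p q) *
          aqChar q ν ^ max 1 (1 / (q - 1)) with hB
  have hN0 : N ≠ 0 := by simp [hN]
  calc _ ≤ ∫⁻ z, (3 ^ n : ℝ≥0∞) ^ q * (N ^ (q - 1) * ∑ c, H c z ^ q) ∂w := by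
        refine lintegral_mono fun z => ?_
        refine (ENNReal.rpow_le_rpow (hpt z) hq0.le).trans ?_
        rw [ENNReal.mul_rpow_of_nonneg _ _ hq0.le]
        gcongr
        exact ENNReal.rpow_sum_le_const_mul_sum_rpow Finset.univ _ hqp.lt.le
    _ = (3 ^ n : ℝ≥0∞) ^ q * (N ^ (q - 1) * ∑ c, ∫⁻ z, H c z ^ q ∂w) := by
        rw [lintegral_const_mul _ (by fun_prop), lintegral_const_mul _ (by fun_prop),
          lintegral_finsetSum _ fun c _ => (hHm c).pow_const q]
    _ ≤ (3 ^ n : ℝ≥0∞) ^ q * (N ^ (q - 1) * (N * (B ^ q * ∫⁻ x, ‖f x‖ₑ ^ q ∂w))) := by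
        gcongr
        refine (Finset.sum_le_sum fun c _ => hclass c).trans (le_of_eq ?_)
        rw [Finset.sum_const, nsmul_eq_mul, Finset.card_univ]
    _ = N ^ (q - 1) * N * ((3 ^ n : ℝ≥0∞) ^ q * B ^ q) * ∫⁻ x, ‖f x‖ₑ ^ q ∂w := by ring
    _ = _ := by
        rw [← ENNReal.mul_rpow_of_nonneg _ _ hq0.le]
        congr 2
        conv_lhs => rw [← ENNReal.rpow_one N, ← ENNReal.rpow_mul, one_mul,
          ← ENNReal.rpow_add _ _ hN0 (by simp [hN])]
        congr 1; ring

lemma mem_dy_neg_of_mem_bigCube {j : ℕ} {y : Rn n} (hy : y ∈ bigCube n j) (i : Fin n) :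
    -1 ≤ idx (-(j : ℤ)) y i ∧ idx (-(j : ℤ)) y i ≤ 0 := by
  have h := mem_bigCube.1 hy i
  have h2 : (0 : ℝ) < 2 ^ j := by positivity
  simp only [idx, zpow_neg, zpow_natCast]
  constructor
  · rw [Int.le_floor]
    push_cast
    rw [inv_mul_eq_div, le_div_iff₀ h2]
    linarith [h.1]
  · rw [← Int.lt_add_one_iff, Int.floor_lt]
    push_cast
    rw [inv_mul_eq_div, div_lt_iff₀ h2]
    linarith [h.2]

lemma bigCube_subset_iUnion_dy (j : ℕ) :
    bigCube n j ⊆ ⋃ b : Fin n → Fin 2, dy (-(j : ℤ)) (fun i => -((b i : ℕ) : ℤ)) := by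
  intro y hy
  have h := mem_dy_neg_of_mem_bigCube hy
  refine Set.mem_iUnion.2 ⟨fun i => ⟨(-idx (-(j : ℤ)) y i).toNat, ?_⟩, ?_⟩
  · have := h i; omega
  · have h1 : (fun i => -(((-idx (-(j : ℤ)) y i).toNat : ℕ) : ℤ)) = idx (-(j : ℤ)) y := by
      funext i
      have := h i; omega
    simp only [h1]
    exact mem_dy_idx _ _

/-- A single dyadic cube may fail to contain a neighbourhood of the origin, but the triple of each
of the `2 ^ n` dyadic cubes that cover `bigCube n j` contains all of it. Hence localising to that
triple does not change a function supported there. -/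
lemma bigCube_subset_tri (j : ℕ) (b : Fin n → Fin 2) :
    bigCube n j ⊆ tri (-(j : ℤ)) (fun i => -((b i : ℕ) : ℤ)) := by
  intro y hy i
  have := mem_dy_neg_of_mem_bigCube hy i
  have := (b i).2
  constructor <;> dsimp only <;> omega

/-- The weighted estimate for integrable functions with bounded support. -/
lemma RegKernel.exists_lintegral_coneSup_le {k : ℝ → Rn n → Rn n → ℝ} {δ C : ℝ}
    (hk : RegKernel k δ C) (hn : 1 ≤ n) {α β : ℝ} (hα : 0 < α) (hβ : 0 < β)
    (hL : L2NontangentialEstimate k α) (hqp : q.HolderConjugate p) :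
    ∃ M : ℝ≥0, ∀ (ν f : Rn n → ℝ) (i : ℕ), IsStrictAqWeight q ν → Measurable f →
      Integrable f volume → (∀ y, y ∉ bigCube n i → f y = 0) →
      ∫⁻ z, coneSup β (Sstar k f) z ^ q ∂(weightMeasure ν) ≤
        (M * aqChar q ν ^ max 1 (1 / (q - 1))) ^ q * ∫⁻ x, ‖f x‖ₑ ^ q ∂(weightMeasure ν) := by
  obtain ⟨K, hK⟩ := hk.exists_sparse hn hα hβ hL
  have hq0 := hqp.pos
  set N : ℝ≥0∞ := (Fintype.card (Fin n → ZMod 3) : ℝ≥0∞) with hN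
  set S := sparseConst (2 * 3 ^ n) q p + sparseConst (2 * 3 ^ n) p q with hS
  have hSt : S ≠ ∞ := ENNReal.add_ne_top.2
    ⟨sparseConst_ne_top _ hqp.lt hqp.symm.lt, sparseConst_ne_top _ hqp.symm.lt hqp.lt⟩
  -- The factor `(2 ^ n) ^ (1 / q)` accounts for the `2 ^ n` dyadic cubes covering a large cube.
  -- Nothing depends on `j`, so the cubes may exhaust the space.
  set M' : ℝ≥0∞ := ((2 : ℝ≥0∞) ^ n) ^ (1 / q) * (K * (N * (3 ^ n * S))) with hM'
  have hM't : M' ≠ ∞ := by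
    refine ENNReal.mul_ne_top (ENNReal.rpow_ne_top_of_nonneg (by positivity)
      (ENNReal.pow_ne_top (by simp))) (ENNReal.mul_ne_top ENNReal.coe_ne_top
      (ENNReal.mul_ne_top (by simp [hN]) (ENNReal.mul_ne_top (ENNReal.pow_ne_top (by simp)) hSt)))
  refine ⟨M'.toNNReal, fun ν f i₀ h hf hfi hsupp => ?_⟩
  rw [ENNReal.coe_toNNReal hM't]
  set w := weightMeasure ν with hw
  set A := aqChar q ν ^ max 1 (1 / (q - 1)) with hA
  set I := ∫⁻ x, ‖f x‖ₑ ^ q ∂w with hI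
  have hloc : ∀ j, i₀ ≤ j → ∀ b : Fin n → Fin 2,
      ∫⁻ z in dy (-(j : ℤ)) (fun i => -((b i : ℕ) : ℤ)), coneSup β (Sstar k f) z ^ q ∂w ≤
        (K * (N * (3 ^ n * (S * A)))) ^ q * I := by
    intro j hj b
    set Q₀ : ℤ × (Fin n → ℤ) := (-(j : ℤ), fun i => -((b i : ℕ) : ℤ)) with hQ₀
    have htp : triPart f Q₀ = f := by
      funext y
      by_cases hy : y ∈ tri Q₀.1 Q₀.2
      · exact Set.indicator_of_mem hy _
      · rw [triPart, Set.indicator_of_notMem hy, hsupp]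
        exact fun hy' => hy (bigCube_subset_tri j b (bigCube_mono hj hy'))
    obtain ⟨G, F, hFm, hFs, hFv, hFd, hae⟩ := hK f Q₀ hf hfi
    rw [htp] at hae
    have hae' : ∀ᵐ z ∂w, z ∈ dy Q₀.1 Q₀.2 → coneSup β (Sstar k f) z ≤
        K * ∑' i : (j : ℕ) × G j, (dy i.2.1.1 i.2.1.2).indicator (fun _ => triAvg f i.2) z :=
      (withDensity_absolutelyContinuous _ _).ae_le hae
    have hsp := lintegral_sparse_tri_le hqp h hf hfi
      (fun i : (j : ℕ) × G j => (i.2 : ℤ × (Fin n → ℤ))) (fun i => F i.2) (fun i => hFm _)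
      (fun i => hFs _) (fun i => hFv _) hFd
    calc _ ≤ ∫⁻ z in dy Q₀.1 Q₀.2, (K * ∑' i : (j : ℕ) × G j,
          (dy i.2.1.1 i.2.1.2).indicator (fun _ => triAvg f i.2) z) ^ q ∂w := by
          refine setLIntegral_mono_ae' (measurableSet_dy _ _) ?_
          filter_upwards [hae'] with z hz hzd
          exact ENNReal.rpow_le_rpow (hz hzd) hq0.le
      _ ≤ ∫⁻ z, (K : ℝ≥0∞) ^ q * (∑' i : (j : ℕ) × G j,
          (dy i.2.1.1 i.2.1.2).indicator (fun _ => triAvg f i.2) z) ^ q ∂w := by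
          refine (setLIntegral_le_lintegral _ _).trans (le_of_eq ?_)
          refine lintegral_congr fun z => ENNReal.mul_rpow_of_nonneg _ _ hq0.le
      _ = (K : ℝ≥0∞) ^ q * ∫⁻ z, (∑' i : (j : ℕ) × G j,
          (dy i.2.1.1 i.2.1.2).indicator (fun _ => triAvg f i.2) z) ^ q ∂w := by
          rw [lintegral_const_mul']
          exact ENNReal.rpow_ne_top_of_nonneg hq0.le ENNReal.coe_ne_top
      _ ≤ (K : ℝ≥0∞) ^ q * (N ^ q * (3 ^ n * (S * A)) ^ q * I) := by
          gcongr
      _ = _ := by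
          rw [ENNReal.mul_rpow_of_nonneg (K : ℝ≥0∞) _ hq0.le,
            ENNReal.mul_rpow_of_nonneg N _ hq0.le]
          ring
  have hbig : ∀ j, i₀ ≤ j → ∫⁻ z in bigCube n j, coneSup β (Sstar k f) z ^ q ∂w ≤
      (M' * A) ^ q * I := by
    intro j hj
    calc _ ≤ ∫⁻ z in ⋃ b : Fin n → Fin 2, dy (-(j : ℤ)) (fun i => -((b i : ℕ) : ℤ)),
          coneSup β (Sstar k f) z ^ q ∂w :=
          lintegral_mono_set (bigCube_subset_iUnion_dy j)
      _ ≤ ∑' b : Fin n → Fin 2, ∫⁻ z in dy (-(j : ℤ)) (fun i => -((b i : ℕ) : ℤ)),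
          coneSup β (Sstar k f) z ^ q ∂w := lintegral_iUnion_le _ _
      _ ≤ ∑' _ : Fin n → Fin 2, (K * (N * (3 ^ n * (S * A)))) ^ q * I :=
          ENNReal.tsum_le_tsum fun b => hloc j hj b
      _ = 2 ^ n * ((K * (N * (3 ^ n * (S * A)))) ^ q * I) := by
          rw [tsum_fintype, Finset.sum_const, nsmul_eq_mul, Finset.card_univ]
          simp
      _ = _ := by
          rw [hM', show ((2 : ℝ≥0∞) ^ n) ^ (1 / q) * (K * (N * (3 ^ n * S))) * A =
            ((2 : ℝ≥0∞) ^ n) ^ (1 / q) * (K * (N * (3 ^ n * (S * A)))) by ring,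
            ENNReal.mul_rpow_of_nonneg (((2 : ℝ≥0∞) ^ n) ^ (1 / q)) _ hq0.le,
            ← ENNReal.rpow_mul, one_div_mul_cancel hq0.ne', ENNReal.rpow_one, mul_assoc]
  have huniv : ⋃ j, bigCube n (i₀ + j) = Set.univ := by
    refine Set.eq_univ_of_forall fun y => ?_
    obtain ⟨i, hi⟩ := exists_mem_bigCube y
    exact Set.mem_iUnion.2 ⟨i, bigCube_mono (by omega) hi⟩
  rw [← setLIntegral_univ, ← huniv, setLIntegral_iUnion_of_directed]
  · exact iSup_le fun j => hbig _ (by omega)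
  · exact Monotone.directed_le fun a b hab => bigCube_mono (by omega)

end NTMax
end

/-! ### Passage to general functions by truncation -/

noncomputable section
namespace NTMax

open Filter

variable {n : ℕ} {p q : ℝ} {ν : Rn n → ℝ}

/-- The truncation of `f` to the points of `[-2^j, 2^j)ⁿ` where `|f| ≤ j`. -/
def truncation (f : Rn n → ℝ) (j : ℕ) : Rn n → ℝ :=
  ({x | |f x| ≤ j} ∩ bigCube n j).indicator f

lemma measurable_truncation {f : Rn n → ℝ} (hf : Measurable f) (j : ℕ) :
    Measurable (truncation f j) :=
  hf.indicator ((measurableSet_le hf.abs measurable_const).inter (measurableSet_bigCube j))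

lemma integrable_truncation {f : Rn n → ℝ} (hf : Measurable f) (j : ℕ) :
    Integrable (truncation f j) volume := by
  have hE : MeasurableSet ({x | |f x| ≤ j} ∩ bigCube n j) :=
    (measurableSet_le hf.abs measurable_const).inter (measurableSet_bigCube j)
  rw [truncation, integrable_indicator_iff hE]
  refine Measure.integrableOn_of_bounded (M := j) ?_ hf.aestronglyMeasurable ?_
  · refine ne_top_of_le_ne_top ?_ (measure_mono Set.inter_subset_right)
    exact volume_cube_ne_top _ (by positivity)
  · filter_upwards [ae_restrict_mem hE] with x hx
    exact hx.1

lemma abs_truncation_le (f : Rn n → ℝ) (j : ℕ) (x : Rn n) : |truncation f j x| ≤ |f x| := by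
  rw [← Real.norm_eq_abs, ← Real.norm_eq_abs]
  exact norm_indicator_le_norm_self f x

lemma truncation_eventually_eq (f : Rn n → ℝ) (x : Rn n) :
    ∀ᶠ j in atTop, truncation f j x = f x := by
  obtain ⟨i, hi⟩ := exists_mem_bigCube x
  obtain ⟨m, hm⟩ := exists_nat_ge |f x|
  filter_upwards [eventually_ge_atTop (max i m)] with j hj
  have hx : x ∈ {x | |f x| ≤ j} ∩ bigCube n j :=
    ⟨hm.trans (Nat.cast_le.2 ((le_max_right _ _).trans hj)),
      bigCube_mono ((le_max_left _ _).trans hj) hi⟩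
  exact Set.indicator_of_mem hx f

lemma tendsto_Sstar_truncation {k : ℝ → Rn n → Rn n → ℝ} {f : Rn n → ℝ}
    (hf : Measurable f) {t : ℝ} {x : Rn n} (hk : Continuous (k t x))
    (hi : Integrable (fun y => k t x y * f y) volume) :
    Tendsto (fun j => Sstar k (truncation f j) t x) atTop (nhds (Sstar k f t x)) := by
  refine tendsto_integral_of_dominated_convergence (fun y => ‖k t x y * f y‖) ?_ hi.norm ?_ ?_
  · exact fun j => (hk.measurable.mul (measurable_truncation hf j)).aestronglyMeasurable
  · refine fun j => Eventually.of_forall fun y => ?_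
    rw [norm_mul, norm_mul]
    gcongr
    exact abs_truncation_le f j y
  · refine Eventually.of_forall fun y => ?_
    refine tendsto_const_nhds.congr' ?_
    filter_upwards [truncation_eventually_eq f y] with j hj
    rw [hj]

lemma coneSup_le_liminf {β : ℝ} {F : ℕ → ℝ → Rn n → ℝ} {G : ℝ → Rn n → ℝ}
    (h : ∀ t x, 0 < t → Tendsto (fun j => F j t x) atTop (nhds (G t x))) (z : Rn n) :
    coneSup β G z ≤ liminf (fun j => coneSup β (F j) z) atTop := by
  refine iSup₂_le fun P hP => ?_
  have h1 : Tendsto (fun j => ‖F j P.1 P.2‖ₑ) atTop (nhds ‖G P.1 P.2‖ₑ) :=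
    (continuous_enorm.tendsto _).comp (h P.1 P.2 hP.1)
  rw [← h1.liminf_eq]
  exact liminf_le_liminf (Eventually.of_forall fun j => le_coneSup (F j) hP.1 hP.2)

/-- Absolute convergence gives pointwise convergence of `S^*` of the truncations, the cone supremum
is lower semicontinuous under it, and Fatou's lemma applies because the bound is uniform in the
truncation. -/
lemma RegKernel.exists_lintegral_coneSup_le_of_memLp {k : ℝ → Rn n → Rn n → ℝ} {δ C : ℝ}
    (hk : RegKernel k δ C) (hn : 1 ≤ n) {α β : ℝ} (hα : 0 < α) (hβ : 0 < β)
    (hL : L2NontangentialEstimate k α) (hqp : q.HolderConjugate p) :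
    ∃ M : ℝ≥0, ∀ (ν f : Rn n → ℝ), IsStrictAqWeight q ν → Measurable f →
      ∫⁻ x, ‖f x‖ₑ ^ q ∂(weightMeasure ν) ≠ ∞ →
      ∫⁻ z, coneSup β (Sstar k f) z ^ q ∂(weightMeasure ν) ≤
        (M * aqChar q ν ^ max 1 (1 / (q - 1))) ^ q * ∫⁻ x, ‖f x‖ₑ ^ q ∂(weightMeasure ν) := by
  obtain ⟨M, hM⟩ := hk.exists_lintegral_coneSup_le hn hα hβ hL hqp
  have hq0 := hqp.pos
  refine ⟨M, fun ν f h hf hfi => ?_⟩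
  have hlim := coneSup_le_liminf (β := β) (F := fun j => Sstar k (truncation f j))
    (G := Sstar k f) fun t x ht => tendsto_Sstar_truncation hf (hk.continuous ht x)
      (hk.integrable_mul_of_memLp hn hqp h hf hfi ht x)
  calc _ ≤ ∫⁻ z, liminf (fun j => coneSup β (Sstar k (truncation f j)) z ^ q) atTop
        ∂(weightMeasure ν) := by
        refine lintegral_mono fun z => ?_
        refine (ENNReal.rpow_le_rpow (hlim z) hq0.le).trans (le_of_eq ?_)
        exact (ENNReal.orderIsoRpow q hq0).liminf_apply
    _ ≤ liminf (fun j => ∫⁻ z, coneSup β (Sstar k (truncation f j)) z ^ q ∂(weightMeasure ν))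
        atTop := lintegral_liminf_le fun j => (measurable_coneSup _ _).pow_const q
    _ ≤ _ := by
        refine liminf_le_of_frequently_le' (Frequently.of_forall fun j => ?_)
        refine (hM ν (truncation f j) j h (measurable_truncation hf j)
          (integrable_truncation hf j) fun y hy => ?_).trans ?_
        · exact Set.indicator_of_notMem (fun h => hy h.2) _
        · gcongr with x
          rw [enorm_le_iff_norm_le]
          exact abs_truncation_le f j x

lemma eLpNorm_ofReal_eq {X E : Type*} [MeasurableSpace X] [TopologicalSpace E]
    [ContinuousENorm E] (μ : Measure X) (f : X → E) (hq : 0 < q) :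
    eLpNorm f (ENNReal.ofReal q) μ = (∫⁻ x, ‖f x‖ₑ ^ q ∂μ) ^ (1 / q) := by
  rw [eLpNorm_eq_lintegral_rpow_enorm_toReal (ENNReal.ofReal_pos.2 hq).ne' ENNReal.ofReal_ne_top,
    ENNReal.toReal_ofReal hq.le]

lemma exists_measurable_rep (hq : 0 < q) (h : IsStrictAqWeight q ν) {f : Rn n → ℝ}
    (hf : MemLp f (ENNReal.ofReal q) (weightMeasure ν)) :
    ∃ g : Rn n → ℝ, Measurable g ∧ f =ᵐ[volume] g ∧ f =ᵐ[weightMeasure ν] g ∧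
      ∫⁻ x, ‖g x‖ₑ ^ q ∂(weightMeasure ν) ≠ ∞ := by
  refine ⟨hf.1.mk f, hf.1.stronglyMeasurable_mk.measurable, ?_, hf.1.ae_eq_mk, ?_⟩
  · exact (absolutelyContinuous_weightMeasure h.measurable h.pos).ae_le hf.1.ae_eq_mk
  · have h1 : eLpNorm (hf.1.mk f) (ENNReal.ofReal q) (weightMeasure ν) < ∞ := by
      rw [← eLpNorm_congr_ae hf.1.ae_eq_mk]; exact hf.2
    rw [eLpNorm_ofReal_eq _ _ hq] at h1
    intro h2
    rw [h2, ENNReal.top_rpow_of_pos (by positivity)] at h1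
    exact h1.ne rfl

lemma Sstar_congr (k : ℝ → Rn n → Rn n → ℝ) {f g : Rn n → ℝ} (h : f =ᵐ[volume] g) :
    Sstar k f = Sstar k g := by
  funext t x
  refine integral_congr_ae ?_
  filter_upwards [h] with y hy
  rw [hy]

lemma RegKernel.integrable_of_isAqWeight {k : ℝ → Rn n → Rn n → ℝ} {δ C : ℝ}
    (hk : RegKernel k δ C) (hn : 1 ≤ n) (hqp : q.HolderConjugate p) (h : IsAqWeight q ν)
    {f : Rn n → ℝ} (hf : MemLp f (ENNReal.ofReal q) (weightMeasure ν)) {t : ℝ} (ht : 0 < t)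
    (x : Rn n) : Integrable (fun y => k t x y * f y) volume := by
  obtain ⟨ν', h', hw, -⟩ := h.exists_strict
  rw [← hw] at hf
  obtain ⟨g, hgm, hg, -, hgi⟩ := exists_measurable_rep hqp.pos h' hf
  refine (hk.integrable_mul_of_memLp hn hqp h' hgm hgi ht x).congr ?_
  filter_upwards [hg] with y hy
  rw [hy]

theorem Admissible.weightedEstimate {k : ℝ → Rn n → Rn n → ℝ} (hk : Admissible k) (hn : 1 ≤ n)
    (hqp : q.HolderConjugate p) {β : ℝ} (hβ : 0 < β) :
    WeightedEstimate k q β (max 1 (p / q)) := by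
  obtain ⟨δ, C, hreg⟩ := hk.exists_regKernel
  obtain ⟨α, hα, hL⟩ := hk.2
  obtain ⟨M, hM⟩ := hreg.exists_lintegral_coneSup_le_of_memLp hn hα hβ hL hqp
  have hq0 := hqp.pos
  refine ⟨M, fun ν h f hf => ?_⟩
  obtain ⟨ν', h', hw, hchar⟩ := h.exists_strict
  rw [← hw] at hf ⊢
  rw [← hchar]
  obtain ⟨g, hgm, hg, hgw, hgi⟩ := exists_measurable_rep hq0 h' hf
  rw [Sstar_congr k hg, eLpNorm_congr_ae hgw, eLpNorm_ofReal_eq _ _ hq0,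
    eLpNorm_ofReal_eq _ _ hq0]
  have e : p / q = 1 / (q - 1) := by
    have := hqp.sub_one_mul_conj
    have := hqp.sub_one_pos
    field_simp
    linarith
  rw [e]
  have h1 : ∫⁻ z, ‖ntMax β (Sstar k g) z‖ₑ ^ q ∂(weightMeasure ν') ≤
      (M * aqChar q ν' ^ max 1 (1 / (q - 1))) ^ q * ∫⁻ x, ‖g x‖ₑ ^ q ∂(weightMeasure ν') := by
    refine le_trans (lintegral_mono fun z => ?_) (hM ν' g h' hgm hgi)
    rw [enorm_eq_self]
    exact ENNReal.rpow_le_rpow (ntMax_le_coneSup _ _ _) hq0.le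
  refine (ENNReal.rpow_le_rpow h1 (by positivity)).trans (le_of_eq ?_)
  rw [ENNReal.mul_rpow_of_nonneg _ _ (by positivity), ← ENNReal.rpow_mul,
    mul_one_div_cancel hq0.ne', ENNReal.rpow_one]

end NTMax
end

/-! ### Integrals of powers of the norm -/

noncomputable section
namespace NTMax

variable {n : ℕ} {ε R : ℝ}

/-- The volume of the unit ball of `ℝⁿ`. -/
def ballVol (n : ℕ) : ℝ := volume.real (Metric.ball (0 : Rn n) 1)

lemma ballVol_pos (n : ℕ) : 0 < ballVol n :=
  ENNReal.toReal_pos (Metric.measure_ball_pos _ _ one_pos).ne' measure_ball_lt_top.ne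

lemma lintegral_ofReal_norm (hn : 1 ≤ n) {g : ℝ → ℝ} (hg : ∀ y, 0 ≤ g y)
    (hi : IntegrableOn (fun y : ℝ => y ^ (n - 1) * g y) (Set.Ioi 0)) :
    ∫⁻ x : Rn n, ENNReal.ofReal (g ‖x‖) =
      ENNReal.ofReal (n * (ballVol n * ∫ y in Set.Ioi (0 : ℝ), y ^ (n - 1) * g y)) := by
  have hf : Module.finrank ℝ (Rn n) = n := by simp
  have : Nontrivial (Rn n) := Module.nontrivial_of_finrank_pos (R := ℝ) (by rw [hf]; omega)
  have h1 := integrable_fun_norm_addHaar (E := Rn n) volume (f := g)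
  have h2 := integral_fun_norm_addHaar (E := Rn n) volume g
  rw [hf] at h1 h2
  simp only [smul_eq_mul, nsmul_eq_mul] at h1 h2
  rw [← ofReal_integral_eq_lintegral_ofReal (h1.2 hi) (Filter.Eventually.of_forall fun x => hg _),
    h2]
  rfl

lemma pow_mul_rpow_eq (hn : 1 ≤ n) {y : ℝ} (hy : 0 < y) (a : ℝ) :
    y ^ (n - 1) * y ^ (a - n) = y ^ (a - 1) := by
  rw [← Real.rpow_natCast, ← Real.rpow_add hy]
  congr 1
  rw [Nat.cast_sub hn]
  push_cast
  ring

/-- Polar coordinates. Writing the exponent as `n ε - n` makes the integral over the unit ball a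
fixed multiple of `1 / ε`. -/
lemma lintegral_ball_rpow (hn : 1 ≤ n) (hε : 0 < ε) (hR : 0 ≤ R) :
    ∫⁻ x in Metric.ball (0 : Rn n) R, ENNReal.ofReal (‖x‖ ^ (n * ε - n)) =
      ENNReal.ofReal (ballVol n * R ^ (n * ε) / ε) := by
  have hn0 : (0 : ℝ) < n := by exact_mod_cast hn
  have hne : 0 < n * ε := by positivity
  set g : ℝ → ℝ := (Set.Ico 0 R).indicator fun y => y ^ (n * ε - n) with hg
  have hg0 : ∀ y, 0 ≤ g y := fun y =>
    Set.indicator_nonneg (fun y hy => Real.rpow_nonneg hy.1 _) y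
  have heq : Set.EqOn (fun y : ℝ => y ^ (n - 1) * g y)
      ((Set.Ioo 0 R).indicator fun y => y ^ (n * ε - 1)) (Set.Ioi 0) := by
    intro y hy
    have hy0 : 0 < y := hy
    by_cases hyR : y < R
    · have h1 : y ∈ Set.Ico 0 R := ⟨hy0.le, hyR⟩
      have h2 : y ∈ Set.Ioo 0 R := ⟨hy0, hyR⟩
      simp only [hg, Set.indicator_of_mem h1, Set.indicator_of_mem h2]
      exact pow_mul_rpow_eq hn hy0 _
    · have h1 : y ∉ Set.Ico 0 R := fun h => hyR h.2
      have h2 : y ∉ Set.Ioo 0 R := fun h => hyR h.2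
      simp [hg, Set.indicator_of_notMem h1, Set.indicator_of_notMem h2]
  have hInt : IntegrableOn (fun y : ℝ => y ^ (n * ε - 1)) (Set.Ioo 0 R) := by
    have := intervalIntegral.intervalIntegrable_rpow' (a := 0) (b := R)
      (by linarith : -1 < n * ε - 1)
    rw [intervalIntegrable_iff_integrableOn_Ioo_of_le hR] at this
    exact this
  have hi : IntegrableOn (fun y : ℝ => y ^ (n - 1) * g y) (Set.Ioi 0) := by
    rw [integrableOn_congr_fun heq measurableSet_Ioi]
    exact ((integrable_indicator_iff measurableSet_Ioo).2 hInt).integrableOn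
  have hval : ∫ y in Set.Ioi (0 : ℝ), y ^ (n - 1) * g y = R ^ (n * ε) / (n * ε) := by
    rw [setIntegral_congr_fun measurableSet_Ioi heq, setIntegral_indicator measurableSet_Ioo,
      Set.inter_eq_self_of_subset_right (fun y hy => hy.1), ← integral_Ioc_eq_integral_Ioo,
      ← intervalIntegral.integral_of_le hR, integral_rpow (Or.inl (by linarith)),
      sub_add_cancel, Real.zero_rpow hne.ne', sub_zero]
  have h := lintegral_ofReal_norm hn hg0 hi
  rw [hval] at h
  rw [← lintegral_indicator Metric.isOpen_ball.measurableSet]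
  refine Eq.trans (lintegral_congr fun x => ?_) (h.trans ?_)
  · by_cases hx : x ∈ Metric.ball (0 : Rn n) R
    · have h1 : ‖x‖ ∈ Set.Ico 0 R := ⟨norm_nonneg x, by simpa using hx⟩
      rw [Set.indicator_of_mem hx, hg, Set.indicator_of_mem h1]
    · have h1 : ‖x‖ ∉ Set.Ico 0 R := fun h => hx (by simpa using h.2)
      rw [Set.indicator_of_notMem hx, hg, Set.indicator_of_notMem h1, ENNReal.ofReal_zero]
  · congr 1
    field_simp

lemma lintegral_compl_ball_rpow (hn : 1 ≤ n) (hε : 0 < ε) (hR : 0 < R) :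
    ∫⁻ x in (Metric.ball (0 : Rn n) R)ᶜ, ENNReal.ofReal (‖x‖ ^ (-(n * ε) - n)) =
      ENNReal.ofReal (ballVol n * R ^ (-(n * ε)) / ε) := by
  have hn0 : (0 : ℝ) < n := by exact_mod_cast hn
  have hne : 0 < n * ε := by positivity
  set g : ℝ → ℝ := (Set.Ici R).indicator fun y => y ^ (-(n * ε) - n) with hg
  have hg0 : ∀ y, 0 ≤ g y := fun y =>
    Set.indicator_nonneg (fun y hy => Real.rpow_nonneg (hR.le.trans hy) _) y
  have heq : Set.EqOn (fun y : ℝ => y ^ (n - 1) * g y)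
      ((Set.Ici R).indicator fun y => y ^ (-(n * ε) - 1)) (Set.Ioi 0) := by
    intro y hy
    have hy0 : 0 < y := hy
    by_cases hyR : y ∈ Set.Ici R
    · simp only [hg, Set.indicator_of_mem hyR]
      exact pow_mul_rpow_eq hn hy0 _
    · simp [hg, Set.indicator_of_notMem hyR]
  have hInt : IntegrableOn (fun y : ℝ => y ^ (-(n * ε) - 1)) (Set.Ici R) := by
    rw [integrableOn_Ici_iff_integrableOn_Ioi]
    exact integrableOn_Ioi_rpow_of_lt (by linarith) hR
  have hi : IntegrableOn (fun y : ℝ => y ^ (n - 1) * g y) (Set.Ioi 0) := by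
    rw [integrableOn_congr_fun heq measurableSet_Ioi]
    exact ((integrable_indicator_iff measurableSet_Ici).2 hInt).integrableOn
  have hval : ∫ y in Set.Ioi (0 : ℝ), y ^ (n - 1) * g y = R ^ (-(n * ε)) / (n * ε) := by
    rw [setIntegral_congr_fun measurableSet_Ioi heq, setIntegral_indicator measurableSet_Ici,
      Set.inter_eq_self_of_subset_right (Set.Ici_subset_Ioi.2 hR), integral_Ici_eq_integral_Ioi,
      integral_Ioi_rpow_of_lt (by linarith) hR, sub_add_cancel, neg_div_neg_eq]
  have h := lintegral_ofReal_norm hn hg0 hi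
  rw [hval] at h
  rw [← lintegral_indicator Metric.isOpen_ball.measurableSet.compl]
  refine Eq.trans (lintegral_congr fun x => ?_) (h.trans ?_)
  · by_cases hx : x ∈ (Metric.ball (0 : Rn n) R)ᶜ
    · have h1 : ‖x‖ ∈ Set.Ici R := by simpa using hx
      rw [Set.indicator_of_mem hx, hg, Set.indicator_of_mem h1]
    · have h1 : ‖x‖ ∉ Set.Ici R := fun h => hx (by simpa using h)
      rw [Set.indicator_of_notMem hx, hg, Set.indicator_of_notMem h1, ENNReal.ofReal_zero]
  · congr 1
    field_simp

end NTMax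
end

/-! ### The Hardy kernel is admissible -/

noncomputable section
namespace NTMax

variable {n : ℕ}

/-- The kernel `(t + |x| + |y|)^{-n}`. -/
def hardyKernel (n : ℕ) (t : ℝ) (x y : Rn n) : ℝ := ((t + ‖x‖ + ‖y‖) ^ n)⁻¹

lemma abs_inv_pow_sub_inv_pow_le (n : ℕ) {a b : ℝ} (ha : 0 < a) (hb : a / 2 ≤ b)
    (hb' : b ≤ 2 * a) :
    |(b ^ n)⁻¹ - (a ^ n)⁻¹| ≤ n * 4 ^ n * (|b - a| / a ^ (n + 1)) := by
  have hb0 : 0 < b := by linarith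
  rcases Nat.eq_zero_or_pos n with rfl | hn
  · simp
  have e : (b ^ n)⁻¹ - (a ^ n)⁻¹ = (a ^ n - b ^ n) / (b ^ n * a ^ n) := by field_simp
  rw [e, abs_div, abs_of_pos (by positivity : 0 < b ^ n * a ^ n)]
  have h1 : |a ^ n - b ^ n| ≤ |a - b| * n * (2 * a) ^ (n - 1) := by
    refine (abs_pow_sub_pow_le a b n).trans ?_
    rw [abs_of_pos ha, abs_of_pos hb0]
    gcongr
    exact max_le (by linarith) hb'
  have h2 : (a / 2) ^ n ≤ b ^ n := pow_le_pow_left₀ (by positivity) hb n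
  calc |a ^ n - b ^ n| / (b ^ n * a ^ n)
      ≤ |a - b| * n * (2 * a) ^ (n - 1) / ((a / 2) ^ n * a ^ n) := by gcongr
    _ ≤ _ := by
        obtain ⟨m, rfl⟩ : ∃ m, n = m + 1 := ⟨n - 1, by omega⟩
        rw [Nat.add_sub_cancel, abs_sub_comm a b, mul_div_assoc', div_le_div_iff₀ (by positivity)
          (by positivity)]
        have h3 : (4 : ℝ) ^ (m + 1) = 2 ^ (m + 1) * 2 ^ (m + 1) := by
          rw [← mul_pow]; norm_num
        have h4 : (2 * a) ^ m * a ^ (m + 1 + 1) ≤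
            4 ^ (m + 1) * ((a / 2) ^ (m + 1) * a ^ (m + 1)) := by
          rw [div_pow, h3]
          have : (2 : ℝ) ^ (m + 1) * 2 ^ (m + 1) * (a ^ (m + 1) / 2 ^ (m + 1) * a ^ (m + 1)) =
            2 * ((2 * a) ^ m * a ^ (m + 1 + 1)) := by
            field_simp
            ring
          rw [this]
          have : 0 ≤ (2 * a) ^ m * a ^ (m + 1 + 1) := by positivity
          linarith
        calc |b - a| * ↑(m + 1) * (2 * a) ^ m * a ^ (m + 1 + 1)
            = |b - a| * ↑(m + 1) * ((2 * a) ^ m * a ^ (m + 1 + 1)) := by ring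
          _ ≤ |b - a| * ↑(m + 1) * (4 ^ (m + 1) * ((a / 2) ^ (m + 1) * a ^ (m + 1))) := by gcongr
          _ = _ := by ring

lemma enorm2_le_hardy {t : ℝ} (ht : 0 < t) (x y : Rn n) :
    enorm2 t (x - y) ≤ t + ‖x‖ + ‖y‖ := by
  refine (enorm2_le t (x - y)).trans ?_
  rw [abs_of_pos ht]
  linarith [norm_sub_le x y]

/-- The kernel depends only on the number `a = t + |x| + |y|`, which dominates the distance to `(0,
y)`. The height and one norm may both change, hence `2 e`; but the height never decreases, so `b ≥ a
- e ≥ a / 2`. -/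
lemma hardy_diff_le {t e a b : ℝ} {u : Rn n} (ht : 0 < t) (hρ : enorm2 t u ≤ a)
    (he : e ≤ enorm2 t u / 2) (h0 : 0 ≤ e) (hba : a - e ≤ b) (hba' : |b - a| ≤ 2 * e) :
    |(b ^ n)⁻¹ - (a ^ n)⁻¹| ≤
      2 * n * 4 ^ n * (e ^ (1 : ℝ) / enorm2 t u ^ ((n : ℝ) + 1)) := by
  have hpos := enorm2_pos ht u
  have ha : 0 < a := by linarith
  refine (abs_inv_pow_sub_inv_pow_le n ha (by linarith)
    (by linarith [(abs_le.1 hba').2])).trans ?_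
  have e1 : enorm2 t u ^ ((n : ℝ) + 1) = enorm2 t u ^ (n + 1) := by
    rw [← Real.rpow_natCast]; push_cast; rfl
  rw [e1, Real.rpow_one]
  calc n * 4 ^ n * (|b - a| / a ^ (n + 1)) ≤ n * 4 ^ n * (2 * e / enorm2 t u ^ (n + 1)) := by
        gcongr
    _ = _ := by ring

lemma hardyKernel_xRegular (n : ℕ) : XRegular (hardyKernel n) 1 := by
  refine ⟨2 * n * 4 ^ n, fun s t x y z hs ht h => ?_⟩
  have h1 : |s| ≤ enorm2 s z := abs_le_enorm2 s z
  have h2 := norm_le_enorm2 s z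
  rw [abs_of_pos hs] at h1
  have h3 : ‖x + z‖ ≤ ‖x‖ + ‖z‖ := norm_add_le x z
  have h4 : ‖x‖ ≤ ‖x + z‖ + ‖z‖ := by
    have := norm_sub_le (x + z) z
    rwa [add_sub_cancel_right] at this
  refine hardy_diff_le ht (enorm2_le_hardy ht x y) h (enorm2_nonneg s z) (by linarith) ?_
  rw [abs_le]
  constructor <;> linarith

lemma hardyKernel_yRegular (n : ℕ) : YRegular (hardyKernel n) 1 := by
  refine ⟨2 * n * 4 ^ n, fun t x y z ht h => ?_⟩
  have h3 : ‖y + z‖ ≤ ‖y‖ + ‖z‖ := norm_add_le y z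
  have h4 : ‖y‖ ≤ ‖y + z‖ + ‖z‖ := by
    have := norm_sub_le (y + z) z
    rwa [add_sub_cancel_right] at this
  have h5 := norm_nonneg z
  refine hardy_diff_le ht (enorm2_le_hardy ht x y) h (norm_nonneg z) (by linarith) ?_
  rw [abs_le]
  constructor <;> linarith

/-- The operator `∫ |f(y)| (|z| + |y|)^{-n} dy`. -/
def hardyOp (f : Rn n → ℝ) (z : Rn n) : ℝ≥0∞ :=
  ∫⁻ y, ENNReal.ofReal (hardyKernel n 0 z y) * ‖f y‖ₑ

lemma hardyKernel_nonneg {t : ℝ} (ht : 0 ≤ t) (x y : Rn n) : 0 ≤ hardyKernel n t x y := by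
  unfold hardyKernel; positivity

lemma measurable_hardyKernel (n : ℕ) :
    Measurable fun P : Rn n × Rn n => hardyKernel n 0 P.1 P.2 := by
  unfold hardyKernel
  fun_prop

lemma measurable_hardyKernel_apply (t : ℝ) (x : Rn n) : Measurable (hardyKernel n t x) := by
  unfold hardyKernel
  fun_prop

lemma hardyKernel_comm (z y : Rn n) : hardyKernel n 0 z y = hardyKernel n 0 y z := by
  simp only [hardyKernel, zero_add, add_comm]

/-- In the cone of aperture one, `|z| ≤ |x| + t`, so the kernel is largest in the limit at the
vertex. -/
lemma coneSup_hardy_le (f : Rn n → ℝ) {z : Rn n} (hz : z ≠ 0) :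
    coneSup 1 (Sstar (hardyKernel n) f) z ≤ hardyOp f z := by
  refine iSup₂_le fun P hP => ?_
  obtain ⟨ht, hx⟩ := hP
  refine (enorm_integral_le_lintegral_enorm _).trans (lintegral_mono fun y => ?_)
  have hz0 : 0 < ‖z‖ := norm_pos_iff.2 hz
  have h1 : ‖z‖ ≤ ‖P.2‖ + ‖P.2 - z‖ := by
    have := norm_sub_le P.2 (P.2 - z)
    rwa [sub_sub_cancel] at this
  rw [enorm_mul]
  gcongr
  rw [← ofReal_norm, Real.norm_of_nonneg (hardyKernel_nonneg ht.le _ _)]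
  refine ENNReal.ofReal_le_ofReal ?_
  unfold hardyKernel
  have := norm_nonneg y
  refine inv_anti₀ (by positivity) (pow_le_pow_left₀ (by positivity) ?_ n)
  linarith

/-- The Schur weight `|y|^{-n/2}`. -/
def schurWeight (y : Rn n) : ℝ≥0∞ := ENNReal.ofReal (‖y‖ ^ ((n : ℝ) * (1 / 2) - n))

lemma measurable_schurWeight : Measurable (schurWeight (n := n)) := by
  unfold schurWeight; fun_prop

/-- Split at `|y| = |z|`: inside, the kernel is at most `|z| ^ (-n)`; outside, at most `|y| ^ (-n)`.
Each part gives `2 * ballVol n` times the Schur weight. -/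
lemma lintegral_hardyKernel_schurWeight_le (hn : 1 ≤ n) {z : Rn n} (hz : z ≠ 0) :
    ∫⁻ y, ENNReal.ofReal (hardyKernel n 0 z y) * schurWeight y ≤
      ENNReal.ofReal (4 * ballVol n) * schurWeight z := by
  have hz0 : 0 < ‖z‖ := norm_pos_iff.2 hz
  have hV := ballVol_pos n
  have hnear : ∫⁻ y in Metric.ball (0 : Rn n) ‖z‖,
      ENNReal.ofReal (hardyKernel n 0 z y) * schurWeight y ≤
      ENNReal.ofReal (2 * ballVol n) * schurWeight z := by
    calc _ ≤ ∫⁻ y in Metric.ball (0 : Rn n) ‖z‖,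
          ENNReal.ofReal ((‖z‖ ^ n)⁻¹) * schurWeight y := by
          refine lintegral_mono fun y => ?_
          gcongr
          unfold hardyKernel
          gcongr
          linarith [norm_nonneg y]
      _ = ENNReal.ofReal ((‖z‖ ^ n)⁻¹) *
          ENNReal.ofReal (ballVol n * ‖z‖ ^ ((n : ℝ) * (1 / 2)) / (1 / 2)) := by
          rw [lintegral_const_mul _ measurable_schurWeight]
          simp only [schurWeight]
          rw [lintegral_ball_rpow hn (by norm_num) hz0.le]
      _ = _ := by
          rw [schurWeight, ← ENNReal.ofReal_mul (by positivity),
            ← ENNReal.ofReal_mul (by positivity), Real.rpow_sub hz0, Real.rpow_natCast]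
          congr 1
          field_simp
  have hfar : ∫⁻ y in (Metric.ball (0 : Rn n) ‖z‖)ᶜ,
      ENNReal.ofReal (hardyKernel n 0 z y) * schurWeight y ≤
      ENNReal.ofReal (2 * ballVol n) * schurWeight z := by
    calc _ ≤ ∫⁻ y in (Metric.ball (0 : Rn n) ‖z‖)ᶜ,
          ENNReal.ofReal (‖y‖ ^ (-((n : ℝ) * (1 / 2)) - n)) := by
          refine setLIntegral_mono (by fun_prop) fun y hy => ?_
          have hy' : ‖z‖ ≤ ‖y‖ := by simpa using hy
          have hy0 : 0 < ‖y‖ := hz0.trans_le hy'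
          rw [schurWeight, ← ENNReal.ofReal_mul (hardyKernel_nonneg le_rfl _ _)]
          refine ENNReal.ofReal_le_ofReal ?_
          have e : ‖y‖ ^ (-((n : ℝ) * (1 / 2)) - n) =
              (‖y‖ ^ n)⁻¹ * ‖y‖ ^ ((n : ℝ) * (1 / 2) - n) := by
            rw [← Real.rpow_natCast, ← Real.rpow_neg hy0.le, ← Real.rpow_add hy0]
            congr 1; ring
          rw [e]
          unfold hardyKernel
          gcongr
          linarith
      _ = ENNReal.ofReal (ballVol n * ‖z‖ ^ (-((n : ℝ) * (1 / 2))) / (1 / 2)) :=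
          lintegral_compl_ball_rpow hn (by norm_num) hz0
      _ = _ := by
          rw [schurWeight, ← ENNReal.ofReal_mul (by positivity)]
          congr 1
          have : (n : ℝ) * (1 / 2) - n = -((n : ℝ) * (1 / 2)) := by ring
          rw [this]
          ring
  rw [← lintegral_add_compl _ (Metric.isOpen_ball (x := (0 : Rn n)) (ε := ‖z‖)).measurableSet]
  refine (add_le_add hnear hfar).trans (le_of_eq ?_)
  rw [← add_mul, ← ENNReal.ofReal_add (by positivity) (by positivity)]
  congr 2; ring

lemma schurWeight_ne_zero {y : Rn n} (hy : y ≠ 0) : schurWeight y ≠ 0 :=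
  (ENNReal.ofReal_pos.2 (Real.rpow_pos_of_pos (norm_pos_iff.2 hy) _)).ne'

lemma ae_ne_zero (hn : 1 ≤ n) : ∀ᵐ y : Rn n, y ≠ 0 := by
  have hf : Module.finrank ℝ (Rn n) = n := by simp
  have : Nontrivial (Rn n) := Module.nontrivial_of_finrank_pos (R := ℝ) (by rw [hf]; omega)
  exact Measure.ae_ne volume (0 : Rn n)

/-- The Cauchy–Schwarz half of Schur's test, with the weight and its inverse placed on the two
factors. Tonelli's theorem and the symmetry of the kernel then finish the `L_2` bound. -/
lemma hardyOp_sq_le (hn : 1 ≤ n) {f : Rn n → ℝ} (hf : Measurable f) {z : Rn n} (hz : z ≠ 0) :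
    hardyOp f z ^ (2 : ℝ) ≤ ENNReal.ofReal (4 * ballVol n) * schurWeight z *
      ∫⁻ y, ENNReal.ofReal (hardyKernel n 0 z y) * (schurWeight y)⁻¹ * ‖f y‖ₑ ^ (2 : ℝ) := by
  set κ : Rn n → ℝ≥0∞ := fun y => ENNReal.ofReal (hardyKernel n 0 z y) with hκ
  have hκm : Measurable κ := (measurable_hardyKernel_apply 0 z).ennreal_ofReal
  have hφ := measurable_schurWeight (n := n)
  have h2 : (2 : ℝ).HolderConjugate 2 := Real.HolderConjugate.two_two
  have h1 := ENNReal.lintegral_mul_le_Lp_mul_Lq volume h2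
    (f := fun y => (κ y * schurWeight y) ^ (1 / 2 : ℝ))
    (g := fun y => (κ y * (schurWeight y)⁻¹) ^ (1 / 2 : ℝ) * ‖f y‖ₑ)
    (by fun_prop) (by fun_prop)
  have e : hardyOp f z = ∫⁻ y, ((fun y => (κ y * schurWeight y) ^ (1 / 2 : ℝ)) *
      (fun y => (κ y * (schurWeight y)⁻¹) ^ (1 / 2 : ℝ) * ‖f y‖ₑ)) y := by
    refine lintegral_congr_ae ?_
    filter_upwards [ae_ne_zero hn] with y hy
    simp only [Pi.mul_apply]
    rw [← mul_assoc, ← ENNReal.mul_rpow_of_nonneg _ _ (by norm_num), mul_mul_mul_comm,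
      ENNReal.mul_inv_cancel (schurWeight_ne_zero hy) ENNReal.ofReal_ne_top, mul_one]
    congr 1
    rw [ENNReal.mul_rpow_of_nonneg _ _ (by norm_num),
      ← ENNReal.rpow_add_of_nonneg _ _ (by norm_num) (by norm_num), add_halves, ENNReal.rpow_one]
  rw [← e] at h1
  have h3 := ENNReal.rpow_le_rpow h1 (by norm_num : (0 : ℝ) ≤ 2)
  have hh : ∀ a : ℝ≥0∞, (a ^ (1 / 2 : ℝ)) ^ (2 : ℝ) = a := fun a => by
    rw [← ENNReal.rpow_mul, one_div_mul_cancel two_ne_zero, ENNReal.rpow_one]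
  rw [ENNReal.mul_rpow_of_nonneg _ _ (by norm_num), hh, hh] at h3
  refine h3.trans ?_
  simp only [ENNReal.mul_rpow_of_nonneg _ ‖f _‖ₑ (by norm_num : (0 : ℝ) ≤ 2), hh]
  gcongr
  exact lintegral_hardyKernel_schurWeight_le hn hz

lemma lintegral_hardyOp_sq_le (hn : 1 ≤ n) {f : Rn n → ℝ} (hf : Measurable f) :
    ∫⁻ z, hardyOp f z ^ (2 : ℝ) ≤
      ENNReal.ofReal (4 * ballVol n) ^ (2 : ℝ) * ∫⁻ y, ‖f y‖ₑ ^ (2 : ℝ) := by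
  set c := ENNReal.ofReal (4 * ballVol n) with hc
  have hφ := measurable_schurWeight (n := n)
  have hκ : Measurable fun P : Rn n × Rn n => ENNReal.ofReal (hardyKernel n 0 P.1 P.2) :=
    (measurable_hardyKernel n).ennreal_ofReal
  have hm : Measurable (Function.uncurry fun (z y : Rn n) => schurWeight z *
      (ENNReal.ofReal (hardyKernel n 0 z y) * (schurWeight y)⁻¹ * ‖f y‖ₑ ^ (2 : ℝ))) := by
    simp only [Function.uncurry_def]
    fun_prop
  calc ∫⁻ z, hardyOp f z ^ (2 : ℝ)
      ≤ ∫⁻ z, c * ∫⁻ y, schurWeight z *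
        (ENNReal.ofReal (hardyKernel n 0 z y) * (schurWeight y)⁻¹ * ‖f y‖ₑ ^ (2 : ℝ)) := by
        refine lintegral_mono_ae ?_
        filter_upwards [ae_ne_zero hn] with z hz
        refine (hardyOp_sq_le hn hf hz).trans (le_of_eq ?_)
        rw [mul_assoc, lintegral_const_mul' (schurWeight z) _ ENNReal.ofReal_ne_top]
    _ = c * ∫⁻ y, ∫⁻ z, schurWeight z *
        (ENNReal.ofReal (hardyKernel n 0 z y) * (schurWeight y)⁻¹ * ‖f y‖ₑ ^ (2 : ℝ)) := by
        rw [lintegral_const_mul' _ _ ENNReal.ofReal_ne_top,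
          lintegral_lintegral_swap hm.aemeasurable]
    _ ≤ c * ∫⁻ y, c * ‖f y‖ₑ ^ (2 : ℝ) := by
        gcongr 1
        refine lintegral_mono_ae ?_
        filter_upwards [ae_ne_zero hn] with y hy
        calc ∫⁻ z, schurWeight z *
              (ENNReal.ofReal (hardyKernel n 0 z y) * (schurWeight y)⁻¹ * ‖f y‖ₑ ^ (2 : ℝ))
            = ∫⁻ z, ENNReal.ofReal (hardyKernel n 0 y z) * schurWeight z *
              ((schurWeight y)⁻¹ * ‖f y‖ₑ ^ (2 : ℝ)) := by
              refine lintegral_congr fun z => ?_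
              rw [hardyKernel_comm z y]
              ring
          _ = (∫⁻ z, ENNReal.ofReal (hardyKernel n 0 y z) * schurWeight z) *
              ((schurWeight y)⁻¹ * ‖f y‖ₑ ^ (2 : ℝ)) := by
              refine lintegral_mul_const _ ?_
              exact (measurable_hardyKernel_apply 0 y).ennreal_ofReal.mul hφ
          _ ≤ c * schurWeight y * ((schurWeight y)⁻¹ * ‖f y‖ₑ ^ (2 : ℝ)) := by
              gcongr
              exact lintegral_hardyKernel_schurWeight_le hn hy
          _ = c * ‖f y‖ₑ ^ (2 : ℝ) := by
              rw [mul_assoc, ← mul_assoc (schurWeight y),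
                ENNReal.mul_inv_cancel (schurWeight_ne_zero hy) ENNReal.ofReal_ne_top, one_mul]
    _ = _ := by
        rw [lintegral_const_mul' _ _ ENNReal.ofReal_ne_top, ← mul_assoc]
        congr 1
        rw [ENNReal.rpow_two, sq]

lemma hardyKernel_admissible (hn : 1 ≤ n) : Admissible (hardyKernel n) := by
  refine ⟨⟨1, one_pos, hardyKernel_xRegular n, hardyKernel_yRegular n⟩, 1, one_pos,
    (4 * ballVol n).toNNReal, fun f hf => ?_⟩
  set g := hf.1.mk f with hg
  have hgm : Measurable g := hf.1.stronglyMeasurable_mk.measurable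
  have hfg : f =ᵐ[volume] g := hf.1.ae_eq_mk
  have e1 := eLpNorm_ofReal_eq volume (ntMax 1 (Sstar (hardyKernel n) g)) two_pos
  have e2 := eLpNorm_ofReal_eq volume g two_pos
  rw [ENNReal.ofReal_ofNat] at e1 e2
  rw [Sstar_congr _ hfg, eLpNorm_congr_ae hfg, e1, e2]
  have h1 : ∫⁻ z, ‖ntMax 1 (Sstar (hardyKernel n) g) z‖ₑ ^ (2 : ℝ) ≤
      ENNReal.ofReal (4 * ballVol n) ^ (2 : ℝ) * ∫⁻ y, ‖g y‖ₑ ^ (2 : ℝ) := by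
    refine le_trans (lintegral_mono_ae ?_) (lintegral_hardyOp_sq_le hn hgm)
    filter_upwards [ae_ne_zero hn] with z hz
    rw [enorm_eq_self]
    exact ENNReal.rpow_le_rpow ((ntMax_le_coneSup _ _ _).trans (coneSup_hardy_le g hz))
      (by norm_num)
  refine (ENNReal.rpow_le_rpow h1 (by norm_num : (0 : ℝ) ≤ 1 / 2)).trans (le_of_eq ?_)
  rw [ENNReal.mul_rpow_of_nonneg _ _ (by norm_num), ← ENNReal.rpow_mul,
    mul_one_div_cancel two_ne_zero, ENNReal.rpow_one]
  rfl

/-- The non-tangential maximal function of `S^* f` dominates the Hardy operator. -/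
lemma hardyOp_le_ntMax {α : ℝ} (hα : 0 < α) {f : Rn n → ℝ} (hf : Integrable f volume)
    (hf0 : ∀ y, 0 ≤ f y) {z : Rn n} (hz : z ≠ 0) :
    hardyOp f z ≤ 2 ^ n * ntMax α (Sstar (hardyKernel n) f) z := by
  have hz0 : 0 < ‖z‖ := norm_pos_iff.2 hz
  -- Points of the cone so low that `t + |x| < 2 |z|`, where the kernel loses at most a factor `2 ^
  -- n` against its value at the vertex, whatever the aperture.
  set U : Set (ℝ × Rn n) := cone α z ∩ {P | P.1 * (1 + α) < ‖z‖} with hU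
  have hUo : IsOpen U := (isOpen_cone α z).inter (isOpen_lt (by fun_prop) (by fun_prop))
  have hUne : U.Nonempty := by
    refine ⟨(‖z‖ / (2 * (1 + α)), z), ⟨?_, ?_⟩, ?_⟩
    · dsimp only; positivity
    · dsimp only; rw [sub_self, norm_zero]; positivity
    · show ‖z‖ / (2 * (1 + α)) * (1 + α) < ‖z‖
      have : ‖z‖ / (2 * (1 + α)) * (1 + α) = ‖z‖ / 2 := by field_simp
      rw [this]; linarith
  obtain ⟨P, hP, hle⟩ := exists_mem_enorm_le_ntMax (α := α) (Sstar (hardyKernel n) f) z hUo hUne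
    Set.inter_subset_left
  obtain ⟨⟨ht, hx⟩, hs⟩ := hP
  have hs' : P.1 * (1 + α) < ‖z‖ := hs
  have hk : ∀ y, hardyKernel n 0 z y ≤ 2 ^ n * hardyKernel n P.1 P.2 y := by
    intro y
    have hy := norm_nonneg y
    have h1 : ‖P.2‖ ≤ ‖P.2 - z‖ + ‖z‖ := by
      have := norm_add_le (P.2 - z) z
      rwa [sub_add_cancel] at this
    have h2 := norm_nonneg P.2
    unfold hardyKernel
    rw [← div_eq_mul_inv, inv_eq_one_div, div_le_div_iff₀ (by positivity) (by positivity), one_mul,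
      ← mul_pow]
    refine pow_le_pow_left₀ (by positivity) ?_ n
    nlinarith
  have hki : Integrable (fun y => hardyKernel n P.1 P.2 y * f y) volume := by
    refine hf.bdd_mul (c := (P.1 ^ n)⁻¹)
      (measurable_hardyKernel_apply _ _).aestronglyMeasurable
      (Filter.Eventually.of_forall fun y => ?_)
    rw [Real.norm_of_nonneg (hardyKernel_nonneg ht.le _ _)]
    unfold hardyKernel
    refine inv_anti₀ (by positivity) (pow_le_pow_left₀ ht.le ?_ n)
    linarith [norm_nonneg P.2, norm_nonneg y]
  have hS : ‖Sstar (hardyKernel n) f P.1 P.2‖ₑ =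
      ∫⁻ y, ENNReal.ofReal (hardyKernel n P.1 P.2 y * f y) := by
    have h0 : ∀ y, 0 ≤ hardyKernel n P.1 P.2 y * f y := fun y =>
      mul_nonneg (hardyKernel_nonneg ht.le _ _) (hf0 y)
    rw [← ofReal_integral_eq_lintegral_ofReal hki (Filter.Eventually.of_forall h0), Sstar,
      ← ofReal_norm, Real.norm_of_nonneg (integral_nonneg h0)]
  calc hardyOp f z ≤ ∫⁻ y, 2 ^ n * ENNReal.ofReal (hardyKernel n P.1 P.2 y * f y) := by
        refine lintegral_mono fun y => ?_
        rw [← ofReal_norm, Real.norm_of_nonneg (hf0 y),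
          ← ENNReal.ofReal_mul (hardyKernel_nonneg le_rfl _ _),
          show (2 : ℝ≥0∞) ^ n = ENNReal.ofReal (2 ^ n) by
            rw [ENNReal.ofReal_pow (by norm_num)]; simp,
          ← ENNReal.ofReal_mul (by positivity), ← mul_assoc]
        exact ENNReal.ofReal_le_ofReal (mul_le_mul_of_nonneg_right (hk y) (hf0 y))
    _ = 2 ^ n * ‖Sstar (hardyKernel n) f P.1 P.2‖ₑ := by
        rw [lintegral_const_mul' _ _ (ENNReal.pow_ne_top (by simp)), hS]
    _ ≤ _ := by gcongr

end NTMax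
end

/-! ### Power weights and the criterion for sharpness -/

noncomputable section
namespace NTMax

variable {n : ℕ} {p q ε : ℝ}

/-- The power weight `|x|^{nε - n}`. -/
def powWeight (n : ℕ) (ε : ℝ) (x : Rn n) : ℝ := ‖x‖ ^ (n * ε - n)

lemma measurable_powWeight (n : ℕ) (ε : ℝ) : Measurable (powWeight n ε) := by
  unfold powWeight; fun_prop

lemma powWeight_pos (ε : ℝ) {x : Rn n} (hx : x ≠ 0) : 0 < powWeight n ε x :=
  Real.rpow_pos_of_pos (norm_pos_iff.2 hx) _

lemma powWeight_nonneg (ε : ℝ) (x : Rn n) : 0 ≤ powWeight n ε x :=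
  Real.rpow_nonneg (norm_nonneg x) _

/-- The constant in the `A_1` condition for power weights. -/
def powConst (n : ℕ) : ℝ := 3 ^ n + ballVol n * (3 * Real.sqrt n) ^ n

lemma powConst_pos (n : ℕ) : 0 < powConst n := by
  have := ballVol_pos n
  unfold powConst
  positivity

/-- The `A_1` condition for power weights. -/
lemma exists_lintegral_powWeight_le (hn : 1 ≤ n) (hε : 0 < ε) (hε1 : ε ≤ 1) (a : Rn n) {l : ℝ}
    (hl : 0 < l) : ∃ m : ℝ, 0 < m ∧ (∀ x ∈ cube a l, x ≠ 0 → m ≤ powWeight n ε x) ∧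
      ∫⁻ x in cube a l, ENNReal.ofReal (powWeight n ε x) ≤
        ENNReal.ofReal (powConst n / ε * m) * volume (cube a l) := by
  have hn0 : (0 : ℝ) < n := by exact_mod_cast hn
  have hV := ballVol_pos n
  set D := Real.sqrt n * l with hD
  have hD0 : 0 < D := by positivity
  have hexp : n * ε - n ≤ 0 := by nlinarith
  have hdist : ∀ x ∈ cube a l, ‖x - a‖ ≤ D := by
    intro x hx
    refine norm_le_sqrt_mul (fun i => ?_) hl.le
    have := hx i
    rw [Set.mem_Ico] at this
    rw [PiLp.sub_apply, abs_le]
    constructor <;> linarith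
  have hup : ∀ x ∈ cube a l, ‖x‖ ≤ ‖a‖ + D := by
    intro x hx
    have := norm_add_le (x - a) a
    rw [sub_add_cancel] at this
    linarith [hdist x hx]
  -- A cube far from the origin compared with its diameter sees a nearly constant weight. A cube
  -- near the origin lies in the ball of radius `3 D`, where the integral is explicit and produces
  -- the factor `1 / ε`.
  rcases le_or_gt (2 * D) ‖a‖ with h | h
  · have ha : 0 < ‖a‖ := by linarith
    refine ⟨(3 * (‖a‖ / 2)) ^ (n * ε - n), by positivity, fun x hx hx0 => ?_, ?_⟩
    · exact Real.rpow_le_rpow_of_nonpos (norm_pos_iff.2 hx0) (by linarith [hup x hx]) hexp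
    · have h1 : ∀ x ∈ cube a l, powWeight n ε x ≤
          powConst n / ε * (3 * (‖a‖ / 2)) ^ (n * ε - n) := by
        intro x hx
        have h2 : ‖a‖ / 2 ≤ ‖x‖ := by
          have := norm_sub_le x (x - a)
          rw [sub_sub_cancel] at this
          linarith [hdist x hx]
        refine (Real.rpow_le_rpow_of_nonpos (by positivity) h2 hexp).trans ?_
        rw [Real.mul_rpow (by norm_num) (by positivity), ← mul_assoc]
        refine le_mul_of_one_le_left (by positivity) ?_
        have h3 : (1 : ℝ) ≤ 3 ^ n * 3 ^ (n * ε - n) := by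
          rw [← Real.rpow_natCast, ← Real.rpow_add (by norm_num)]
          exact Real.one_le_rpow (by norm_num) (by nlinarith)
        refine h3.trans ?_
        gcongr
        rw [le_div_iff₀ hε]
        have : (3 : ℝ) ^ n ≤ powConst n := by
          unfold powConst
          linarith [show 0 ≤ ballVol n * (3 * Real.sqrt n) ^ n by positivity]
        have h4 : (0 : ℝ) ≤ 3 ^ n := by positivity
        nlinarith
      calc _ ≤ ∫⁻ _ in cube a l,
            ENNReal.ofReal (powConst n / ε * (3 * (‖a‖ / 2)) ^ (n * ε - n)) :=
            setLIntegral_mono measurable_const fun x hx => ENNReal.ofReal_le_ofReal (h1 x hx)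
        _ = _ := setLIntegral_const _ _
  · refine ⟨(3 * D) ^ (n * ε - n), by positivity, fun x hx hx0 => ?_, ?_⟩
    · exact Real.rpow_le_rpow_of_nonpos (norm_pos_iff.2 hx0) (by linarith [hup x hx]) hexp
    · have hsub : cube a l ⊆ Metric.ball (0 : Rn n) (3 * D) := by
        intro x hx
        rw [mem_ball_zero_iff]
        linarith [hup x hx]
      refine (lintegral_mono_set hsub).trans ?_
      unfold powWeight
      rw [lintegral_ball_rpow hn hε (by positivity), volume_cube a hl.le,
        ← ENNReal.ofReal_pow hl.le, ← ENNReal.ofReal_mul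
          (by have := powConst_pos n; positivity)]
      refine ENNReal.ofReal_le_ofReal ?_
      have e : (3 * D) ^ (n * ε) = (3 * D) ^ (n * ε - n) * ((3 * Real.sqrt n) ^ n * l ^ n) := by
        rw [← mul_pow, mul_assoc 3, ← hD, ← Real.rpow_natCast, ← Real.rpow_add (by positivity),
          sub_add_cancel]
      rw [e]
      have h5 : ballVol n * (3 * Real.sqrt n) ^ n ≤ powConst n := by
        unfold powConst; linarith [show (0 : ℝ) ≤ 3 ^ n by positivity]
      calc ballVol n * ((3 * D) ^ (n * ε - n) * ((3 * Real.sqrt n) ^ n * l ^ n)) / ε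
          = ballVol n * (3 * Real.sqrt n) ^ n / ε * (3 * D) ^ (n * ε - n) * l ^ n := by ring
        _ ≤ _ := by gcongr

lemma setLAverage_le {E : Set (Rn n)} {g : Rn n → ℝ≥0∞} {c : ℝ≥0∞}
    (h : ∫⁻ x in E, g x ≤ c * volume E) : ⨍⁻ x in E, g x ∂volume ≤ c := by
  rw [setLAverage_eq]
  exact ENNReal.div_le_of_le_mul h

lemma setLIntegral_le_const_mul (hn : 1 ≤ n) {E : Set (Rn n)} (hE : MeasurableSet E)
    {g : Rn n → ℝ≥0∞} {c : ℝ≥0∞} (h : ∀ x ∈ E, x ≠ 0 → g x ≤ c) :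
    ∫⁻ x in E, g x ≤ c * volume E := by
  rw [← setLIntegral_const]
  refine setLIntegral_mono_ae' hE ?_
  filter_upwards [ae_ne_zero hn] with x hx hxE using h x hxE hx

/-- The lower bound `m` for the weight on the cube bounds the dual average by `m ^ (-1 / (q - 1))`,
which cancels the `m` in the average of the weight. -/
lemma aqChar_powWeight_le (hn : 1 ≤ n) (hq : 1 < q) (hε : 0 < ε) (hε1 : ε ≤ 1) :
    aqChar q (powWeight n ε) ≤ ENNReal.ofReal (powConst n / ε) := by
  refine iSup_le fun a => iSup_le fun l => iSup_le fun hl => ?_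
  have hC := powConst_pos n
  have hq1 : 0 < q - 1 := by linarith
  obtain ⟨m, hm, hle, hInt⟩ := exists_lintegral_powWeight_le hn hε hε1 a hl
  have h2 : ⨍⁻ x in cube a l, ENNReal.ofReal (powWeight n ε x ^ (-1 / (q - 1))) ∂volume ≤
      ENNReal.ofReal (m ^ (-1 / (q - 1))) := by
    refine setLAverage_le (setLIntegral_le_const_mul hn (measurableSet_cube a l)
      fun x hx hx0 => ENNReal.ofReal_le_ofReal ?_)
    exact Real.rpow_le_rpow_of_nonpos hm (hle x hx hx0)
      (div_nonpos_of_nonpos_of_nonneg (by norm_num) hq1.le)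
  calc _ ≤ ENNReal.ofReal (powConst n / ε * m) *
        ENNReal.ofReal (m ^ (-1 / (q - 1))) ^ (q - 1) := by
        gcongr
        exact setLAverage_le hInt
    _ = _ := by
        rw [ENNReal.ofReal_rpow_of_nonneg (by positivity) hq1.le,
          ← ENNReal.ofReal_mul (by positivity), ← Real.rpow_mul hm.le, div_mul_cancel₀ _ hq1.ne',
          Real.rpow_neg_one, mul_assoc, mul_inv_cancel₀ hm.ne', mul_one]

lemma powWeight_rpow_rpow (hq : 1 < q) (x : Rn n) :
    (powWeight n ε x ^ (-(q - 1))) ^ (-1 / (q - 1)) = powWeight n ε x := by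
  have hq1 : q - 1 ≠ 0 := by linarith
  rw [← Real.rpow_mul (powWeight_nonneg _ _)]
  have : -(q - 1) * (-1 / (q - 1)) = 1 := by field_simp
  rw [this, Real.rpow_one]

/-- Here the power weight is the dual weight, so its `A_1` constant enters with the exponent `q -
1`. -/
lemma aqChar_powWeight_rpow_le (hn : 1 ≤ n) (hq : 1 < q) (hε : 0 < ε) (hε1 : ε ≤ 1) :
    aqChar q (fun x => powWeight n ε x ^ (-(q - 1))) ≤
      ENNReal.ofReal ((powConst n / ε) ^ (q - 1)) := by
  refine iSup_le fun a => iSup_le fun l => iSup_le fun hl => ?_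
  have hC := powConst_pos n
  have hq1 : 0 < q - 1 := by linarith
  obtain ⟨m, hm, hle, hInt⟩ := exists_lintegral_powWeight_le hn hε hε1 a hl
  simp only [powWeight_rpow_rpow hq]
  have h2 : ⨍⁻ x in cube a l, ENNReal.ofReal (powWeight n ε x ^ (-(q - 1))) ∂volume ≤
      ENNReal.ofReal (m ^ (-(q - 1))) := by
    refine setLAverage_le (setLIntegral_le_const_mul hn (measurableSet_cube a l)
      fun x hx hx0 => ENNReal.ofReal_le_ofReal ?_)
    exact Real.rpow_le_rpow_of_nonpos hm (hle x hx hx0) (by linarith)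
  calc _ ≤ ENNReal.ofReal (m ^ (-(q - 1))) *
        ENNReal.ofReal (powConst n / ε * m) ^ (q - 1) := by
        gcongr
        exact setLAverage_le hInt
    _ = _ := by
        rw [ENNReal.ofReal_rpow_of_nonneg (by positivity) hq1.le,
          ← ENNReal.ofReal_mul (by positivity), Real.mul_rpow (by positivity) hm.le,
          mul_left_comm, ← Real.rpow_add hm, neg_add_cancel, Real.rpow_zero, mul_one]

lemma isAqWeight_powWeight (hn : 1 ≤ n) (hq : 1 < q) (hε : 0 < ε) (hε1 : ε ≤ 1) :
    IsAqWeight q (powWeight n ε) where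
  aemeasurable := (measurable_powWeight n ε).aemeasurable
  pos := by filter_upwards [ae_ne_zero hn] with x hx using powWeight_pos ε hx
  char_lt_top := (aqChar_powWeight_le hn hq hε hε1).trans_lt ENNReal.ofReal_lt_top

lemma isAqWeight_powWeight_rpow (hn : 1 ≤ n) (hq : 1 < q) (hε : 0 < ε) (hε1 : ε ≤ 1) :
    IsAqWeight q (fun x : Rn n => powWeight n ε x ^ (-(q - 1))) where
  aemeasurable := ((measurable_powWeight n ε).pow_const _).aemeasurable
  pos := by
    filter_upwards [ae_ne_zero hn] with x hx using Real.rpow_pos_of_pos (powWeight_pos ε hx) _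
  char_lt_top := (aqChar_powWeight_rpow_le hn hq hε hε1).trans_lt ENNReal.ofReal_lt_top

/-- A family of weights and functions on which the operator norm grows like `ε⁻¹` while the
characteristic grows at most like `ε^{-γ}` rules out the powers `β < 1/γ`. -/
lemma not_weightedEstimate {k : ℝ → Rn n → Rn n → ℝ} {α β γ c C : ℝ}
    (hqp : q.HolderConjugate p) (hγ : 0 < γ) (hβ : γ * β < 1) (hc : 0 < c) (hC : 0 < C)
    (H : ∀ ε : ℝ, 0 < ε → ε ≤ 1 → ∃ (ν f : Rn n → ℝ) (A : ℝ≥0∞), IsAqWeight q ν ∧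
      aqChar q ν ≤ ENNReal.ofReal ((C / ε) ^ γ) ∧ A ≠ 0 ∧ A ≠ ∞ ∧
      MemLp f (ENNReal.ofReal q) (weightMeasure ν) ∧
      eLpNorm f (ENNReal.ofReal q) (weightMeasure ν) ≤ A ∧
      ENNReal.ofReal (c / ε) * A ≤
        eLpNorm (ntMax α (Sstar k f)) (ENNReal.ofReal q) (weightMeasure ν)) :
    ¬ WeightedEstimate k q α β := by
  rintro ⟨K, hK⟩
  -- Replacing `β` by `max β 0` covers negative powers, since the characteristic is at least one.
  set θ := γ * max β 0 with hθ
  have hθ1 : θ < 1 := by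
    rw [hθ, mul_max_of_nonneg _ _ hγ.le, mul_zero]
    exact max_lt hβ one_pos
  have hθ0 : 0 ≤ θ := mul_nonneg hγ.le (le_max_right _ _)
  -- With `X = 1 / ε` the weighted estimate would bound `X ^ (1 - θ)`, which is unbounded because `θ
  -- < 1`.
  have hbound : ∀ X : ℝ, 1 ≤ X → c * X ^ (1 - θ) ≤ K * C ^ θ := by
    intro X hX
    have hX0 : 0 < X := by linarith
    obtain ⟨ν, f, A, hν, hchar, hA0, hAt, hf, hfA, hlow⟩ := H X⁻¹ (by positivity)
      (inv_le_one_of_one_le₀ hX)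
    obtain ⟨ν', h', -, hch⟩ := hν.exists_strict
    have h1 : 1 ≤ aqChar q ν := hch ▸ one_le_aqChar hqp h'
    have h2 : aqChar q ν ^ β ≤ ENNReal.ofReal ((C * X) ^ θ) := by
      calc aqChar q ν ^ β ≤ aqChar q ν ^ max β 0 :=
            ENNReal.rpow_le_rpow_of_exponent_le h1 (le_max_left _ _)
        _ ≤ ENNReal.ofReal ((C / X⁻¹) ^ γ) ^ max β 0 :=
            ENNReal.rpow_le_rpow hchar (le_max_right _ _)
        _ = _ := by
            rw [ENNReal.ofReal_rpow_of_nonneg (by positivity) (le_max_right _ _),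
              ← Real.rpow_mul (by positivity), div_inv_eq_mul]
    have h3 : ENNReal.ofReal (c / X⁻¹) * A ≤ K * ENNReal.ofReal ((C * X) ^ θ) * A := by
      refine hlow.trans ((hK ν hν f hf).trans ?_)
      gcongr
    have h4 := (ENNReal.mul_le_mul_iff_left hA0 hAt).1 h3
    rw [← ENNReal.ofReal_coe_nnreal, ← ENNReal.ofReal_mul (NNReal.coe_nonneg K), div_inv_eq_mul,
      ENNReal.ofReal_le_ofReal_iff (by positivity), Real.mul_rpow hC.le hX0.le] at h4
    rw [Real.rpow_sub hX0, Real.rpow_one, ← mul_div_assoc, div_le_iff₀ (by positivity)]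
    linarith
  have ht : Filter.Tendsto (fun X : ℝ => c * X ^ (1 - θ)) Filter.atTop Filter.atTop :=
    (tendsto_rpow_atTop (by linarith)).const_mul_atTop hc
  obtain ⟨X, hX1, hX⟩ := ((Filter.eventually_ge_atTop 1).and
    (ht.eventually_gt_atTop (K * C ^ θ))).exists
  exact absurd (hbound X hX1) (not_le.2 hX)

end NTMax
end

/-! ### Test functions for the lower bounds -/

noncomputable section
namespace NTMax

variable {n : ℕ} {p q ε : ℝ}

lemma mul_rpow_one_div_le {a B I : ℝ≥0∞} (hq : 0 < q) (h : a ^ q * B ≤ I) :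
    a * B ^ (1 / q) ≤ I ^ (1 / q) := by
  have h1 := ENNReal.rpow_le_rpow h (z := 1 / q) (by positivity)
  rwa [ENNReal.mul_rpow_of_nonneg _ _ (by positivity), ← ENNReal.rpow_mul,
    mul_one_div_cancel hq.ne', ENNReal.rpow_one] at h1

lemma lintegral_ball_powWeight (hn : 1 ≤ n) (hε : 0 < ε) {R : ℝ} (hR : 0 ≤ R) :
    ∫⁻ x in Metric.ball (0 : Rn n) R, ENNReal.ofReal (powWeight n ε x) =
      ENNReal.ofReal (ballVol n * R ^ (n * ε) / ε) :=
  lintegral_ball_rpow hn hε hR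

lemma lintegral_unitBall_powWeight (hn : 1 ≤ n) (hε : 0 < ε) :
    ∫⁻ x in Metric.ball (0 : Rn n) 1, ENNReal.ofReal (powWeight n ε x) =
      ENNReal.ofReal (ballVol n / ε) := by
  rw [lintegral_ball_powWeight hn hε zero_le_one, Real.one_rpow, mul_one]

lemma measurableSet_unitBall : MeasurableSet (Metric.ball (0 : Rn n) 1) :=
  Metric.isOpen_ball.measurableSet

lemma lintegral_univ_weightMeasure {ν : Rn n → ℝ} (hm : Measurable ν) {g : Rn n → ℝ≥0∞}
    (hg : Measurable g) :
    ∫⁻ x, g x ∂(weightMeasure ν) = ∫⁻ x, ENNReal.ofReal (ν x) * g x := by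
  have := lintegral_weightMeasure hm hg MeasurableSet.univ
  simpa using this

/-- Test functions reduce the failure of the weighted estimate to two integral bounds. -/
lemma sharpness_test {k : ℝ → Rn n → Rn n → ℝ} {ν f : Rn n → ℝ} {α : ℝ} {a B : ℝ≥0∞}
    (hq : 0 < q) (hB : B ≠ ∞) (hf : Measurable f)
    (hup : ∫⁻ x, ‖f x‖ₑ ^ q ∂(weightMeasure ν) ≤ B)
    (hlow : a ^ q * B ≤ ∫⁻ z, ntMax α (Sstar k f) z ^ q ∂(weightMeasure ν)) :
    MemLp f (ENNReal.ofReal q) (weightMeasure ν) ∧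
      eLpNorm f (ENNReal.ofReal q) (weightMeasure ν) ≤ B ^ (1 / q) ∧
      a * B ^ (1 / q) ≤
        eLpNorm (ntMax α (Sstar k f)) (ENNReal.ofReal q) (weightMeasure ν) := by
  have h1 : eLpNorm f (ENNReal.ofReal q) (weightMeasure ν) ≤ B ^ (1 / q) := by
    rw [eLpNorm_ofReal_eq _ _ hq]
    exact ENNReal.rpow_le_rpow hup (by positivity)
  refine ⟨⟨hf.aestronglyMeasurable, h1.trans_lt ?_⟩, h1, ?_⟩
  · exact (ENNReal.rpow_ne_top_of_nonneg (by positivity) hB).lt_top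
  · rw [eLpNorm_ofReal_eq _ _ hq]
    exact mul_rpow_one_div_le hq hlow

/-! ### The power weight itself -/

/-- The function `|y|^{nε}` on the unit ball. -/
def powBump (n : ℕ) (ε : ℝ) : Rn n → ℝ :=
  (Metric.ball (0 : Rn n) 1).indicator fun y => ‖y‖ ^ (n * ε)

lemma measurable_powBump (n : ℕ) (ε : ℝ) : Measurable (powBump n ε) :=
  Measurable.indicator (by fun_prop) measurableSet_unitBall

lemma powBump_nonneg (y : Rn n) : 0 ≤ powBump n ε y :=
  Set.indicator_nonneg (fun y _ => Real.rpow_nonneg (norm_nonneg y) _) y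

lemma powBump_le (hε : 0 < ε) (y : Rn n) :
    powBump n ε y ≤ (Metric.ball (0 : Rn n) 1).indicator 1 y := by
  refine Set.indicator_le_indicator' fun hy => ?_
  exact Real.rpow_le_one (norm_nonneg y) (mem_ball_zero_iff.1 hy).le (by positivity)

lemma integrable_powBump (hε : 0 < ε) : Integrable (powBump n ε) volume := by
  have h1 : Integrable ((Metric.ball (0 : Rn n) 1).indicator (1 : Rn n → ℝ)) volume :=
    (integrable_indicator_iff measurableSet_unitBall).2
      (integrableOn_const (C := (1 : ℝ)) measure_ball_lt_top.ne)
  refine h1.mono' (measurable_powBump n ε).aestronglyMeasurable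
    (Filter.Eventually.of_forall fun y => ?_)
  rw [Real.norm_of_nonneg (powBump_nonneg y)]
  exact powBump_le hε y

lemma lintegral_powBump_le (hn : 1 ≤ n) (hq : 0 < q) (hε : 0 < ε) :
    ∫⁻ x, ‖powBump n ε x‖ₑ ^ q ∂(weightMeasure (powWeight n ε)) ≤
      ENNReal.ofReal (ballVol n / ε) := by
  rw [lintegral_univ_weightMeasure (measurable_powWeight n ε)
    ((measurable_powBump n ε).enorm.pow_const q), ← lintegral_unitBall_powWeight hn hε,
    ← lintegral_indicator measurableSet_unitBall]
  refine lintegral_mono fun x => ?_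
  have h1 := powBump_le (n := n) hε x
  have h0 := powBump_nonneg (n := n) (ε := ε) x
  rw [← ofReal_norm, Real.norm_of_nonneg h0]
  by_cases hx : x ∈ Metric.ball (0 : Rn n) 1
  · rw [Set.indicator_of_mem hx] at h1 ⊢
    refine mul_le_of_le_one_right' ?_
    refine ENNReal.rpow_le_one ?_ hq.le
    rw [← ENNReal.ofReal_one]
    exact ENNReal.ofReal_le_ofReal h1
  · rw [Set.indicator_of_notMem hx] at h1 ⊢
    rw [le_antisymm h1 h0, ENNReal.ofReal_zero, ENNReal.zero_rpow_of_pos hq, mul_zero]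

/-- The radius satisfies `r ^ (n ε) = 1 / 2`, so the shell between `r` and `1` carries half of the
mass of the power weight. For `z` in the inner ball and `y` in the shell, `|z| + |y| ≤ 2 |y|`, and
kernel times bump is at least `2 ^ (-n)` times the power weight at `y`. -/
lemma le_hardyOp_powBump (hn : 1 ≤ n) (hε : 0 < ε) {r : ℝ} (hr0 : 0 ≤ r) (hr1 : r ≤ 1)
    (hr : r ^ (n * ε) = 1 / 2) {z : Rn n} (hz : z ∈ Metric.ball (0 : Rn n) r) :
    ENNReal.ofReal (ballVol n / (2 * 2 ^ n) / ε) ≤ hardyOp (powBump n ε) z := by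
  have hV := ballVol_pos n
  have hzr : ‖z‖ < r := by simpa using hz
  have hrpos : 0 < r := (norm_nonneg z).trans_lt hzr
  set S := Metric.ball (0 : Rn n) 1 \ Metric.ball (0 : Rn n) r with hS
  have hSm : MeasurableSet S := measurableSet_unitBall.diff Metric.isOpen_ball.measurableSet
  have hshell : ENNReal.ofReal (ballVol n / 2 / ε) ≤
      ∫⁻ y in S, ENNReal.ofReal (powWeight n ε y) := by
    have h1 := lintegral_inter_add_sdiff (fun y => ENNReal.ofReal (powWeight n ε y))
      (Metric.ball (0 : Rn n) 1)
      (Metric.isOpen_ball (x := (0 : Rn n)) (ε := r)).measurableSet (μ := volume)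
    rw [Set.inter_eq_self_of_subset_right (Metric.ball_subset_ball hr1),
      lintegral_unitBall_powWeight hn hε, lintegral_ball_powWeight hn hε hr0, hr] at h1
    have e : ENNReal.ofReal (ballVol n / ε) = ENNReal.ofReal (ballVol n * (1 / 2) / ε) +
        ENNReal.ofReal (ballVol n / 2 / ε) := by
      rw [← ENNReal.ofReal_add (by positivity) (by positivity)]
      congr 1; ring
    rw [e] at h1
    exact ((ENNReal.add_right_inj ENNReal.ofReal_ne_top).1 h1).ge
  calc ENNReal.ofReal (ballVol n / (2 * 2 ^ n) / ε)
      = ENNReal.ofReal ((2 ^ n)⁻¹) * ENNReal.ofReal (ballVol n / 2 / ε) := by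
        rw [← ENNReal.ofReal_mul (by positivity)]
        congr 1
        field_simp
    _ ≤ ENNReal.ofReal ((2 ^ n)⁻¹) * ∫⁻ y in S, ENNReal.ofReal (powWeight n ε y) := by gcongr
    _ = ∫⁻ y in S, ENNReal.ofReal ((2 ^ n)⁻¹) * ENNReal.ofReal (powWeight n ε y) := by
        rw [lintegral_const_mul' _ _ ENNReal.ofReal_ne_top]
    _ ≤ ∫⁻ y in S, ENNReal.ofReal (hardyKernel n 0 z y) * ‖powBump n ε y‖ₑ := by
        refine setLIntegral_mono' hSm fun y hy => ?_
        have hy1 : r ≤ ‖y‖ := by simpa using hy.2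
        have hy0 : 0 < ‖y‖ := hrpos.trans_le hy1
        have hz0 := norm_nonneg z
        rw [← ofReal_norm, Real.norm_of_nonneg (powBump_nonneg y), powBump,
          Set.indicator_of_mem hy.1, ← ENNReal.ofReal_mul (by positivity),
          ← ENNReal.ofReal_mul (hardyKernel_nonneg le_rfl _ _)]
        refine ENNReal.ofReal_le_ofReal ?_
        rw [powWeight, Real.rpow_sub hy0, Real.rpow_natCast]
        calc (2 ^ n)⁻¹ * (‖y‖ ^ (n * ε) / ‖y‖ ^ n) = ((2 * ‖y‖) ^ n)⁻¹ * ‖y‖ ^ (n * ε) := by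
              rw [mul_pow]; field_simp
          _ ≤ _ := by
              refine mul_le_mul_of_nonneg_right ?_ (by positivity)
              refine inv_anti₀ (by positivity) (pow_le_pow_left₀ (by positivity) ?_ n)
              linarith
    _ ≤ _ := setLIntegral_le_lintegral _ _

lemma ofReal_two_pow (n : ℕ) : (2 : ℝ≥0∞) ^ n = ENNReal.ofReal (2 ^ n) := by
  rw [ENNReal.ofReal_pow (by norm_num)]; simp

lemma ofReal_le_of_le_two_pow_mul {a : ℝ} {N H : ℝ≥0∞} (h : H ≤ 2 ^ n * N)
    (ha : ENNReal.ofReal a ≤ H) : ENNReal.ofReal (a / 2 ^ n) ≤ N := by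
  rw [ENNReal.ofReal_div_of_pos (by positivity), ← ofReal_two_pow]
  exact ENNReal.div_le_of_le_mul' (ha.trans h)

/-- The inner ball, where the Hardy integral is at least a multiple of `1 / ε`, carries half of the
weight of the unit ball; that half is absorbed by halving the constant, as `2 ≤ 2 ^ q`. -/
lemma le_lintegral_ntMax_powBump (hn : 1 ≤ n) (hq : 1 < q) (hε : 0 < ε) {α : ℝ} (hα : 0 < α) :
    ENNReal.ofReal (ballVol n / (4 * 2 ^ n * 2 ^ n) / ε) ^ q * ENNReal.ofReal (ballVol n / ε) ≤
      ∫⁻ z, ntMax α (Sstar (hardyKernel n) (powBump n ε)) z ^ q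
        ∂(weightMeasure (powWeight n ε)) := by
  have hV := ballVol_pos n
  have hq0 : 0 < q := by linarith
  have hn0 : (0 : ℝ) < n := by exact_mod_cast hn
  set r : ℝ := (1 / 2) ^ (1 / (n * ε)) with hr
  have hr0 : 0 ≤ r := by positivity
  have hr1 : r ≤ 1 := Real.rpow_le_one (by norm_num) (by norm_num) (by positivity)
  have hrr : r ^ (n * ε) = 1 / 2 := by
    rw [hr, ← Real.rpow_mul (by norm_num), one_div_mul_cancel (by positivity), Real.rpow_one]
  have hBm : MeasurableSet (Metric.ball (0 : Rn n) r) := Metric.isOpen_ball.measurableSet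
  set c' := ballVol n / (2 * 2 ^ n) / ε / 2 ^ n with hc'
  have hc'0 : 0 ≤ c' := by positivity
  calc ENNReal.ofReal (ballVol n / (4 * 2 ^ n * 2 ^ n) / ε) ^ q * ENNReal.ofReal (ballVol n / ε)
      = ENNReal.ofReal ((c' / 2) ^ q * (ballVol n / ε)) := by
        rw [ENNReal.ofReal_rpow_of_nonneg (by positivity) hq0.le,
          ← ENNReal.ofReal_mul (by positivity)]
        congr 3
        rw [hc']; field_simp; norm_num
    _ ≤ ENNReal.ofReal (c' ^ q * (ballVol n * r ^ (n * ε) / ε)) := by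
        refine ENNReal.ofReal_le_ofReal ?_
        rw [hrr, Real.div_rpow hc'0 (by norm_num)]
        have h2 : (2 : ℝ) ≤ 2 ^ q := by
          conv_lhs => rw [← Real.rpow_one 2]
          exact Real.rpow_le_rpow_of_exponent_le (by norm_num) hq.le
        calc c' ^ q / 2 ^ q * (ballVol n / ε) ≤ c' ^ q / 2 * (ballVol n / ε) := by gcongr
          _ = _ := by ring
    _ = ENNReal.ofReal c' ^ q * weightMeasure (powWeight n ε) (Metric.ball (0 : Rn n) r) := by
        rw [weightMeasure_apply _ hBm, lintegral_ball_powWeight hn hε hr0,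
          ENNReal.ofReal_rpow_of_nonneg hc'0 hq0.le, ← ENNReal.ofReal_mul (by positivity)]
    _ = ∫⁻ _ in Metric.ball (0 : Rn n) r, ENNReal.ofReal c' ^ q
          ∂(weightMeasure (powWeight n ε)) := (setLIntegral_const _ _).symm
    _ ≤ ∫⁻ z in Metric.ball (0 : Rn n) r,
          ntMax α (Sstar (hardyKernel n) (powBump n ε)) z ^ q
          ∂(weightMeasure (powWeight n ε)) := by
        refine setLIntegral_mono_ae' hBm ?_
        have hae : ∀ᵐ z ∂(weightMeasure (powWeight n ε)), z ≠ 0 :=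
          (withDensity_absolutelyContinuous _ _).ae_le (ae_ne_zero hn)
        filter_upwards [hae] with z hz hzr
        refine ENNReal.rpow_le_rpow ?_ hq0.le
        exact ofReal_le_of_le_two_pow_mul
          (hardyOp_le_ntMax hα (integrable_powBump hε) powBump_nonneg hz)
          (le_hardyOp_powBump hn hε hr0 hr1 hrr hzr)
    _ ≤ _ := setLIntegral_le_lintegral _ _

/-! ### The dual of the power weight -/

/-- The power weight restricted to the unit ball. -/
def powWeightBall (n : ℕ) (ε : ℝ) : Rn n → ℝ :=
  (Metric.ball (0 : Rn n) 1).indicator (powWeight n ε)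

lemma measurable_powWeightBall (n : ℕ) (ε : ℝ) : Measurable (powWeightBall n ε) :=
  (measurable_powWeight n ε).indicator measurableSet_unitBall

lemma powWeightBall_nonneg (y : Rn n) : 0 ≤ powWeightBall n ε y :=
  Set.indicator_nonneg (fun y _ => powWeight_nonneg ε y) y

lemma enorm_powWeight (x : Rn n) : ‖powWeight n ε x‖ₑ = ENNReal.ofReal (powWeight n ε x) := by
  rw [← ofReal_norm, Real.norm_of_nonneg (powWeight_nonneg ε x)]

lemma integrable_powWeightBall (hn : 1 ≤ n) (hε : 0 < ε) :
    Integrable (powWeightBall n ε) volume := by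
  refine (integrable_indicator_iff measurableSet_unitBall).2
    ⟨(measurable_powWeight n ε).aestronglyMeasurable, ?_⟩
  rw [hasFiniteIntegral_iff_enorm]
  simp only [enorm_powWeight]
  rw [lintegral_unitBall_powWeight hn hε]
  exact ENNReal.ofReal_lt_top

lemma powWeight_dual_mul (hq : 0 < q) {x : Rn n} (hx : x ≠ 0) :
    ENNReal.ofReal (powWeight n ε x ^ (-(q - 1))) * ENNReal.ofReal (powWeight n ε x) ^ q =
      ENNReal.ofReal (powWeight n ε x) := by
  have h := powWeight_pos ε hx
  rw [ENNReal.ofReal_rpow_of_nonneg h.le hq.le, ← ENNReal.ofReal_mul (by positivity),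
    ← Real.rpow_add h]
  congr 1
  have : -(q - 1) + q = 1 := by ring
  rw [this, Real.rpow_one]

lemma lintegral_dual_powWeight (hn : 1 ≤ n) (hq : 0 < q) (hε : 0 < ε) :
    ∫⁻ x in Metric.ball (0 : Rn n) 1, ENNReal.ofReal (powWeight n ε x) ^ q
        ∂(weightMeasure fun x => powWeight n ε x ^ (-(q - 1))) =
      ENNReal.ofReal (ballVol n / ε) := by
  rw [lintegral_weightMeasure ((measurable_powWeight n ε).pow_const _)
    ((measurable_powWeight n ε).ennreal_ofReal.pow_const q) measurableSet_unitBall,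
    ← lintegral_unitBall_powWeight hn hε]
  refine lintegral_congr_ae (ae_restrict_of_ae ?_)
  filter_upwards [ae_ne_zero hn] with x hx using powWeight_dual_mul hq hx

lemma lintegral_powWeightBall (hn : 1 ≤ n) (hq : 0 < q) (hε : 0 < ε) :
    ∫⁻ x, ‖powWeightBall n ε x‖ₑ ^ q ∂(weightMeasure fun x => powWeight n ε x ^ (-(q - 1))) =
      ENNReal.ofReal (ballVol n / ε) := by
  rw [← lintegral_dual_powWeight hn hq hε, ← lintegral_indicator measurableSet_unitBall]
  refine lintegral_congr fun x => ?_
  by_cases hx : x ∈ Metric.ball (0 : Rn n) 1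
  · rw [powWeightBall, Set.indicator_of_mem hx, Set.indicator_of_mem hx, enorm_powWeight]
  · rw [powWeightBall, Set.indicator_of_notMem hx, Set.indicator_of_notMem hx, enorm_zero,
      ENNReal.zero_rpow_of_pos hq]

/-- The part `|y| < |z|` alone suffices: there the kernel is at least `(2 |z|) ^ (-n)`, and the
power weight integrates to a multiple of `|z| ^ (n ε) / ε`. The function is thus reproduced up to
the factor `1 / ε`, like an approximate eigenfunction. -/
lemma le_hardyOp_powWeightBall (hn : 1 ≤ n) (hε : 0 < ε) {z : Rn n} (hz0 : z ≠ 0)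
    (hz : z ∈ Metric.ball (0 : Rn n) 1) :
    ENNReal.ofReal (ballVol n / 2 ^ n / ε * powWeight n ε z) ≤ hardyOp (powWeightBall n ε) z := by
  have hV := ballVol_pos n
  have hz1 : ‖z‖ < 1 := by simpa using hz
  have hzp : 0 < ‖z‖ := norm_pos_iff.2 hz0
  have hBm : MeasurableSet (Metric.ball (0 : Rn n) ‖z‖) := Metric.isOpen_ball.measurableSet
  calc ENNReal.ofReal (ballVol n / 2 ^ n / ε * powWeight n ε z)
      = ENNReal.ofReal (((2 * ‖z‖) ^ n)⁻¹) *
        ENNReal.ofReal (ballVol n * ‖z‖ ^ (n * ε) / ε) := by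
        rw [← ENNReal.ofReal_mul (by positivity), powWeight, Real.rpow_sub hzp,
          Real.rpow_natCast, mul_pow]
        congr 1
        field_simp
    _ = ∫⁻ y in Metric.ball (0 : Rn n) ‖z‖,
          ENNReal.ofReal (((2 * ‖z‖) ^ n)⁻¹) * ENNReal.ofReal (powWeight n ε y) := by
        rw [lintegral_const_mul' _ _ ENNReal.ofReal_ne_top,
          lintegral_ball_powWeight hn hε hzp.le]
    _ ≤ ∫⁻ y in Metric.ball (0 : Rn n) ‖z‖,
          ENNReal.ofReal (hardyKernel n 0 z y) * ‖powWeightBall n ε y‖ₑ := by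
        refine setLIntegral_mono' hBm fun y hy => ?_
        have hy1 : ‖y‖ < ‖z‖ := by simpa using hy
        rw [powWeightBall, Set.indicator_of_mem (Metric.ball_subset_ball hz1.le hy),
          enorm_powWeight]
        gcongr
        unfold hardyKernel
        have := norm_nonneg y
        refine inv_anti₀ (by positivity) (pow_le_pow_left₀ (by positivity) ?_ n)
        linarith
    _ ≤ _ := setLIntegral_le_lintegral _ _

lemma le_lintegral_ntMax_powWeightBall (hn : 1 ≤ n) (hq : 0 < q) (hε : 0 < ε) {α : ℝ}
    (hα : 0 < α) :
    ENNReal.ofReal (ballVol n / (2 ^ n * 2 ^ n) / ε) ^ q * ENNReal.ofReal (ballVol n / ε) ≤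
      ∫⁻ z, ntMax α (Sstar (hardyKernel n) (powWeightBall n ε)) z ^ q
        ∂(weightMeasure fun x => powWeight n ε x ^ (-(q - 1))) := by
  have hV := ballVol_pos n
  set c := ballVol n / (2 ^ n * 2 ^ n) / ε with hc
  have hc0 : 0 ≤ c := by positivity
  rw [← lintegral_dual_powWeight hn hq hε, ← lintegral_const_mul' _ _
    (ENNReal.rpow_ne_top_of_nonneg hq.le ENNReal.ofReal_ne_top)]
  refine le_trans ?_ (setLIntegral_le_lintegral (Metric.ball (0 : Rn n) 1) _)
  refine setLIntegral_mono_ae' measurableSet_unitBall ?_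
  have hae : ∀ᵐ z ∂(weightMeasure fun x : Rn n => powWeight n ε x ^ (-(q - 1))), z ≠ 0 :=
    (withDensity_absolutelyContinuous _ _).ae_le (ae_ne_zero hn)
  filter_upwards [hae] with z hz hz1
  rw [← ENNReal.mul_rpow_of_nonneg _ _ hq.le, ← ENNReal.ofReal_mul hc0]
  refine ENNReal.rpow_le_rpow ?_ hq.le
  have h := ofReal_le_of_le_two_pow_mul
    (hardyOp_le_ntMax hα (integrable_powWeightBall hn hε) powWeightBall_nonneg hz)
    (le_hardyOp_powWeightBall hn hε hz hz1)
  convert h using 2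
  rw [hc]; field_simp

/-- For the kernel `(t + |x| + |y|)^{-n}` no power smaller than `max(1, 1/(q-1))` is possible. -/
theorem hardyKernel_not_weightedEstimate (hn : 1 ≤ n) (hqp : q.HolderConjugate p) {α β : ℝ}
    (hα : 0 < α) (hβ : β < max 1 (1 / (q - 1))) :
    ¬ WeightedEstimate (hardyKernel n) q α β := by
  have hq := hqp.lt
  have hq0 := hqp.pos
  have hq1 : 0 < q - 1 := hqp.sub_one_pos
  have hV := ballVol_pos n
  have hC := powConst_pos n
  have hA : ∀ ε : ℝ, 0 < ε → ENNReal.ofReal (ballVol n / ε) ^ (1 / q) ≠ 0 ∧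
      ENNReal.ofReal (ballVol n / ε) ^ (1 / q) ≠ ∞ := fun ε hε =>
    ⟨(ENNReal.rpow_pos (ENNReal.ofReal_pos.2 (by positivity)) ENNReal.ofReal_ne_top).ne',
      ENNReal.rpow_ne_top_of_nonneg (by positivity) ENNReal.ofReal_ne_top⟩
  rcases lt_max_iff.1 hβ with h | h
  -- Below power one: the power weight, of characteristic at most a multiple of `1 / ε`, with the
  -- bump.
  · refine not_weightedEstimate (γ := 1) (c := ballVol n / (4 * 2 ^ n * 2 ^ n)) (C := powConst n)
      hqp one_pos (by linarith) (by positivity) hC fun ε hε hε1 => ?_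
    obtain ⟨h1, h2, h3⟩ := sharpness_test hq0 ENNReal.ofReal_ne_top (measurable_powBump n ε)
      (lintegral_powBump_le hn hq0 hε) (le_lintegral_ntMax_powBump hn hq hε hα)
    refine ⟨_, _, _, isAqWeight_powWeight hn hq hε hε1, ?_, (hA ε hε).1, (hA ε hε).2, h1, h2, h3⟩
    rw [Real.rpow_one]
    exact aqChar_powWeight_le hn hq hε hε1
  -- Below power `1 / (q - 1)`: the weight with exponent `-(q - 1)`, tested on its own dual weight
  -- in the unit ball.
  · have hγ : (q - 1) * β < 1 := by
      rw [lt_div_iff₀ hq1] at h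
      linarith
    refine not_weightedEstimate (c := ballVol n / (2 ^ n * 2 ^ n)) (C := powConst n)
      hqp hq1 hγ (by positivity) hC fun ε hε hε1 => ?_
    obtain ⟨h1, h2, h3⟩ := sharpness_test hq0 ENNReal.ofReal_ne_top (measurable_powWeightBall n ε)
      (lintegral_powWeightBall hn hq0 hε).le (le_lintegral_ntMax_powWeightBall hn hq0 hε hα)
    exact ⟨_, _, _, isAqWeight_powWeight_rpow hn hq hε hε1,
      aqChar_powWeight_rpow_le hn hq hε hε1, (hA ε hε).1, (hA ε hε).2, h1, h2, h3⟩

end NTMax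
end

/-! ### The theorem -/

theorem theorem5p4 (n : ℕ) (hn : 1 ≤ n) (p q : ℝ) (hq : 1 < q) (hpq : 1 / p + 1 / q = 1) :
    -- the weighted estimate, for every admissible kernel and every aperture
    (∀ k : ℝ → NTMax.Rn n → NTMax.Rn n → ℝ, NTMax.Admissible k →
      -- the integral defining `S^* f` converges absolutely
      (∀ ν : NTMax.Rn n → ℝ, NTMax.IsAqWeight q ν →
        ∀ f : NTMax.Rn n → ℝ,
          MeasureTheory.MemLp f (ENNReal.ofReal q) (NTMax.weightMeasure ν) →
          ∀ (t : ℝ) (x : NTMax.Rn n), 0 < t →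
            MeasureTheory.Integrable (fun y => k t x y * f y) MeasureTheory.volume) ∧
      ∀ α : ℝ, 0 < α → NTMax.WeightedEstimate k q α (max 1 (p / q))) ∧
    -- sharpness: for some admissible kernel no smaller power is possible
    (∃ k : ℝ → NTMax.Rn n → NTMax.Rn n → ℝ, NTMax.Admissible k ∧
      ∀ α : ℝ, 0 < α → ∀ β : ℝ, β < max 1 (p / q) → ¬ NTMax.WeightedEstimate k q α β) := by
  have hqp := NTMax.holderConjugate_of hq hpq
  have e : p / q = 1 / (q - 1) := by
    have := hqp.sub_one_mul_conj
    have := hqp.sub_one_pos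
    have := hqp.pos
    field_simp
    linarith
  refine ⟨fun k hk => ⟨fun ν hν f hf t x ht => ?_, fun α hα => hk.weightedEstimate hn hqp hα⟩,
    NTMax.hardyKernel n, NTMax.hardyKernel_admissible hn, fun α hα β hβ => ?_⟩
  · obtain ⟨δ, C, hreg⟩ := hk.exists_regKernel
    exact hreg.integrable_of_isAqWeight hn hqp hν hf ht x
  · rw [e] at hβ
    exact NTMax.hardyKernel_not_weightedEstimate hn hqp hα hβ
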